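/- Let $L_1,L_2\ge 0$ and $D>0$. There is a constant $C$, depending only on $L_1,L_2,D$, such that the following holds for every $d\ge 1$, every $T\ge 2$ and every $\nu$. Let $\mathcal K\subseteq\mathbb R^d$ be a compact convex set with $\mathbf 0\in\mathcal K\subseteq\{\|x\|\le D\}$ and nonempty interior, contained in a box $\mathcal X=\prod_{i=1}^d[0,a_i]$. Let $\Phi:\operatorname{int}\mathcal K\to\mathbb R$ be a $\nu$-self-concordant barrier of $\mathcal K$: $\Phi$ is $C^3$ and convex, tends to $+\infty$ at every boundary point of $\mathcal K$, and for all $x\in\operatorname{int}\mathcal K$ and $h\in\mathbb R^d$ satisfies $|\nabla^3\Phi(x)[h,h,h]|\le 2(\nabla^2\Phi(x)[h,h])^{3/2}$ and $|\nabla\Phi(x)[h]|\le\nu^{1/2}(\nabla^2\Phi(x)[h,h])^{1/2}$. Let $f_1,\dots,f_T:\mathcal X\to\mathbb R_+$ be fixed in advance (oblivious adversary), each of them continuously differentiable, monotone ($x\ge y\Rightarrow f_t(x)\ge f_t(y)$), DR-submodular ($f_t(x+\lambda e_i)-f_t(x)\le f_t(y+\lambda e_i)-f_t(y)$ whenever $x\ge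 y$, $\lambda\ge0$ and these points lie in $\mathcal X$), $L_1$-Lipschitz and $L_2$-smooth ($\nabla f_t$ is $L_2$-Lipschitz) in the Euclidean norm, with $f_t(\mathbf 0)=0$. Set $$\eta=D^{-2}d^{-1}T^{-1/2},\qquad \delta=\min\{1,\,d^{1/4}T^{-1/8}\},\qquad L=\max\{1,\lfloor d^{-1/2}T^{1/4}\rfloor\},$$ and run the following algorithm $\mathtt{BanditDRSM}(\eta,\delta,L,\Phi)$. The rounds $1,\dots,T$ are divided into consecutive blocks of $L$ rounds (the last one cut off at $T$). Let $x_1\in\operatorname{int}\mathcal K$ be the point with $\nabla\Phi(x_1)=0$. In block $q=1,2,\dots$ draw independently (of each other and of the past) $t_q$ uniformly from $\{(q-1)L+1,\dots,qL\}$, $z_q\in[0,1]$ with density $e^{z-1}/(1-e^{-1})$, and $v_q$ uniformly from the unit sphere of $\mathbb R^d$, and let $H_q=(\nabla^2\Phi(x_q))^{-1/2}$. In round $t_q$ play $y_{t_q}=z_qx_q+\delta z_qH_qv_q$; in every other round $t$ of the block play $y_t=x_q$. At the end of the block set $$g_q=(1-1/e)\,\frac{d}{\delta z_q}\,f_{t_q}(y_{t_q})\,H_q^{-1}v_q\quad(g_q=0\text{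 if }z_q=0),\qquad x_{q+1}=\operatorname*{arg\,min}_{x\in\operatorname{int}\mathcal K}\Big(\sum_{s=1}^q\langle-\eta g_s,x\rangle+\Phi(x)\Big).$$ Then almost surely $y_t\in\mathcal K$ for all $t\le T$, every reward $f_t(y_t)$ is integrable, and the expected $(1-1/e)$-regret satisfies $$\max_{x^*\in\mathcal K}\mathbb E\Big[\sum_{t=1}^T\big((1-1/e)f_t(x^*)-f_t(y_t)\big)\Big]\le C\,\nu\,d^{1/2}\,T^{3/4}\log T .$$ -/

import Mathlib

open MeasureTheory ProbabilityTheory Set Filter Topology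

namespace DRSM

noncomputable section

/-- `ℝ^d` with the Euclidean norm. -/
abbrev Vec (d : ℕ) : Type := EuclideanSpace ℝ (Fin d)

/-! ### Self-concordant barriers -/

/-- `Φ` is a `ν`-self-concordant barrier of the convex set `K`. Only the values of `Φ` on the
(open) interior of `K` matter. -/
structure IsSelfConcordantBarrier {d : ℕ} (K : Set (Vec d)) (ν : ℝ) (Φ : Vec d → ℝ) : Prop where
  convex_set : Convex ℝ K
  nonempty_interior : (interior K).Nonempty
  nu_nonneg : 0 ≤ ν
  contDiffOn : ContDiffOn ℝ 3 Φ (interior K)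
  convexOn : ConvexOn ℝ (interior K) Φ
  blows_up : ∀ y ∈ frontier K, Tendsto Φ (𝓝[interior K] y) atTop
  third_le : ∀ x ∈ interior K, ∀ h : Vec d,
    |iteratedFDeriv ℝ 3 Φ x (fun _ => h)| ≤
      2 * (iteratedFDeriv ℝ 2 Φ x (fun _ => h)) ^ (3 / 2 : ℝ)
  first_le : ∀ x ∈ interior K, ∀ h : Vec d,
    |fderiv ℝ Φ x h| ≤ Real.sqrt ν * Real.sqrt (iteratedFDeriv ℝ 2 Φ x (fun _ => h))

/-! ### The reward functions -/

/-- The box `∏ i, [0, a i]`, the common domain of the reward functions. -/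
def box {d : ℕ} (a : Fin d → ℝ) : Set (Vec d) := {x | ∀ i, 0 ≤ x i ∧ x i ≤ a i}

/-- Monotone, DR-submodular, `L₁`-Lipschitz, `L₂`-smooth functions on the box with `f 0 = 0`.
The values of `f` outside the box are irrelevant; the derivative is the one within the box (which
has nonempty interior in all uses), so it is the usual derivative at interior points. -/
structure IsReward {d : ℕ} (a : Fin d → ℝ) (L₁ L₂ : ℝ) (f : Vec d → ℝ) : Prop where
  zero : f 0 = 0
  mono : ∀ x ∈ box a, ∀ y ∈ box a, (∀ i, y i ≤ x i) → f y ≤ f x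
  dr : ∀ x ∈ box a, ∀ y ∈ box a, (∀ i, y i ≤ x i) → ∀ (i : Fin d) (c : ℝ), 0 ≤ c →
    x + c • EuclideanSpace.single i (1 : ℝ) ∈ box a →
    f (x + c • EuclideanSpace.single i (1 : ℝ)) - f x ≤
      f (y + c • EuclideanSpace.single i (1 : ℝ)) - f y
  lipschitz : ∀ x ∈ box a, ∀ y ∈ box a, |f x - f y| ≤ L₁ * ‖x - y‖
  differentiable : DifferentiableOn ℝ f (box a)
  smooth : ∀ x ∈ box a, ∀ y ∈ box a,
    ‖fderivWithin ℝ f (box a) x - fderivWithin ℝ f (box a) y‖ ≤ L₂ * ‖x - y‖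

/-! ### The random choices of the algorithm -/

/-- The uniform distribution on the unit sphere of `ℝ^d`. -/
def sphereLaw (d : ℕ) : Measure (Metric.sphere (0 : Vec d) 1) :=
  ProbabilityTheory.cond (volume : Measure (Vec d)).toSphere univ

/-- The distribution with `P (Z ≤ z) = ∫_0^z e^(u-1) / (1 - e^(-1)) 1[u ∈ [0, 1]] du`. -/
def zLaw : Measure ℝ :=
  (volume.restrict (Icc (0 : ℝ) 1)).withDensity
    (fun u => ENNReal.ofReal (Real.exp (u - 1) / (1 - Real.exp (-1))))

/-- The random choices made in one block: the (0-based) position of the exploration round inside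
the block, the scaling `z`, and the direction `v`. -/
abbrev Seed (d : ℕ) : Type := ℕ × ℝ × Metric.sphere (0 : Vec d) 1

/-- The joint law of the three independent choices made in one block of length `L`. -/
def seedLaw (d L : ℕ) : Measure (Seed d) :=
  (uniformOn (Finset.range L : Set ℕ)).prod (zLaw.prod (sphereLaw d))

instance instProbSphereLaw (d : ℕ) [NeZero d] : IsProbabilityMeasure (sphereLaw d) := by
  have : Nontrivial (Vec d) := by
    have : Nonempty (Fin d) := ⟨0⟩
    infer_instance
  unfold sphereLaw
  apply cond_isProbabilityMeasure
  rw [Ne, Measure.measure_univ_eq_zero]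
  exact Measure.toSphere_ne_zero _

instance instProbZLaw : IsProbabilityMeasure zLaw := by
  constructor
  have hpos : (0 : ℝ) < 1 - Real.exp (-1) := by
    have : Real.exp (-1) < 1 := by rw [Real.exp_lt_one_iff]; norm_num
    linarith
  have hcont : Continuous (fun u : ℝ => Real.exp (u - 1) / (1 - Real.exp (-1))) := by fun_prop
  rw [zLaw, withDensity_apply _ MeasurableSet.univ, Measure.restrict_univ,
    ← ofReal_integral_eq_lintegral_ofReal (hcont.continuousOn.integrableOn_compact isCompact_Icc)
      (Eventually.of_forall fun u => by positivity),
    integral_Icc_eq_integral_Ioc, ← intervalIntegral.integral_of_le zero_le_one,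
    intervalIntegral.integral_div, intervalIntegral.integral_comp_sub_right (fun u => Real.exp u),
    integral_exp]
  norm_num
  exact hpos.ne'

instance instProbSeedLaw (d L : ℕ) [NeZero d] [NeZero L] :
    IsProbabilityMeasure (seedLaw d L) := by
  have : IsProbabilityMeasure (uniformOn (Finset.range L : Set ℕ)) :=
    isProbabilityMeasure_uniformOn (Finset.finite_toSet _)
      ⟨0, by simpa using Nat.pos_of_ne_zero (NeZero.ne L)⟩
  unfold seedLaw
  infer_instance

/-- The random tape of a run: independent seeds, one for each block. -/
def tapeLaw (d L : ℕ) [NeZero d] [NeZero L] : Measure (ℕ → Seed d) :=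
  Measure.infinitePi (fun _ : ℕ => seedLaw d L)

/-! ### The algorithm -/

/-- The Hessian matrix of `Φ` at `x`. -/
def hessMatrix {d : ℕ} (Φ : Vec d → ℝ) (x : Vec d) : Matrix (Fin d) (Fin d) ℝ :=
  Matrix.of fun i j => iteratedFDeriv ℝ 2 Φ x
    ![EuclideanSpace.single i (1 : ℝ), EuclideanSpace.single j (1 : ℝ)]

/-- The matrix `H = (∇² Φ (x)) ^ (-1/2)` (functional calculus of symmetric matrices). -/
def ellipsoid {d : ℕ} (Φ : Vec d → ℝ) (x : Vec d) : Matrix (Fin d) (Fin d) ℝ :=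
  cfc (fun s : ℝ => s ^ (-(1 / 2) : ℝ)) (hessMatrix Φ x)

open Classical in
/-- A minimizer of `φ` over `S` (the minimizer, where it is unique; `0` if there is none). -/
def argminOn {d : ℕ} (S : Set (Vec d)) (φ : Vec d → ℝ) : Vec d :=
  if h : ∃ x ∈ S, IsMinOn φ S x then h.choose else 0

/-- Regularized follow the leader: the minimizer of `⟨-η G, x⟩ + Φ x`, where `G` is the sum of the
gradient estimates so far. The barrier is `+∞` off the interior of `K`. For `G = 0` this is the
minimizer of `Φ`, i.e. the point of the interior with `∇ Φ = 0`. -/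
def rftl {d : ℕ} (K : Set (Vec d)) (Φ : Vec d → ℝ) (η : ℝ) (G : Vec d) : Vec d :=
  argminOn (interior K) (fun x => inner ℝ (-η • G) x + Φ x)

/-- The exploratory action `z x + δ z H v`. -/
def exploreAction {d : ℕ} (Φ : Vec d → ℝ) (δ : ℝ) (x : Vec d) (s : Seed d) : Vec d :=
  s.2.1 • x + (δ * s.2.1) • Matrix.toEuclideanLin (ellipsoid Φ x) (s.2.2 : Vec d)

/-- The gradient estimate `(1 - 1/e) (d / (δ z)) r H⁻¹ v` built from the observed reward `r`
(it is `0` when `z = 0`). -/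
def gradEstimate {d : ℕ} (Φ : Vec d → ℝ) (δ : ℝ) (x : Vec d) (s : Seed d) (r : ℝ) : Vec d :=
  ((1 - 1 / Real.exp 1) * (d / (δ * s.2.1)) * r) •
    Matrix.toEuclideanLin (ellipsoid Φ x)⁻¹ (s.2.2 : Vec d)

/-- The sum of the gradient estimates of the first `q` blocks. Rounds and blocks are numbered
from `0`; block `q` consists of the rounds `q L, …, q L + L - 1`, and its exploration round is
`q L + (ω q).1`. The rewards `f` enter only through the reward observed in that round. -/
def gradSum {d : ℕ} (K : Set (Vec d)) (Φ : Vec d → ℝ) (η δ : ℝ) (L : ℕ) (f : ℕ → Vec d → ℝ)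
    (ω : ℕ → Seed d) : ℕ → Vec d
  | 0 => 0
  | q + 1 =>
    let G := gradSum K Φ η δ L f ω q
    let x := rftl K Φ η G
    let r := f (q * L + (ω q).1) (exploreAction Φ δ x (ω q))
    G + gradEstimate Φ δ x (ω q) r

/-- The action that `BanditDRSM` with parameters `η, δ, L, Φ` plays in round `t` on the tape `ω`
against the reward functions `f`. -/
def banditDRSM {d : ℕ} (K : Set (Vec d)) (Φ : Vec d → ℝ) (η δ : ℝ) (L : ℕ) (f : ℕ → Vec d → ℝ)
    (t : ℕ) (ω : ℕ → Seed d) : Vec d :=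
  let q := t / L
  let x := rftl K Φ η (gradSum K Φ η δ L f ω q)
  if t % L = (ω q).1 then exploreAction Φ δ x (ω q) else x

/-! ### Parameters and regret -/

/-- The block length `d^(-1/2) T^(1/4)`, rounded down to a positive integer. -/
def blockLength (d T : ℕ) : ℕ :=
  max 1 ⌊(d : ℝ) ^ (-(1 / 2) : ℝ) * (T : ℝ) ^ (1 / 4 : ℝ)⌋₊

instance instNeZeroBlockLength (d T : ℕ) : NeZero (blockLength d T) :=
  ⟨(lt_of_lt_of_le Nat.one_pos (le_max_left 1 _)).ne'⟩

/-- The smoothing radius `d^(1/4) T^(-1/8)`, capped at `1`; the cap is active only if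
`d^(-1/2) T^(1/4) < 1`. -/
def smoothingRadius (d T : ℕ) : ℝ :=
  min 1 ((d : ℝ) ^ (1 / 4 : ℝ) * (T : ℝ) ^ (-(1 / 8) : ℝ))

/-- The learning rate `D^(-2) d^(-1) T^(-1/2)`. -/
def learningRate (D : ℝ) (d T : ℕ) : ℝ :=
  D ^ (-2 : ℝ) * (d : ℝ) ^ (-1 : ℝ) * (T : ℝ) ^ (-(1 / 2) : ℝ)

/-- The expected `α`-regret `sup_{x ∈ K} E [∑_{t < T} (α f_t x - f_t y_t)]` of the random actions
`y_t`, as an extended real so that the supremum carries no convention. -/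
def expectedRegret {d : ℕ} {Ω : Type*} [MeasurableSpace Ω] (P : Measure Ω) (α : ℝ)
    (K : Set (Vec d)) (f : ℕ → Vec d → ℝ) (y : ℕ → Ω → Vec d) (T : ℕ) : EReal :=
  ⨆ x ∈ K, ((∫ ω, ∑ t ∈ Finset.range T, (α * f t x - f t (y t ω)) ∂P : ℝ) : EReal)

end

end DRSM

/-!
The proof compares the algorithm with online linear optimization for a surrogate of the rewards.

*Surrogate.* A monotone DR-submodular `f` satisfies `f y - f x ≤ ⟨∇f x, y⟩`, as it is concave along
nonnegative directions. If `f 0 = 0`, an integration by parts in `z` gives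
`(1 - 1/e) f y - f x ≤ (1 - 1/e) E[⟨∇f (z x), y - x⟩]` for `z ∼ zLaw`
(`IsExtendedReward.le_integral_fderiv`). Hence an unbiased estimate of `(1 - 1/e) ∇f (z x)` for one
random `z` per block is enough.

*Estimator.* By the divergence theorem on the unit ball (`integral_sphere_mul_inner`, proved
by polar coordinates), the one-point estimate `d / (δ z) f (z x + δ z H v) H⁻¹ v` averages
`∇f` over `z (x + δ H B)`, where `B` is the unit ball. As `H = (∇²Φ x) ^ (-1/2)`, the ellipsoid
`x + δ H B` lies in the Dikin ellipsoid of `x`, hence in `K`. The uniform law on the ball is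
symmetric, so the first-order error cancels and the bias is quadratic in `δ`
(`IsExtendedReward.le_integral_estimator`).

*Follow the leader.* The optimal values of the regularized linear problems telescope. Restricted to
a line, the inverse square root of the Hessian of a self-concordant function is `1`-Lipschitz, so
`Φ` exceeds its tangent by at least `r - log (1 + r)` at local distance `r`. The local dual norm of
`η g_q` is at most `η d L₁ D / δ`, and `a r - (r - log (1 + r)) ≤ a ^ 2` for `a ≤ 1/2`, so one
step costs at most the square of it (`IsSelfConcordantBarrier.rftl_regret`). At the comparator,
moved towards the minimizer of `Φ` by the fraction `1 / T`, the barrier exceeds its minimum by at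
most `ν log T` (`IsSelfConcordantBarrier.apply_line_sub_le`).

*Expectation.* The state at the beginning of a block is a function of the seeds of the earlier
blocks, so it is independent of the seed of the block, and the estimator may be integrated with the
state frozen. In the other rounds the state itself is played, and the uniformly chosen round
represents the block (`IsInstance.expected_regret_le`).

*Parameters.* If `δ` is capped, or if the step is too large for the stability estimate, then the
trivial bound `T L₁ D` is of the required order. A barrier of a bounded set has `ν ≥ 1/2`
(`IsSelfConcordantBarrier.half_le_nu`), so `ν log T` absorbs all constants.
-/

namespace DRSM

noncomputable section

/-! ### Self-concordant functions along a line -/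

/-- The Hessian quadratic form `∇² Φ (x) [h, h]`, the square of the local norm of `h` at `x`. -/
def hessForm {d : ℕ} (Φ : Vec d → ℝ) (x h : Vec d) : ℝ := iteratedFDeriv ℝ 2 Φ x (fun _ => h)

/-- If `|w'| ≤ 2 w ^ (3 / 2)`, then `(w + ε) ^ (-1 / 2)` is `1`-Lipschitz; the shift by `ε` allows
`w` to vanish. -/
lemma abs_inv_sqrt_sub_le {w w' : ℝ → ℝ} {b ε : ℝ} (hb : 0 ≤ b) (hε : 0 < ε)
    (hw : ∀ t ∈ Icc 0 b, HasDerivAt w (w' t) t) (h0 : ∀ t ∈ Icc 0 b, 0 ≤ w t)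
    (h1 : ∀ t ∈ Icc 0 b, |w' t| ≤ 2 * w t ^ (3 / 2 : ℝ)) :
    |(√(w b + ε))⁻¹ - (√(w 0 + ε))⁻¹| ≤ b := by
  have key := (convex_Icc (0 : ℝ) b).norm_image_sub_le_of_norm_hasDerivWithin_le
    (f := fun t => (√(w t + ε))⁻¹) (f' := fun t => -(w' t / (2 * √(w t + ε))) / √(w t + ε) ^ 2)
    (C := 1) (x := 0) (y := b) ?_ ?_ ⟨le_rfl, hb⟩ ⟨hb, le_rfl⟩
  · simpa [Real.norm_eq_abs, abs_of_nonneg hb] using key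
  · intro t ht
    have hpos : 0 < w t + ε := by linarith [h0 t ht]
    exact ((((hw t ht).add_const ε).sqrt hpos.ne').inv (Real.sqrt_pos.2 hpos).ne').hasDerivWithinAt
  · intro t ht
    have hwt := h0 t ht
    have hpos : 0 < √(w t + ε) := Real.sqrt_pos.2 (by linarith)
    rw [Real.norm_eq_abs, abs_div, abs_neg, abs_div,
      abs_of_pos (by positivity : 0 < 2 * √(w t + ε)),
      abs_of_pos (by positivity : 0 < √(w t + ε) ^ 2), div_div, div_le_one (by positivity)]
    refine (h1 t ht).trans ?_
    have h3 : w t ^ (3 / 2 : ℝ) = √(w t) ^ 3 := by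
      rw [Real.sqrt_eq_rpow, ← Real.rpow_natCast, ← Real.rpow_mul hwt]; norm_num
    have h4 : √(w t) ≤ √(w t + ε) := Real.sqrt_le_sqrt (by linarith)
    rw [h3]
    calc 2 * √(w t) ^ 3 ≤ 2 * √(w t + ε) ^ 3 := by gcongr
      _ = _ := by ring

section Barrier

variable {d : ℕ} {K : Set (Vec d)} {ν : ℝ} {Φ : Vec d → ℝ}

lemma IsSelfConcordantBarrier.contDiffAt (hΦ : IsSelfConcordantBarrier K ν Φ) {x : Vec d}
    (hx : x ∈ interior K) : ContDiffAt ℝ 3 Φ x :=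
  hΦ.contDiffOn.contDiffAt (isOpen_interior.mem_nhds hx)

lemma hasDerivAt_add_smul (x h : Vec d) (t : ℝ) : HasDerivAt (fun t : ℝ => x + t • h) h t := by
  simpa using ((hasDerivAt_id t).smul_const h).const_add x

lemma IsSelfConcordantBarrier.hasDerivAt_line (hΦ : IsSelfConcordantBarrier K ν Φ) {x h : Vec d}
    {t : ℝ} (hx : x + t • h ∈ interior K) :
    HasDerivAt (fun t : ℝ => Φ (x + t • h)) (fderiv ℝ Φ (x + t • h) h) t :=
  (((hΦ.contDiffAt hx).differentiableAt (by norm_num)).hasFDerivAt).comp_hasDerivAt t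
    (hasDerivAt_add_smul x h t)

lemma IsSelfConcordantBarrier.hasDerivAt_fderiv_line (hΦ : IsSelfConcordantBarrier K ν Φ)
    {x h : Vec d} {t : ℝ} (hx : x + t • h ∈ interior K) :
    HasDerivAt (fun t : ℝ => fderiv ℝ Φ (x + t • h) h) (hessForm Φ (x + t • h) h) t := by
  have h1 : DifferentiableAt ℝ (fderiv ℝ Φ) (x + t • h) :=
    ((hΦ.contDiffAt hx).fderiv_right (m := 2) (by norm_num)).differentiableAt (by norm_num)
  have h2 : HasDerivAt (fun t : ℝ => fderiv ℝ Φ (x + t • h))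
      (fderiv ℝ (fderiv ℝ Φ) (x + t • h) h) t :=
    h1.hasFDerivAt.comp_hasDerivAt t (hasDerivAt_add_smul x h t)
  have h3 := (ContinuousLinearMap.apply ℝ ℝ h).hasFDerivAt.comp_hasDerivAt t h2
  rw [hessForm, iteratedFDeriv_two_apply]
  exact h3

lemma IsSelfConcordantBarrier.hasDerivAt_hessForm_line (hΦ : IsSelfConcordantBarrier K ν Φ)
    {x h : Vec d} {t : ℝ} (hx : x + t • h ∈ interior K) :
    HasDerivAt (fun t : ℝ => hessForm Φ (x + t • h) h)
      (iteratedFDeriv ℝ 3 Φ (x + t • h) (fun _ => h)) t := by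
  have h1 : DifferentiableAt ℝ (iteratedFDeriv ℝ 2 Φ) (x + t • h) :=
    ((hΦ.contDiffAt hx).iteratedFDeriv_right (m := 1) (i := 2) (by norm_num)).differentiableAt
      (by norm_num)
  have h2 := h1.hasFDerivAt.comp_hasDerivAt t (hasDerivAt_add_smul x h t)
  have h3 := (ContinuousMultilinearMap.apply ℝ (fun _ : Fin 2 => Vec d) ℝ
    (fun _ => h)).hasFDerivAt.comp_hasDerivAt t h2
  rw [iteratedFDeriv_succ_apply_left]
  exact h3

lemma IsSelfConcordantBarrier.hessForm_nonneg (hΦ : IsSelfConcordantBarrier K ν Φ) {x : Vec d}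
    (hx : x ∈ interior K) (h : Vec d) : 0 ≤ hessForm Φ x h := by
  obtain ⟨r, hr, hball⟩ := Metric.isOpen_iff.1
    (isOpen_interior.preimage (f := fun t : ℝ => x + t • h) (by fun_prop)) 0 (by simpa using hx)
  have hconv : ConvexOn ℝ (Metric.ball (0 : ℝ) r) (fun t : ℝ => Φ (x + t • h)) := by
    refine ⟨convex_ball _ _, fun s hs t ht a b ha hb hab => ?_⟩
    have := hΦ.convexOn.2 (hball hs) (hball ht) ha hb hab
    convert this using 2
    obtain rfl : b = 1 - a := by linarith
    simp only [smul_eq_mul]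
    module
  have hmono : MonotoneOn (deriv fun t : ℝ => Φ (x + t • h)) (Metric.ball (0 : ℝ) r) :=
    hconv.monotoneOn_deriv fun t ht => (hΦ.hasDerivAt_line (hball ht)).differentiableAt
  have h0 : (0 : ℝ) ∈ Metric.ball (0 : ℝ) r := Metric.mem_ball_self hr
  have hd := hΦ.hasDerivAt_fderiv_line (hball h0)
  have heq : (fun t : ℝ => fderiv ℝ Φ (x + t • h) h) =ᶠ[𝓝 0] deriv fun t : ℝ => Φ (x + t • h) := by
    filter_upwards [Metric.ball_mem_nhds (0 : ℝ) hr] with t ht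
    exact (hΦ.hasDerivAt_line (hball ht)).deriv.symm
  have := (heq.hasDerivAt_iff.1 hd).hasDerivWithinAt (s := Metric.ball (0 : ℝ) r)
  have h2 := hmono.derivWithin_nonneg (x := (0 : ℝ))
  rw [this.derivWithin (Metric.isOpen_ball.uniqueDiffWithinAt h0)] at h2
  simpa using h2

lemma hessForm_smul (x h : Vec d) (c : ℝ) : hessForm Φ x (c • h) = c ^ 2 * hessForm Φ x h := by
  have := (iteratedFDeriv ℝ 2 Φ x).map_smul_univ (fun _ => c) (fun _ => h)
  simpa [hessForm] using this

lemma IsSelfConcordantBarrier.abs_inv_sqrt_hessForm_sub_le (hΦ : IsSelfConcordantBarrier K ν Φ)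
    {x h : Vec d} {b ε : ℝ} (hb : 0 ≤ b) (hε : 0 < ε)
    (hseg : ∀ t ∈ Icc 0 b, x + t • h ∈ interior K) :
    |(√(hessForm Φ (x + b • h) h + ε))⁻¹ - (√(hessForm Φ x h + ε))⁻¹| ≤ b := by
  simpa using abs_inv_sqrt_sub_le (w := fun t => hessForm Φ (x + t • h) h) hb hε
    (fun t ht => hΦ.hasDerivAt_hessForm_line (hseg t ht))
    (fun t ht => hΦ.hessForm_nonneg (hseg t ht) h) (fun t ht => hΦ.third_le _ (hseg t ht) h)

lemma IsSelfConcordantBarrier.add_smul_sub_mem (hΦ : IsSelfConcordantBarrier K ν Φ)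
    {x y : Vec d} (hx : x ∈ interior K) (hy : y ∈ closure K) {t : ℝ} (ht : t ∈ Ico (0 : ℝ) 1) :
    x + t • (y - x) ∈ interior K := by
  have := hΦ.convex_set.combo_interior_closure_mem_interior hx hy (a := 1 - t) (b := t)
    (by linarith [ht.2]) ht.1 (by ring)
  convert this using 1
  module

/-! ### The Dikin ellipsoid -/

/-- If a boundary point were at local distance less than `1` from `x`, the Hessian would stay
bounded on the segment towards it, and so would `Φ`. -/
lemma IsSelfConcordantBarrier.one_le_hessForm_of_frontier (hΦ : IsSelfConcordantBarrier K ν Φ)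
    {x y : Vec d} (hx : x ∈ interior K) (hy : y ∈ frontier K) : 1 ≤ hessForm Φ x (y - x) := by
  by_contra! hlt
  set h := y - x with hh
  have hseg : ∀ t ∈ Ico (0 : ℝ) 1, x + t • h ∈ interior K := fun t ht =>
    hΦ.add_smul_sub_mem hx (frontier_subset_closure hy) ht
  have hw0 := hΦ.hessForm_nonneg hx h
  obtain ⟨ε, hε, hs⟩ : ∃ ε : ℝ, 0 < ε ∧ hessForm Φ x h + ε < 1 :=
    ⟨(1 - hessForm Φ x h) / 2, by linarith, by linarith⟩
  set s := √(hessForm Φ x h + ε) with hsdef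
  have hspos : 0 < s := Real.sqrt_pos.2 (by linarith)
  have hs1 : s < 1 := by rw [hsdef, Real.sqrt_lt' one_pos]; simpa using hs
  have hκ : 0 < s⁻¹ - 1 := by have := (one_lt_inv₀ hspos).2 hs1; linarith
  set M := ((s⁻¹ - 1)⁻¹) ^ 2 with hM
  have hMpos : 0 < M := by positivity
  have hwM : ∀ t ∈ Ico (0 : ℝ) 1, hessForm Φ (x + t • h) h ≤ M := by
    intro t ht
    have h1 := abs_le.1 (hΦ.abs_inv_sqrt_hessForm_sub_le ht.1 hε
      fun u hu => hseg u ⟨hu.1, hu.2.trans_lt ht.2⟩)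
    have hp : 0 < hessForm Φ (x + t • h) h + ε := by linarith [hΦ.hessForm_nonneg (hseg t ht) h]
    have h2 : s⁻¹ - 1 ≤ (√(hessForm Φ (x + t • h) h + ε))⁻¹ := by linarith [h1.1, ht.2]
    have h3 : √(hessForm Φ (x + t • h) h + ε) ≤ (s⁻¹ - 1)⁻¹ :=
      (le_inv_comm₀ hκ (Real.sqrt_pos.2 hp)).1 h2
    have h4 := Real.sq_sqrt hp.le
    have h5 : √(hessForm Φ (x + t • h) h + ε) ^ 2 ≤ M := pow_le_pow_left₀ (Real.sqrt_nonneg _) h3 2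
    linarith
  have hp' : ∀ t ∈ Ico (0 : ℝ) 1, |fderiv ℝ Φ (x + t • h) h| ≤ |fderiv ℝ Φ x h| + M := by
    intro t ht
    have := (convex_Ico (0 : ℝ) 1).norm_image_sub_le_of_norm_hasDerivWithin_le
      (C := M) (x := 0) (y := t)
      (fun u hu => (hΦ.hasDerivAt_fderiv_line (hseg u hu)).hasDerivWithinAt)
      (fun u hu => by
        rw [Real.norm_eq_abs, abs_of_nonneg (hΦ.hessForm_nonneg (hseg u hu) h)]
        exact hwM u hu) ⟨le_rfl, one_pos⟩ ht
    simp only [zero_smul, add_zero, sub_zero, Real.norm_eq_abs, abs_of_nonneg ht.1] at this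
    have h3 := abs_sub_abs_le_abs_sub (fderiv ℝ Φ (x + t • h) h) (fderiv ℝ Φ x h)
    nlinarith [ht.1, ht.2]
  have hp : ∀ t ∈ Ico (0 : ℝ) 1, Φ (x + t • h) ≤ Φ x + (|fderiv ℝ Φ x h| + M) := by
    intro t ht
    have := (convex_Ico (0 : ℝ) 1).norm_image_sub_le_of_norm_hasDerivWithin_le
      (C := |fderiv ℝ Φ x h| + M) (x := 0) (y := t)
      (fun u hu => (hΦ.hasDerivAt_line (hseg u hu)).hasDerivWithinAt)
      (fun u hu => hp' u hu) ⟨le_rfl, one_pos⟩ ht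
    simp only [zero_smul, add_zero, sub_zero, Real.norm_eq_abs, abs_of_nonneg ht.1] at this
    have h3 := (le_abs_self _).trans this
    nlinarith [ht.1, ht.2, abs_nonneg (fderiv ℝ Φ x h)]
  have hI : ∀ᶠ t in 𝓝[<] (1 : ℝ), t ∈ Ico (0 : ℝ) 1 := by
    filter_upwards [Ioo_mem_nhdsLT (zero_lt_one (α := ℝ))] with t ht using ⟨ht.1.le, ht.2⟩
  have htend : Tendsto (fun t : ℝ => x + t • h) (𝓝[<] 1) (𝓝[interior K] y) := by
    refine tendsto_nhdsWithin_iff.2 ⟨?_, hI.mono hseg⟩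
    have : Tendsto (fun t : ℝ => x + t • h) (𝓝 1) (𝓝 (x + (1 : ℝ) • h)) :=
      Continuous.tendsto (by fun_prop) 1
    rw [one_smul, hh, add_sub_cancel] at this
    exact this.mono_left nhdsWithin_le_nhds
  have hev := ((hΦ.blows_up y hy).comp htend).eventually_gt_atTop (Φ x + (|fderiv ℝ Φ x h| + M))
  obtain ⟨t, ht, ht2⟩ := (hev.and hI).exists
  exact absurd (hp t ht2) (not_le.2 ht)

/-- The open Dikin ellipsoid lies in the interior. -/
lemma IsSelfConcordantBarrier.add_mem_interior (hΦ : IsSelfConcordantBarrier K ν Φ)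
    {x h : Vec d} (hx : x ∈ interior K) (hh : hessForm Φ x h < 1) : x + h ∈ interior K := by
  by_contra hnot
  have hne : (segment ℝ x (x + h) ∩ frontier (interior K)).Nonempty := by
    by_contra hemp
    have hcov : segment ℝ x (x + h) ⊆ interior K ∪ (closure (interior K))ᶜ := by
      intro z hz
      by_contra hz2
      simp only [mem_union, mem_compl_iff, not_or, not_not] at hz2
      exact hemp ⟨z, hz, hz2.2, by simpa using hz2.1⟩
    obtain ⟨z, -, hz1, hz2⟩ := (convex_segment x (x + h)).isPreconnected _ _ isOpen_interior
      isClosed_closure.isOpen_compl hcov ⟨x, left_mem_segment ℝ _ _, hx⟩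
      ⟨x + h, right_mem_segment ℝ _ _,
        (hcov (right_mem_segment ℝ _ _)).resolve_left hnot⟩
    exact hz2 (subset_closure hz1)
  obtain ⟨y, hy, hyf⟩ := hne
  rw [segment_eq_image'] at hy
  obtain ⟨s, hs, rfl⟩ := hy
  have h1 := hΦ.one_le_hessForm_of_frontier hx (frontier_interior_subset hyf)
  simp only [add_sub_cancel_left, hessForm_smul] at h1
  nlinarith [hs.1, hs.2, hΦ.hessForm_nonneg hx h, mul_le_one₀ hs.2 hs.1 hs.2]

lemma IsSelfConcordantBarrier.add_mem (hΦ : IsSelfConcordantBarrier K ν Φ) (hK : IsClosed K)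
    {x h : Vec d} (hx : x ∈ interior K) (hh : hessForm Φ x h ≤ 1) : x + h ∈ K := by
  have htend : Tendsto (fun t : ℝ => x + t • h) (𝓝[<] 1) (𝓝 (x + h)) := by
    have : Tendsto (fun t : ℝ => x + t • h) (𝓝 1) (𝓝 (x + (1 : ℝ) • h)) :=
      Continuous.tendsto (by fun_prop) 1
    rw [one_smul] at this
    exact this.mono_left nhdsWithin_le_nhds
  refine hK.mem_of_tendsto htend ?_
  filter_upwards [Ioo_mem_nhdsLT (zero_lt_one (α := ℝ))] with t ht
  refine interior_subset (hΦ.add_mem_interior hx ?_)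
  rw [hessForm_smul]
  have := hΦ.hessForm_nonneg hx h
  have h2 : t ^ 2 < 1 := by nlinarith [ht.1, ht.2]
  nlinarith [sq_nonneg t]

/-- Boundedness of `K` makes the Hessian positive definite, with an explicit lower bound. -/
lemma IsSelfConcordantBarrier.norm_sq_le_hessForm (hΦ : IsSelfConcordantBarrier K ν Φ)
    {D : ℝ} (hKD : K ⊆ Metric.closedBall 0 D) {x : Vec d} (hx : x ∈ interior K) (h : Vec d) :
    ‖h‖ ^ 2 ≤ D ^ 2 * hessForm Φ x h := by
  have hD : 0 ≤ D := by
    have := hKD (interior_subset hx)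
    rw [mem_closedBall_zero_iff] at this
    exact (norm_nonneg _).trans this
  have hw := hΦ.hessForm_nonneg hx h
  -- `x ± h` lie in the ball whenever `h` is in the open Dikin ellipsoid, hence so does `h`.
  have key : ∀ c : ℝ, 0 ≤ c → c ^ 2 * hessForm Φ x h < 1 → c * ‖h‖ ≤ D := by
    intro c hc hlt
    have h1 := hKD (interior_subset (hΦ.add_mem_interior (h := c • h) hx
      (by rwa [hessForm_smul])))
    have h2 := hKD (interior_subset (hΦ.add_mem_interior (h := (-c) • h) hx
      (by rw [hessForm_smul]; simpa using hlt)))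
    rw [mem_closedBall_zero_iff] at h1 h2
    have h3 : ‖(2 : ℝ) • (c • h)‖ ≤ 2 * D := by
      calc ‖(2 : ℝ) • (c • h)‖ = ‖(x + c • h) - (x + (-c) • h)‖ := by congr 1; module
        _ ≤ _ := norm_sub_le _ _
        _ ≤ _ := by linarith
    rw [norm_smul, norm_smul, Real.norm_eq_abs, Real.norm_eq_abs, abs_of_nonneg hc] at h3
    norm_num at h3
    linarith
  refine le_of_forall_pos_le_add fun ε hε => ?_
  set W := hessForm Φ x h
  have hη : 0 < ε / (D ^ 2 + 1) := by positivity
  set η := ε / (D ^ 2 + 1)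
  have hs : 0 < √(W + η) := Real.sqrt_pos.2 (by positivity)
  have hsq : √(W + η) ^ 2 = W + η := Real.sq_sqrt (by positivity)
  have h1 := key (√(W + η))⁻¹ (by positivity) (by
    rw [inv_pow, hsq, inv_mul_lt_one₀ (by positivity)]; linarith)
  have h2 : ‖h‖ ≤ D * √(W + η) := by
    rwa [inv_mul_le_iff₀ hs, mul_comm] at h1
  calc ‖h‖ ^ 2 ≤ (D * √(W + η)) ^ 2 := by gcongr
    _ = D ^ 2 * W + D ^ 2 * η := by rw [mul_pow, hsq]; ring
    _ ≤ D ^ 2 * W + (D ^ 2 + 1) * η := by gcongr; linarith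
    _ = D ^ 2 * W + ε := by rw [mul_div_cancel₀ _ (by positivity : D ^ 2 + 1 ≠ 0)]

/-! ### Growth of the barrier -/

/-- Along a line the Hessian decays at most quadratically in the local distance: the squared form
of the Lipschitz bound on its inverse square root. -/
lemma IsSelfConcordantBarrier.sq_le_hessForm_line (hΦ : IsSelfConcordantBarrier K ν Φ)
    {x h : Vec d} {b : ℝ} (hb : 0 ≤ b) (hseg : ∀ t ∈ Icc 0 b, x + t • h ∈ interior K) :
    (√(hessForm Φ x h) / (1 + b * √(hessForm Φ x h))) ^ 2 ≤ hessForm Φ (x + b • h) h := by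
  refine le_of_forall_pos_le_add fun ε hε => ?_
  have hw := hΦ.hessForm_nonneg (hseg b ⟨hb, le_rfl⟩) h
  have hw0 := hΦ.hessForm_nonneg (by simpa using hseg 0 ⟨le_rfl, hb⟩) h
  have h1 := (abs_le.1 (hΦ.abs_inv_sqrt_hessForm_sub_le hb hε hseg)).2
  set r := √(hessForm Φ x h)
  set s := √(hessForm Φ x h + ε)
  have hrs : r ≤ s := Real.sqrt_le_sqrt (by linarith)
  have hr : 0 ≤ r := Real.sqrt_nonneg _
  have hs : 0 < s := Real.sqrt_pos.2 (by linarith)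
  have hu : 0 < √(hessForm Φ (x + b • h) h + ε) := Real.sqrt_pos.2 (by linarith)
  have h2 : (√(hessForm Φ (x + b • h) h + ε))⁻¹ ≤ (1 + b * s) / s := by
    have : (1 + b * s) / s = s⁻¹ + b := by field_simp
    linarith
  have h3 : s / (1 + b * s) ≤ √(hessForm Φ (x + b • h) h + ε) := by
    rw [inv_le_comm₀ hu (by positivity), inv_div] at h2
    exact h2
  have h4 : r / (1 + b * r) ≤ s / (1 + b * s) := by
    rw [div_le_div_iff₀ (by positivity) (by positivity)]
    nlinarith
  calc (r / (1 + b * r)) ^ 2 ≤ √(hessForm Φ (x + b • h) h + ε) ^ 2 := by gcongr; linarith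
    _ = _ := Real.sq_sqrt (by linarith)

/-- The lower bound `Φ (x + h) ≥ Φ x + ∇ Φ x h + r - log (1 + r)`, where `r` is the local norm of
`h` at `x`. -/
lemma IsSelfConcordantBarrier.le_apply_add (hΦ : IsSelfConcordantBarrier K ν Φ)
    {x h : Vec d} (hx : x ∈ interior K) (hxh : x + h ∈ interior K) :
    Φ x + fderiv ℝ Φ x h + (√(hessForm Φ x h) - Real.log (1 + √(hessForm Φ x h))) ≤ Φ (x + h) := by
  have hseg : ∀ t ∈ Icc (0 : ℝ) 1, x + t • h ∈ interior K := fun t ht => by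
    have := hΦ.convex_set.interior.add_smul_sub_mem hx hxh ht
    simpa using this
  set r := √(hessForm Φ x h)
  have hr : 0 ≤ r := Real.sqrt_nonneg _
  have hd1 : ∀ t ∈ Icc (0 : ℝ) 1, HasDerivAt
      (fun t => fderiv ℝ Φ (x + t • h) h - fderiv ℝ Φ x h - (r - r / (1 + t * r)))
      (hessForm Φ (x + t • h) h - (r / (1 + t * r)) ^ 2) t := by
    intro t ht
    have hpos : 0 < 1 + t * r := by have := mul_nonneg ht.1 hr; linarith
    have h1 : HasDerivAt (fun t => 1 + t * r) r t := by
      simpa using ((hasDerivAt_id t).mul_const r).const_add 1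
    have h2 := ((hΦ.hasDerivAt_fderiv_line (hseg t ht)).sub_const (fderiv ℝ Φ x h)).sub
      (((hasDerivAt_const t r).div h1 hpos.ne').const_sub r)
    refine h2.congr_deriv ?_
    field_simp
    ring
  have hd0 : ∀ t ∈ Icc (0 : ℝ) 1, HasDerivAt
      (fun t => Φ (x + t • h) - t * fderiv ℝ Φ x h - (t * r - Real.log (1 + t * r)))
      (fderiv ℝ Φ (x + t • h) h - fderiv ℝ Φ x h - (r - r / (1 + t * r))) t := by
    intro t ht
    have hpos : 0 < 1 + t * r := by have := mul_nonneg ht.1 hr; linarith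
    have h1 : HasDerivAt (fun t => 1 + t * r) r t := by
      simpa using ((hasDerivAt_id t).mul_const r).const_add 1
    have h2 := ((hΦ.hasDerivAt_line (hseg t ht)).sub
      ((hasDerivAt_id t).mul_const (fderiv ℝ Φ x h))).sub
      (((hasDerivAt_id t).mul_const r).sub (h1.log hpos.ne'))
    refine h2.congr_deriv ?_
    simp
  have hm1 : MonotoneOn
      (fun t => fderiv ℝ Φ (x + t • h) h - fderiv ℝ Φ x h - (r - r / (1 + t * r))) (Icc 0 1) := by
    refine monotoneOn_of_hasDerivWithinAt_nonneg (convex_Icc _ _)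
      (fun t ht => (hd1 t ht).continuousAt.continuousWithinAt)
      (fun t ht => (hd1 t (interior_subset ht)).hasDerivWithinAt) fun t ht => ?_
    have ht' := interior_subset ht
    exact sub_nonneg.2 (hΦ.sq_le_hessForm_line ht'.1 fun u hu => hseg u ⟨hu.1, hu.2.trans ht'.2⟩)
  have hm0 : MonotoneOn
      (fun t => Φ (x + t • h) - t * fderiv ℝ Φ x h - (t * r - Real.log (1 + t * r))) (Icc 0 1) := by
    refine monotoneOn_of_hasDerivWithinAt_nonneg (convex_Icc _ _)
      (fun t ht => (hd0 t ht).continuousAt.continuousWithinAt)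
      (fun t ht => (hd0 t (interior_subset ht)).hasDerivWithinAt) fun t ht => ?_
    have ht' := interior_subset ht
    simpa using hm1 ⟨le_rfl, zero_le_one⟩ ht' ht'.1
  have := hm0 ⟨le_rfl, zero_le_one⟩ ⟨zero_le_one, le_rfl⟩ zero_le_one
  simp only [zero_smul, add_zero, zero_mul, sub_zero, Real.log_one, one_smul, one_mul] at this
  linarith

/-- Along the segment from `x` to a point `y` of `K`, the derivative of the barrier at time `t` is
at most `ν / (1 - t)`: the reciprocal of a positive derivative decreases at rate at least `1 / ν`
and stays positive up to time `1`. -/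
lemma IsSelfConcordantBarrier.fderiv_line_le (hΦ : IsSelfConcordantBarrier K ν Φ)
    {x y : Vec d} (hx : x ∈ interior K) (hy : y ∈ closure K) {t : ℝ} (ht : t ∈ Ico (0 : ℝ) 1) :
    fderiv ℝ Φ (x + t • (y - x)) (y - x) ≤ ν / (1 - t) := by
  set h := y - x
  have hseg : ∀ t ∈ Ico (0 : ℝ) 1, x + t • h ∈ interior K := fun t ht =>
    hΦ.add_smul_sub_mem hx hy ht
  have h1t : 0 < 1 - t := by linarith [ht.2]
  set g := fun t : ℝ => fderiv ℝ Φ (x + t • h) h with hg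
  rcases le_or_gt (g t) 0 with hle | hpos
  · exact hle.trans (div_nonneg hΦ.nu_nonneg h1t.le)
  have hsub : Ico t 1 ⊆ Ico (0 : ℝ) 1 := Ico_subset_Ico_left ht.1
  have hmono : MonotoneOn g (Ico t 1) :=
    monotoneOn_of_hasDerivWithinAt_nonneg (convex_Ico _ _)
      (fun s hs => (hΦ.hasDerivAt_fderiv_line (hseg s (hsub hs))).continuousAt.continuousWithinAt)
      (fun s hs => (hΦ.hasDerivAt_fderiv_line
        (hseg s (hsub (interior_subset hs)))).hasDerivWithinAt)
      fun s hs => hΦ.hessForm_nonneg (hseg s (hsub (interior_subset hs))) h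
  have hgpos : ∀ s ∈ Ico t 1, 0 < g s := fun s hs =>
    hpos.trans_le (hmono ⟨le_rfl, ht.2⟩ hs hs.1)
  have hmono2 : MonotoneOn (fun s => -(ν * (g s)⁻¹) - s) (Ico t 1) := by
    have hd : ∀ s ∈ Ico t 1, HasDerivAt (fun s => -(ν * (g s)⁻¹) - s)
        (-(ν * (-hessForm Φ (x + s • h) h / g s ^ 2)) - 1) s := fun s hs =>
      ((((hΦ.hasDerivAt_fderiv_line (hseg s (hsub hs))).inv (hgpos s hs).ne').const_mul ν).neg).sub
        (hasDerivAt_id s)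
    refine monotoneOn_of_hasDerivWithinAt_nonneg (convex_Ico _ _)
      (fun s hs => (hd s hs).continuousAt.continuousWithinAt)
      (fun s hs => (hd s (interior_subset hs)).hasDerivWithinAt) fun s hs => ?_
    have hs' := interior_subset hs
    have hf := hΦ.first_le _ (hseg s (hsub hs')) h
    have hw := hΦ.hessForm_nonneg (hseg s (hsub hs')) h
    have h2 : g s ^ 2 ≤ ν * hessForm Φ (x + s • h) h := by
      rw [← sq_abs]
      calc |g s| ^ 2 ≤ (√ν * √(hessForm Φ (x + s • h) h)) ^ 2 := by gcongr; exact hf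
        _ = _ := by rw [mul_pow, Real.sq_sqrt hΦ.nu_nonneg, Real.sq_sqrt hw]
    have h3 : 1 ≤ ν * hessForm Φ (x + s • h) h / g s ^ 2 := by
      rwa [one_le_div (pow_pos (hgpos s hs') 2)]
    calc (0 : ℝ) ≤ ν * hessForm Φ (x + s • h) h / g s ^ 2 - 1 := by linarith
      _ = _ := by ring
  have hbound : ∀ s ∈ Ico t 1, s - t ≤ ν * (g t)⁻¹ := by
    intro s hs
    have := hmono2 ⟨le_rfl, ht.2⟩ hs hs.1
    simp only at this
    have h5 : 0 ≤ ν * (g s)⁻¹ := mul_nonneg hΦ.nu_nonneg (inv_nonneg.2 (hgpos s hs).le)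
    linarith
  have hlim : 1 - t ≤ ν * (g t)⁻¹ := by
    refine le_of_forall_lt fun c hc => ?_
    rcases lt_or_ge c 0 with hc0 | hc0
    · exact hc0.trans_le (mul_nonneg hΦ.nu_nonneg (inv_nonneg.2 hpos.le))
    · have := hbound (t + (c + (1 - t)) / 2) ⟨by linarith, by linarith⟩
      linarith
  rw [le_div_iff₀ h1t]
  calc g t * (1 - t) ≤ g t * (ν * (g t)⁻¹) := by gcongr
    _ = ν := by field_simp

/-- The barrier grows only logarithmically towards the boundary. -/
lemma IsSelfConcordantBarrier.apply_line_sub_le (hΦ : IsSelfConcordantBarrier K ν Φ)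
    {x y : Vec d} (hx : x ∈ interior K) (hy : y ∈ closure K) {t : ℝ} (ht : t ∈ Ico (0 : ℝ) 1) :
    Φ (x + t • (y - x)) - Φ x ≤ -(ν * Real.log (1 - t)) := by
  have hd : ∀ s ∈ Ico (0 : ℝ) 1, HasDerivAt
      (fun s => -(ν * Real.log (1 - s)) - Φ (x + s • (y - x)))
      (-(ν * (-1 / (1 - s))) - fderiv ℝ Φ (x + s • (y - x)) (y - x)) s := fun s hs =>
    (((((hasDerivAt_id s).const_sub 1).log
      (by simpa using (sub_pos.2 hs.2).ne')).const_mul ν).neg).sub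
      (hΦ.hasDerivAt_line (hΦ.add_smul_sub_mem hx hy hs))
  have hmono : MonotoneOn (fun s => -(ν * Real.log (1 - s)) - Φ (x + s • (y - x))) (Ico 0 1) := by
    refine monotoneOn_of_hasDerivWithinAt_nonneg (convex_Ico _ _)
      (fun s hs => (hd s hs).continuousAt.continuousWithinAt)
      (fun s hs => (hd s (interior_subset hs)).hasDerivWithinAt) fun s hs => ?_
    have := hΦ.fderiv_line_le hx hy (interior_subset hs)
    calc (0 : ℝ) ≤ ν / (1 - s) - fderiv ℝ Φ (x + s • (y - x)) (y - x) := by linarith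
      _ = _ := by ring
  have := hmono ⟨le_rfl, one_pos⟩ ht ht.1
  simp only [sub_zero, Real.log_one, mul_zero, neg_zero, zero_smul, add_zero] at this
  linarith

end Barrier

/-! ### Regularized follow the leader -/

/-- The convex conjugate of `r ↦ r - log (1 + r)` is at most `a ^ 2` for `a ≤ 1 / 2`. -/
lemma mul_sub_sq_le_sub_log {a r : ℝ} (ha : 0 ≤ a) (ha2 : a ≤ 1 / 2) (hr : 0 ≤ r) :
    a * r - a ^ 2 ≤ r - Real.log (1 + r) := by
  -- The supremum of `a r - r + log (1 + r)` is attained at `1 + r = 1 / (1 - a)`; the tangent of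
  -- `log` at that point gives the value `-a - log (1 - a)`.
  have h1 : Real.log ((1 + r) * (1 - a)) ≤ (1 + r) * (1 - a) - 1 :=
    Real.log_le_sub_one_of_pos (mul_pos (by linarith) (by linarith))
  rw [Real.log_mul (by linarith) (by linarith)] at h1
  have h2 : -(a + a ^ 2) ≤ Real.log (1 - a) := by
    rw [Real.le_log_iff_exp_le (by linarith), Real.exp_neg,
      inv_le_comm₀ (Real.exp_pos _) (by linarith)]
    refine le_trans ?_ (Real.quadratic_le_exp_of_nonneg (by positivity))
    rw [inv_le_iff_one_le_mul₀ (by linarith)]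
    nlinarith [sq_nonneg a, mul_nonneg ha ha, mul_nonneg (mul_nonneg ha ha) ha,
      mul_nonneg (mul_nonneg ha ha) (by linarith : 0 ≤ 1 / 2 - a),
      mul_nonneg (mul_nonneg (mul_nonneg ha ha) ha) (by linarith : 0 ≤ 1 / 2 - a),
      mul_nonneg (mul_nonneg (mul_nonneg (mul_nonneg ha ha) ha) ha) (by linarith : 0 ≤ 1 / 2 - a)]
  nlinarith

section Rftl

variable {d : ℕ} {K : Set (Vec d)} {ν : ℝ} {Φ : Vec d → ℝ} {D : ℝ}

lemma IsSelfConcordantBarrier.exists_isMinOn (hΦ : IsSelfConcordantBarrier K ν Φ)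
    (hK : IsCompact K) (c : Vec d) :
    ∃ x ∈ interior K, IsMinOn (fun x => inner ℝ c x + Φ x) (interior K) x := by
  obtain ⟨x₀, hx₀⟩ := hΦ.nonempty_interior
  obtain ⟨R, hR⟩ := hK.isBounded.exists_norm_le
  set Ψ : Vec d → ℝ := fun x => inner ℝ c x + Φ x with hΨ
  have hcont : ∀ x ∈ interior K, ContinuousAt Ψ x := fun x hx =>
    (by fun_prop : Continuous fun x : Vec d => inner ℝ c x).continuousAt.add
      (hΦ.contDiffAt hx).continuousAt
  set S := {x | x ∈ interior K ∧ Ψ x ≤ Ψ x₀}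
  have hSK : S ⊆ interior K := fun x hx => hx.1
  have hSclosed : IsClosed S := by
    refine isClosed_of_closure_subset fun x hx => ?_
    have : (𝓝[S] x).NeBot := mem_closure_iff_nhdsWithin_neBot.1 hx
    have hxK : x ∈ K := hK.isClosed.closure_subset_iff.2 (hSK.trans interior_subset) hx
    by_cases hxi : x ∈ interior K
    · exact ⟨hxi, le_of_tendsto ((hcont x hxi).tendsto.mono_left nhdsWithin_le_nhds)
        (eventually_nhdsWithin_of_forall fun y (hy : y ∈ S) => hy.2)⟩
    · exfalso
      have h1 := (hΦ.blows_up x ⟨subset_closure hxK, hxi⟩).mono_left (nhdsWithin_mono x hSK)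
      have h2 : ∀ᶠ y in 𝓝[S] x, Φ y ≤ Ψ x₀ + ‖c‖ * R := by
        refine eventually_nhdsWithin_of_forall fun y (hy : y ∈ S) => ?_
        have h3 := (abs_le.1 (abs_real_inner_le_norm c y)).1
        have h4 : ‖c‖ * ‖y‖ ≤ ‖c‖ * R := by
          gcongr
          exact hR y (interior_subset hy.1)
        have h5 : inner ℝ c y + Φ y ≤ Ψ x₀ := hy.2
        linarith
      obtain ⟨y, hy1, hy2⟩ := (h2.and (h1.eventually_gt_atTop _)).exists
      exact absurd hy1 (not_le.2 hy2)
  have hScomp : IsCompact S := hK.of_isClosed_subset hSclosed (hSK.trans interior_subset)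
  obtain ⟨x, hx, hmin⟩ := hScomp.exists_isMinOn ⟨x₀, hx₀, le_rfl⟩
    (fun y (hy : y ∈ S) => (hcont y hy.1).continuousWithinAt)
  refine ⟨x, hx.1, fun y hy => ?_⟩
  rcases le_total (Ψ y) (Ψ x₀) with h | h
  · exact hmin (show y ∈ S from ⟨hy, h⟩)
  · exact (hmin (show x₀ ∈ S from ⟨hx₀, le_rfl⟩)).trans h

lemma IsSelfConcordantBarrier.rftl_spec (hΦ : IsSelfConcordantBarrier K ν Φ) (hK : IsCompact K)
    (η : ℝ) (G : Vec d) :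
    rftl K Φ η G ∈ interior K ∧
      IsMinOn (fun x => inner ℝ (-η • G) x + Φ x) (interior K) (rftl K Φ η G) := by
  have h := hΦ.exists_isMinOn hK (-η • G)
  rw [rftl, argminOn, dif_pos h]
  exact h.choose_spec

lemma IsSelfConcordantBarrier.fderiv_eq_of_isMinOn (hΦ : IsSelfConcordantBarrier K ν Φ)
    {c x : Vec d} (hx : x ∈ interior K)
    (hmin : IsMinOn (fun x => inner ℝ c x + Φ x) (interior K) x) (h : Vec d) :
    fderiv ℝ Φ x h = -inner ℝ c h := by
  have h1 : IsLocalMin (fun x => inner ℝ c x + Φ x) x :=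
    hmin.isLocalMin (isOpen_interior.mem_nhds hx)
  have h2 : HasFDerivAt (fun x => inner ℝ c x + Φ x) (innerSL ℝ c + fderiv ℝ Φ x) x :=
    (innerSL ℝ c).hasFDerivAt.add
      ((hΦ.contDiffAt hx).differentiableAt (by norm_num)).hasFDerivAt
  have h3 := DFunLike.congr_fun (h1.hasFDerivAt_eq_zero h2) h
  simp only [add_apply, innerSL_apply_apply, zero_apply] at h3
  linarith

/-- Quantitative uniqueness of the minimizer: the objective grows with the local distance. -/
lemma IsSelfConcordantBarrier.le_of_isMinOn (hΦ : IsSelfConcordantBarrier K ν Φ)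
    {c x y : Vec d} (hx : x ∈ interior K)
    (hmin : IsMinOn (fun x => inner ℝ c x + Φ x) (interior K) x) (hy : y ∈ interior K) {a : ℝ}
    (ha : 0 ≤ a) (ha2 : a ≤ 1 / 2) :
    inner ℝ c x + Φ x + (a * √(hessForm Φ x (y - x)) - a ^ 2) ≤ inner ℝ c y + Φ y := by
  have h1 := hΦ.le_apply_add hx (h := y - x) (by simpa using hy)
  rw [hΦ.fderiv_eq_of_isMinOn hx hmin, inner_sub_right, add_sub_cancel] at h1
  have h2 := mul_sub_sq_le_sub_log ha ha2 (Real.sqrt_nonneg (hessForm Φ x (y - x)))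
  linarith

/-- The optimal value of the regularized objective, whose changes control the regret. -/
def rftlValue (K : Set (Vec d)) (Φ : Vec d → ℝ) (η : ℝ) (G : Vec d) : ℝ :=
  inner ℝ (-η • G) (rftl K Φ η G) + Φ (rftl K Φ η G)

lemma IsSelfConcordantBarrier.rftlValue_le (hΦ : IsSelfConcordantBarrier K ν Φ) (hK : IsCompact K)
    (η : ℝ) (G : Vec d) {u : Vec d} (hu : u ∈ interior K) :
    rftlValue K Φ η G ≤ inner ℝ (-η • G) u + Φ u :=
  (hΦ.rftl_spec hK η G).2 hu

/-- One step of regularized follow the leader: adding a gradient `g` whose dual local norm, scaled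
by `η`, is at most `a ≤ 1 / 2` changes the optimal value by its first-order variation up to
`a ^ 2`. -/
lemma IsSelfConcordantBarrier.le_rftlValue_add (hΦ : IsSelfConcordantBarrier K ν Φ)
    (hK : IsCompact K) (η : ℝ) (G g : Vec d) {a : ℝ} (ha : 0 ≤ a) (ha2 : a ≤ 1 / 2)
    (hg : ∀ h, η * inner ℝ g h ≤ a * √(hessForm Φ (rftl K Φ η G) h)) :
    rftlValue K Φ η G - η * inner ℝ g (rftl K Φ η G) - a ^ 2 ≤ rftlValue K Φ η (G + g) := by
  obtain ⟨hx, hmin⟩ := hΦ.rftl_spec hK η G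
  obtain ⟨hy, -⟩ := hΦ.rftl_spec hK η (G + g)
  have h1 := hΦ.le_of_isMinOn hx hmin hy ha ha2
  have h2 := hg (rftl K Φ η (G + g) - rftl K Φ η G)
  rw [inner_sub_right] at h2
  simp only [rftlValue, smul_add, inner_add_left, inner_smul_left] at h1 ⊢
  simp only [map_neg, conj_trivial] at h1 ⊢
  linarith

/-- The minimizer depends continuously on the gradient sum, which makes the states measurable. -/
lemma IsSelfConcordantBarrier.continuous_rftl (hΦ : IsSelfConcordantBarrier K ν Φ)
    (hK : IsCompact K) (hKD : K ⊆ Metric.closedBall 0 D) (η : ℝ) :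
    Continuous (rftl K Φ η) := by
  have hD : 0 ≤ D := by
    obtain ⟨x, hx⟩ := hΦ.nonempty_interior
    exact (norm_nonneg _).trans (mem_closedBall_zero_iff.1 (hKD (interior_subset hx)))
  rw [continuous_iff_continuousAt]
  intro G
  -- The distance is at most `2 D a` once `‖η (G' - G)‖ * (2 D) ≤ a ^ 2`.
  have key : ∀ a : ℝ, 0 < a → a ≤ 1 / 2 → ∀ G' : Vec d, ‖η • (G' - G)‖ * (2 * D) ≤ a ^ 2 →
      ‖rftl K Φ η G' - rftl K Φ η G‖ ≤ D * (2 * a) := by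
    intro a ha ha2 G' hG'
    obtain ⟨hx, hmin⟩ := hΦ.rftl_spec hK η G
    obtain ⟨hy, hmin'⟩ := hΦ.rftl_spec hK η G'
    set x := rftl K Φ η G
    set y := rftl K Φ η G'
    have h1 := hΦ.le_of_isMinOn hx hmin hy ha.le ha2
    have h2 : inner ℝ (-η • G') y + Φ y ≤ inner ℝ (-η • G') x + Φ x := hmin' hx
    have h3 : inner ℝ (η • (G' - G)) (y - x) ≤ a ^ 2 := by
      refine (real_inner_le_norm _ _).trans (le_trans ?_ hG')
      gcongr
      have e1 := mem_closedBall_zero_iff.1 (hKD (interior_subset hx))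
      have e2 := mem_closedBall_zero_iff.1 (hKD (interior_subset hy))
      linarith [norm_sub_le y x]
    have h4 : a * √(hessForm Φ x (y - x)) ≤ a * (2 * a) := by
      simp only [inner_smul_left, inner_sub_left, inner_sub_right, conj_trivial] at h1 h2 h3
      linarith
    have h5 := le_of_mul_le_mul_left h4 ha
    have h6 := hΦ.norm_sq_le_hessForm hKD hx (y - x)
    rw [← Real.sq_sqrt (hΦ.hessForm_nonneg hx (y - x)), ← mul_pow] at h6
    exact ((le_abs_self _).trans (abs_le_of_sq_le_sq h6 (by positivity))).trans (by gcongr)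
  rw [ContinuousAt, tendsto_iff_norm_sub_tendsto_zero]
  have hlim : Tendsto (fun G' => ‖η • (G' - G)‖ * (2 * D)) (𝓝 G) (𝓝 0) := by
    have : Continuous fun G' => ‖η • (G' - G)‖ * (2 * D) := by fun_prop
    simpa using this.tendsto G
  rw [Metric.tendsto_nhds]
  intro ε hε
  set a := min (1 / 2) (ε / (4 * (D + 1)))
  have ha : 0 < a := lt_min (by norm_num) (by positivity)
  filter_upwards [hlim.eventually_le_const (show (0 : ℝ) < a ^ 2 by positivity)] with G' hG'
  rw [Real.dist_eq, sub_zero, abs_norm]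
  refine (key a ha (min_le_left _ _) G' hG').trans_lt ?_
  calc D * (2 * a) ≤ (D + 1) * (2 * (ε / (4 * (D + 1)))) := by
        gcongr
        · linarith
        · exact min_le_right _ _
    _ = ε / 2 := by field_simp; ring
    _ < ε := by linarith

/-- The barrier parameter is bounded below: the derivative of `Φ` along the segment from its
minimizer to a boundary point grows at least like `1 / (1 - t) - 1`. -/
lemma IsSelfConcordantBarrier.half_le_nu (hΦ : IsSelfConcordantBarrier K ν Φ) (hK : IsCompact K)
    [NeZero d] : 1 / 2 ≤ ν := by
  obtain ⟨x, hx, hmin⟩ := hΦ.exists_isMinOn hK 0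
  have : Nontrivial (Vec d) := by
    have : Nonempty (Fin d) := ⟨0⟩
    infer_instance
  obtain ⟨y, hy⟩ : (frontier K).Nonempty := by
    rw [nonempty_frontier_iff]
    exact ⟨⟨x, interior_subset hx⟩, fun h => noncompact_univ (Vec d) (h ▸ hK)⟩
  have hyc := frontier_subset_closure hy
  set h := y - x with hh
  have hd : ∀ t ∈ Ico (0 : ℝ) 1, HasDerivAt (fun t => fderiv ℝ Φ (x + t • h) h - (1 - t)⁻¹)
      (hessForm Φ (x + t • h) h - (-(-1) / (1 - t) ^ 2)) t := fun t ht =>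
    (hΦ.hasDerivAt_fderiv_line (hΦ.add_smul_sub_mem hx hyc ht)).sub
      (((hasDerivAt_id t).const_sub 1).inv (by simpa using (sub_pos.2 ht.2).ne'))
  have hmono : MonotoneOn (fun t => fderiv ℝ Φ (x + t • h) h - (1 - t)⁻¹) (Ico 0 1) := by
    refine monotoneOn_of_hasDerivWithinAt_nonneg (convex_Ico _ _)
      (fun s hs => (hd s hs).continuousAt.continuousWithinAt)
      (fun s hs => (hd s (interior_subset hs)).hasDerivWithinAt) fun t ht => ?_
    have ht' := interior_subset ht
    have h1 := hΦ.one_le_hessForm_of_frontier (hΦ.add_smul_sub_mem hx hyc ht') hy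
    have h2 : y - (x + t • (y - x)) = (1 - t) • h := by rw [hh]; module
    rw [h2, hessForm_smul] at h1
    have h3 : 0 < (1 - t) ^ 2 := pow_pos (sub_pos.2 ht'.2) 2
    rw [neg_neg, sub_nonneg, div_le_iff₀ h3, mul_comm]
    exact h1
  have h0 := hmono ⟨le_rfl, one_pos⟩ (show (1 / 2 : ℝ) ∈ Ico (0 : ℝ) 1 by norm_num) (by norm_num)
  have h1 := hΦ.fderiv_line_le hx hyc (show (1 / 2 : ℝ) ∈ Ico (0 : ℝ) 1 by norm_num)
  have h2 := hΦ.fderiv_eq_of_isMinOn hx hmin h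
  simp only [zero_smul, add_zero, inner_zero_left, neg_zero] at h0 h1 h2
  rw [h2] at h0
  rw [← hh] at h1
  norm_num at h0 h1
  linarith

/-- Regret of regularized follow the leader, by telescoping the optimal values. -/
lemma IsSelfConcordantBarrier.rftl_regret (hΦ : IsSelfConcordantBarrier K ν Φ) (hK : IsCompact K)
    (η : ℝ) (G g : ℕ → Vec d) (hG0 : G 0 = 0) (Q : ℕ) (hG : ∀ q < Q, G (q + 1) = G q + g q) {a : ℝ}
    (ha : 0 ≤ a) (ha2 : a ≤ 1 / 2)
    (hg : ∀ q < Q, ∀ h, η * inner ℝ (g q) h ≤ a * √(hessForm Φ (rftl K Φ η (G q)) h))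
    {y : Vec d} (hy : y ∈ K) {τ : ℝ} (hτ : τ ∈ Ico (0 : ℝ) 1) :
    η * ∑ q ∈ Finset.range Q, inner ℝ (g q)
      (rftl K Φ η 0 + τ • (y - rftl K Φ η 0) - rftl K Φ η (G q)) ≤
      -(ν * Real.log (1 - τ)) + Q * a ^ 2 := by
  obtain ⟨hx, -⟩ := hΦ.rftl_spec hK η 0
  set x₁ := rftl K Φ η 0
  set u := x₁ + τ • (y - x₁)
  have hu : u ∈ interior K := hΦ.add_smul_sub_mem hx (subset_closure hy) hτ
  have htel : ∀ n ≤ Q, rftlValue K Φ η 0 - η * ∑ q ∈ Finset.range n, inner ℝ (g q)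
      (rftl K Φ η (G q)) - n * a ^ 2 ≤ rftlValue K Φ η (G n) := by
    intro n
    induction n with
    | zero => intro _; simp [hG0]
    | succ n ih =>
      intro hn
      have h1 := ih (by omega)
      have h2 := hΦ.le_rftlValue_add hK η (G n) (g n) ha ha2 (hg n (by omega))
      rw [hG n (by omega), Finset.sum_range_succ]
      push_cast
      linarith
  have hsum : ∀ n ≤ Q, G n = ∑ q ∈ Finset.range n, g q := by
    intro n
    induction n with
    | zero => intro _; simp [hG0]
    | succ n ih => intro hn; rw [hG n (by omega), Finset.sum_range_succ, ih (by omega)]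
  have h1 := htel Q le_rfl
  have h2 := hΦ.rftlValue_le hK η (G Q) hu
  have h3 := hΦ.apply_line_sub_le hx (subset_closure hy) hτ
  have h4 : inner ℝ (-η • G Q) u = -(η * ∑ q ∈ Finset.range Q, inner ℝ (g q) u) := by
    rw [hsum Q le_rfl, inner_smul_left, sum_inner]
    simp
  have h5 : rftlValue K Φ η 0 = Φ x₁ := by simp [rftlValue, x₁]
  simp only [inner_sub_right (𝕜 := ℝ) _ u, Finset.sum_sub_distrib]
  rw [mul_sub]
  linarith

end Rftl

/-! ### The inverse square root of the Hessian -/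

section Ellipsoid

variable {d : ℕ} {K : Set (Vec d)} {ν : ℝ} {Φ : Vec d → ℝ} {D : ℝ}

lemma inner_toEuclideanLin_hessMatrix (x h : Vec d) :
    inner ℝ h (Matrix.toEuclideanLin (hessMatrix Φ x) h) = hessForm Φ x h := by
  have hsum : h = ∑ i, h i • EuclideanSpace.single i (1 : ℝ) := by
    simpa using ((EuclideanSpace.basisFun (Fin d) ℝ).sum_repr h).symm
  have h1 : hessForm Φ x h = ∑ i, ∑ j, h i * (h j * hessMatrix Φ x i j) := by
    have : hessForm Φ x h = fderiv ℝ (fderiv ℝ Φ) x h h := by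
      rw [hessForm, iteratedFDeriv_two_apply]
    rw [this]
    conv_lhs => rw [hsum]
    simp only [map_sum, map_smul, FunLike.coe_sum, Finset.sum_apply, FunLike.coe_smul,
      Pi.smul_apply, smul_eq_mul, Finset.mul_sum]
    rw [Finset.sum_comm]
    simp [hessMatrix, iteratedFDeriv_two_apply]
    grind
  rw [h1, EuclideanSpace.inner_eq_star_dotProduct]
  simp only [Matrix.ofLp_toLpLin, Matrix.toLin'_apply, dotProduct, Matrix.mulVec, star_trivial,
    Finset.sum_mul]
  refine Finset.sum_congr rfl fun i _ => Finset.sum_congr rfl fun j _ => by ring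

lemma IsSelfConcordantBarrier.isHermitian_hessMatrix (hΦ : IsSelfConcordantBarrier K ν Φ)
    {x : Vec d} (hx : x ∈ interior K) : (hessMatrix Φ x).IsHermitian := by
  ext i j
  have hs := (hΦ.contDiffAt hx).isSymmSndFDerivAt (by simp; norm_num)
  simp only [Matrix.conjTranspose_apply, hessMatrix, Matrix.of_apply, iteratedFDeriv_two_apply,
    star_trivial]
  exact hs _ _

lemma IsSelfConcordantBarrier.posDef_hessMatrix (hΦ : IsSelfConcordantBarrier K ν Φ)
    (hKD : K ⊆ Metric.closedBall 0 D) {x : Vec d} (hx : x ∈ interior K) :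
    (hessMatrix Φ x).PosDef := by
  refine Matrix.PosDef.of_dotProduct_mulVec_pos (hΦ.isHermitian_hessMatrix hx) fun v hv => ?_
  have h1 := inner_toEuclideanLin_hessMatrix (Φ := Φ) x (WithLp.toLp 2 v)
  rw [EuclideanSpace.inner_eq_star_dotProduct] at h1
  simp only [Matrix.ofLp_toLpLin, Matrix.toLin'_apply] at h1
  rw [dotProduct_comm, h1]
  have h2 := hΦ.norm_sq_le_hessForm hKD hx (WithLp.toLp 2 v)
  have h3 : 0 < ‖(WithLp.toLp 2 v : Vec d)‖ ^ 2 := by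
    have : (WithLp.toLp 2 v : Vec d) ≠ 0 := by simpa using hv
    positivity
  exact pos_of_mul_pos_right (h3.trans_le h2) (sq_nonneg D)

lemma IsSelfConcordantBarrier.spectrum_hessMatrix_subset (hΦ : IsSelfConcordantBarrier K ν Φ)
    (hKD : K ⊆ Metric.closedBall 0 D) {x : Vec d} (hx : x ∈ interior K) :
    spectrum ℝ (hessMatrix Φ x) ⊆ Ioi 0 := by
  have hpd := hΦ.posDef_hessMatrix hKD hx
  rw [hpd.1.spectrum_real_eq_range_eigenvalues]
  rintro _ ⟨i, rfl⟩
  exact hpd.eigenvalues_pos i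

lemma continuousOn_rpow_neg_half : ContinuousOn (fun s : ℝ => s ^ (-(1 / 2) : ℝ)) (Ioi 0) :=
  fun _ hs => (Real.continuousAt_rpow_const _ _ (Or.inl (ne_of_gt hs))).continuousWithinAt

lemma IsSelfConcordantBarrier.ellipsoid_mul_mul (hΦ : IsSelfConcordantBarrier K ν Φ)
    (hKD : K ⊆ Metric.closedBall 0 D) {x : Vec d} (hx : x ∈ interior K) :
    ellipsoid Φ x * (ellipsoid Φ x * hessMatrix Φ x) = 1 := by
  have hsa : IsSelfAdjoint (hessMatrix Φ x) := hΦ.isHermitian_hessMatrix hx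
  have hspec := hΦ.spectrum_hessMatrix_subset hKD hx
  have hc := continuousOn_rpow_neg_half.mono hspec
  rw [ellipsoid]
  nth_rw 3 [← cfc_id ℝ (hessMatrix Φ x) hsa]
  rw [← cfc_mul _ _ _ hc continuousOn_id,
    ← cfc_mul _ (fun s => s ^ (-(1 / 2) : ℝ) * id s) _ hc (hc.mul continuousOn_id),
    ← cfc_one ℝ (hessMatrix Φ x) hsa]
  refine cfc_congr fun s hs => ?_
  have hs0 : 0 < s := hspec hs
  have : s ^ (-(1 / 2) : ℝ) * (s ^ (-(1 / 2) : ℝ) * s) = 1 := by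
    rw [← mul_assoc, ← Real.rpow_add hs0]
    norm_num
    rw [Real.rpow_neg_one, inv_mul_cancel₀ hs0.ne']
  simpa using this

lemma IsSelfConcordantBarrier.inv_ellipsoid (hΦ : IsSelfConcordantBarrier K ν Φ)
    (hKD : K ⊆ Metric.closedBall 0 D) {x : Vec d} (hx : x ∈ interior K) :
    (ellipsoid Φ x)⁻¹ = ellipsoid Φ x * hessMatrix Φ x :=
  Matrix.inv_eq_right_inv (hΦ.ellipsoid_mul_mul hKD hx)

lemma isHermitian_ellipsoid (Φ : Vec d → ℝ) (x : Vec d) : (ellipsoid Φ x).IsHermitian :=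
  cfc_predicate (R := ℝ) (p := IsSelfAdjoint) _ (hessMatrix Φ x)

lemma inner_ellipsoid_left (x v w : Vec d) :
    inner ℝ (Matrix.toEuclideanLin (ellipsoid Φ x) v) w =
      inner ℝ v (Matrix.toEuclideanLin (ellipsoid Φ x) w) :=
  Matrix.isSymmetric_toEuclideanLin_iff.2 (isHermitian_ellipsoid Φ x) v w

lemma inner_inv_ellipsoid_left (x v w : Vec d) :
    inner ℝ (Matrix.toEuclideanLin (ellipsoid Φ x)⁻¹ v) w =
      inner ℝ v (Matrix.toEuclideanLin (ellipsoid Φ x)⁻¹ w) :=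
  Matrix.isSymmetric_toEuclideanLin_iff.2 (isHermitian_ellipsoid Φ x).inv v w

lemma IsSelfConcordantBarrier.ellipsoid_inv_ellipsoid (hΦ : IsSelfConcordantBarrier K ν Φ)
    (hKD : K ⊆ Metric.closedBall 0 D) {x : Vec d} (hx : x ∈ interior K) (v : Vec d) :
    Matrix.toEuclideanLin (ellipsoid Φ x) (Matrix.toEuclideanLin (ellipsoid Φ x)⁻¹ v) = v := by
  have h := Matrix.toLpLin_mul_same 2 (ellipsoid Φ x) (ellipsoid Φ x)⁻¹
  rw [hΦ.inv_ellipsoid hKD hx, hΦ.ellipsoid_mul_mul hKD hx, Matrix.toLpLin_one] at h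
  rw [hΦ.inv_ellipsoid hKD hx]
  exact (LinearMap.congr_fun h v).symm

lemma IsSelfConcordantBarrier.hessForm_ellipsoid (hΦ : IsSelfConcordantBarrier K ν Φ)
    (hKD : K ⊆ Metric.closedBall 0 D) {x : Vec d} (hx : x ∈ interior K) (v : Vec d) :
    hessForm Φ x (Matrix.toEuclideanLin (ellipsoid Φ x) v) = ‖v‖ ^ 2 := by
  set E := ellipsoid Φ x with hE
  have h1 : E * hessMatrix Φ x * E = 1 := by
    rw [← hΦ.inv_ellipsoid hKD hx]
    exact Matrix.nonsing_inv_mul _ ((Matrix.isUnit_iff_isUnit_det _).1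
      (IsUnit.of_mul_eq_one _ (hΦ.ellipsoid_mul_mul hKD hx)))
  rw [← inner_toEuclideanLin_hessMatrix, inner_ellipsoid_left]
  have h2 := LinearMap.congr_fun (Matrix.toLpLin_mul_same 2 (E * hessMatrix Φ x) E) v
  rw [h1, Matrix.toLpLin_mul_same, Matrix.toLpLin_one] at h2
  simp only [LinearMap.comp_apply, LinearMap.id_apply] at h2
  rw [← h2, real_inner_self_eq_norm_sq]

lemma IsSelfConcordantBarrier.hessForm_eq_norm_sq (hΦ : IsSelfConcordantBarrier K ν Φ)
    (hKD : K ⊆ Metric.closedBall 0 D) {x : Vec d} (hx : x ∈ interior K) (h : Vec d) :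
    hessForm Φ x h = ‖Matrix.toEuclideanLin (ellipsoid Φ x)⁻¹ h‖ ^ 2 := by
  rw [← hΦ.hessForm_ellipsoid hKD hx, hΦ.ellipsoid_inv_ellipsoid hKD hx]

lemma IsSelfConcordantBarrier.norm_ellipsoid_le (hΦ : IsSelfConcordantBarrier K ν Φ)
    (hD : 0 ≤ D) (hKD : K ⊆ Metric.closedBall 0 D) {x : Vec d} (hx : x ∈ interior K) (v : Vec d) :
    ‖Matrix.toEuclideanLin (ellipsoid Φ x) v‖ ≤ D * ‖v‖ := by
  have h := hΦ.norm_sq_le_hessForm hKD hx (Matrix.toEuclideanLin (ellipsoid Φ x) v)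
  rw [hΦ.hessForm_ellipsoid hKD hx, ← mul_pow] at h
  exact (le_abs_self _).trans (abs_le_of_sq_le_sq h (by positivity))

lemma IsSelfConcordantBarrier.continuousOn_hessMatrix (hΦ : IsSelfConcordantBarrier K ν Φ) :
    ContinuousOn (hessMatrix Φ) (interior K) := by
  intro x hx
  refine ContinuousAt.continuousWithinAt ?_
  have h1 : ContinuousAt (iteratedFDeriv ℝ 2 Φ) x :=
    ((hΦ.contDiffAt hx).iteratedFDeriv_right (m := 1) (i := 2) (by norm_num)).continuousAt
  refine continuousAt_pi.2 fun i => continuousAt_pi.2 fun j => ?_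
  exact (ContinuousMultilinearMap.apply ℝ (fun _ : Fin 2 => Vec d) ℝ
    ![EuclideanSpace.single i (1 : ℝ),
      EuclideanSpace.single j (1 : ℝ)]).continuous.continuousAt.comp h1

open scoped Matrix.Norms.L2Operator in
lemma IsSelfConcordantBarrier.continuousOn_ellipsoid (hΦ : IsSelfConcordantBarrier K ν Φ)
    (hKD : K ⊆ Metric.closedBall 0 D) : ContinuousOn (ellipsoid Φ) (interior K) := by
  refine ContinuousOn.cfc_of_mem_nhdsSet (s := Ioi 0) _ ?_ hΦ.continuousOn_hessMatrix
    (fun x hx => hΦ.isHermitian_hessMatrix hx) continuousOn_rpow_neg_half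
  exact (isOpen_Ioi.mem_nhdsSet).2 (iUnion₂_subset fun x hx => hΦ.spectrum_hessMatrix_subset hKD hx)

lemma IsSelfConcordantBarrier.continuousOn_inv_ellipsoid (hΦ : IsSelfConcordantBarrier K ν Φ)
    (hKD : K ⊆ Metric.closedBall 0 D) :
    ContinuousOn (fun x => (ellipsoid Φ x)⁻¹) (interior K) := by
  refine ((hΦ.continuousOn_ellipsoid hKD).mul hΦ.continuousOn_hessMatrix).congr fun x hx => ?_
  exact hΦ.inv_ellipsoid hKD hx

lemma continuous_toEuclideanLin {X : Type*} [TopologicalSpace X]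
    {M : X → Matrix (Fin d) (Fin d) ℝ} {v : X → Vec d} (hM : Continuous M) (hv : Continuous v) :
    Continuous fun x => Matrix.toEuclideanLin (M x) (v x) := by
  simp only [Matrix.toLpLin_apply]
  exact (PiLp.continuous_toLp 2 _).comp
    (hM.matrix_mulVec ((PiLp.continuous_ofLp 2 _).comp hv))

end Ellipsoid

/-! ### The divergence theorem on the unit ball -/

lemma lipschitzWith_max_zero_sub_norm {E : Type*} [SeminormedAddCommGroup E] (r : ℝ) :
    LipschitzWith 1 fun b : E => max 0 (r - ‖b‖) := by
  refine LipschitzWith.of_dist_le_mul fun x y => ?_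
  rw [NNReal.coe_one, one_mul, Real.dist_eq, dist_eq_norm]
  calc |max 0 (r - ‖x‖) - max 0 (r - ‖y‖)| ≤ |(r - ‖x‖) - (r - ‖y‖)| := by
        simpa using abs_max_sub_max_le_max 0 (r - ‖x‖) 0 (r - ‖y‖)
    _ = |‖y‖ - ‖x‖| := by congr 1; ring
    _ ≤ ‖y - x‖ := abs_norm_sub_norm_le y x
    _ = ‖x - y‖ := norm_sub_rev y x

lemma hasLineDerivAt_norm {E : Type*} [NormedAddCommGroup E] [InnerProductSpace ℝ E]
    {b : E} (hb : b ≠ 0) (c : E) :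
    HasLineDerivAt ℝ (fun x : E => ‖x‖) (inner ℝ b c / ‖b‖) b c := by
  have h1 : HasDerivAt (fun t : ℝ => b + t • c) c 0 := by
    simpa using ((hasDerivAt_id (0 : ℝ)).smul_const c).const_add b
  have h2 := h1.norm_sq.sqrt (by simpa using hb)
  simp only [zero_smul, add_zero, Real.sqrt_sq (norm_nonneg _)] at h2
  rw [HasLineDerivAt]
  refine h2.congr_deriv ?_
  rw [mul_div_mul_left _ _ two_ne_zero]

lemma abs_inner_div_norm_le {E : Type*} [NormedAddCommGroup E] [InnerProductSpace ℝ E] (b c : E) :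
    |inner ℝ b c / ‖b‖| ≤ ‖c‖ := by
  rw [abs_div, abs_norm]
  exact div_le_of_le_mul₀ (norm_nonneg _) (norm_nonneg _)
    ((abs_real_inner_le_norm b c).trans_eq (mul_comm _ _))

section Sphere

variable {E : Type*} [NormedAddCommGroup E] [InnerProductSpace ℝ E] [FiniteDimensional ℝ E]
  [MeasurableSpace E] [BorelSpace E] (μ : Measure E) [μ.IsAddHaarMeasure]

/-- The flux of `φ c` through the sphere of radius `s`. -/
def radialFlux (φ : E → ℝ) (c : E) (s : ℝ) : ℝ :=
  s ^ (Module.finrank ℝ E - 1) *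
    ∫ v : Metric.sphere (0 : E) 1, φ (s • (v : E)) * inner ℝ (v : E) c ∂μ.toSphere

lemma continuous_radialFlux {φ : E → ℝ} (hφ : Continuous φ) (c : E) :
    Continuous (radialFlux μ φ c) := by
  refine (continuous_pow _).mul ?_
  have := continuous_parametric_integral_of_continuous (μ := μ.toSphere) (s := univ)
    (f := fun (s : ℝ) (v : Metric.sphere (0 : E) 1) => φ (s • (v : E)) * inner ℝ (v : E) c)
    (by simp only [Function.uncurry_def]; fun_prop) isCompact_univ
  simpa using this

variable [Nontrivial E]

/-- Integration in polar coordinates. -/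
lemma integral_eq_integral_radial {f : E → ℝ} (hf : Integrable f μ) :
    ∫ x, f x ∂μ = ∫ r in Ioi (0 : ℝ), r ^ (Module.finrank ℝ E - 1) *
      ∫ v : Metric.sphere (0 : E) 1, f (r • (v : E)) ∂μ.toSphere := by
  set g : Metric.sphere (0 : E) 1 × Ioi (0 : ℝ) → ℝ := fun p => f (p.2.1 • p.1.1)
  have hg : ∀ x : ({0}ᶜ : Set E), g (homeomorphUnitSphereProd E x) = f x := by
    intro x
    have hx : ‖(x : E)‖ ≠ 0 := norm_ne_zero_iff.2 x.2
    simp [g, smul_smul, hx]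
  have hmp := μ.measurePreserving_homeomorphUnitSphereProd
  have hemb := (homeomorphUnitSphereProd E).measurableEmbedding
  have hgint : Integrable g (μ.toSphere.prod (.volumeIoiPow (Module.finrank ℝ E - 1))) := by
    rw [← hmp.integrable_comp_emb hemb]
    have : g ∘ homeomorphUnitSphereProd E = f ∘ ((↑) : ({0}ᶜ : Set E) → E) := funext hg
    rw [this, ← integrableOn_iff_comap_subtypeVal (measurableSet_singleton _).compl]
    exact hf.integrableOn
  calc ∫ x, f x ∂μ = ∫ x : ({0}ᶜ : Set E), f x ∂(μ.comap (↑)) := by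
        rw [integral_subtype_comap (measurableSet_singleton _).compl f, restrict_compl_singleton]
    _ = ∫ x : ({0}ᶜ : Set E), g (homeomorphUnitSphereProd E x) ∂(μ.comap (↑)) := by simp_rw [hg]
    _ = ∫ p, g p ∂μ.toSphere.prod (.volumeIoiPow (Module.finrank ℝ E - 1)) :=
        hmp.integral_comp hemb g
    _ = ∫ r : Ioi (0 : ℝ), ∫ v : Metric.sphere (0 : E) 1, f (r.1 • (v : E)) ∂μ.toSphere
          ∂(.volumeIoiPow (Module.finrank ℝ E - 1)) := integral_prod_symm g hgint
    _ = _ := by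
      simp only [Measure.volumeIoiPow, ENNReal.ofReal]
      rw [integral_withDensity_eq_integral_smul,
        integral_subtype_comap measurableSet_Ioi fun a : ℝ =>
          Real.toNNReal (a ^ (Module.finrank ℝ E - 1)) •
            ∫ v : Metric.sphere (0 : E) 1, f (a • (v : E)) ∂μ.toSphere,
        setIntegral_congr_fun measurableSet_Ioi fun x hx => ?_]
      · rw [NNReal.smul_def, Real.coe_toNNReal _ (pow_nonneg (le_of_lt hx) _), smul_eq_mul]
      · exact (measurable_subtype_coe.pow_const _).real_toNNReal

/-- The line derivative of the cone `max 0 (r - ‖·‖)`. -/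
lemma ae_lineDeriv_cone {r : ℝ} (c : E) :
    ∀ᵐ b ∂μ, lineDeriv ℝ (fun b : E => max 0 (r - ‖b‖)) b (-c) =
      (Metric.ball (0 : E) r).indicator (fun b => inner ℝ b c / ‖b‖) b := by
  have h0 : ∀ᵐ b ∂μ, b ∉ ({0} : Set E) := measure_eq_zero_iff_ae_notMem.1 (measure_singleton 0)
  have h1 : ∀ᵐ b ∂μ, b ∉ Metric.sphere (0 : E) r :=
    measure_eq_zero_iff_ae_notMem.1 (Measure.addHaar_sphere μ 0 r)
  filter_upwards [h0, h1] with b hb0 hb1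
  have hb1' : ‖b‖ ≠ r := by simpa using hb1
  rcases lt_or_gt_of_ne hb1' with hlt | hgt
  · rw [indicator_of_mem (by simpa using hlt)]
    have h2 : HasLineDerivAt ℝ (fun b : E => r - ‖b‖) (-(inner ℝ b (-c) / ‖b‖)) b (-c) :=
      HasDerivAt.const_sub r (hasLineDerivAt_norm hb0 (-c))
    have h3 : HasLineDerivAt ℝ (fun b : E => max 0 (r - ‖b‖)) (-(inner ℝ b (-c) / ‖b‖)) b (-c) := by
      refine h2.congr_of_eventuallyEq ?_
      filter_upwards [continuous_norm.continuousAt.eventually_lt_const hlt] with x hx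
      exact max_eq_right (by linarith)
    rw [h3.lineDeriv, inner_neg_right]
    ring
  · rw [indicator_of_notMem (by simpa using hgt.le)]
    have h3 : HasLineDerivAt ℝ (fun b : E => max 0 (r - ‖b‖)) 0 b (-c) := by
      have h2 : HasLineDerivAt ℝ (fun _ : E => (0 : ℝ)) 0 b (-c) := hasDerivAt_const _ _
      refine h2.congr_of_eventuallyEq ?_
      filter_upwards [continuous_norm.continuousAt.eventually_const_lt hgt] with x hx
      exact max_eq_left (by linarith)
    exact h3.lineDeriv

/-- Integration by parts against the cone `max 0 (r - ‖·‖)`, in polar coordinates. -/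
lemma integral_lineDeriv_mul_cone {φ : E → ℝ} {C : NNReal} (hφ : LipschitzWith C φ) (c : E)
    {r : ℝ} (hr : 0 < r) :
    ∫ b, lineDeriv ℝ φ b c * max 0 (r - ‖b‖) ∂μ = ∫ s in (0)..r, radialFlux μ φ c s := by
  have hsupp : HasCompactSupport fun b : E => max 0 (r - ‖b‖) := by
    refine HasCompactSupport.intro (isCompact_closedBall (0 : E) r) fun x hx => ?_
    have : r < ‖x‖ := by simpa using hx
    exact max_eq_left (by linarith)
  rw [LipschitzWith.integral_lineDeriv_mul_eq hφ (lipschitzWith_max_zero_sub_norm r) hsupp c]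
  set F : E → ℝ := (Metric.ball (0 : E) r).indicator fun b => inner ℝ b c / ‖b‖ * φ b with hF
  have hmeas : Measurable fun b : E => inner ℝ b c / ‖b‖ * φ b :=
    ((by fun_prop : Measurable fun b : E => inner ℝ b c).div measurable_norm).mul
      hφ.continuous.measurable
  obtain ⟨B, hB⟩ := (isCompact_closedBall (0 : E) r).exists_bound_of_continuousOn
    hφ.continuous.continuousOn
  have hFint : Integrable F μ := by
    rw [hF, integrable_indicator_iff measurableSet_ball]
    refine Measure.integrableOn_of_bounded (M := ‖c‖ * B) measure_ball_lt_top.ne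
      hmeas.aestronglyMeasurable ((ae_restrict_mem measurableSet_ball).mono fun b hb => ?_)
    rw [norm_mul, Real.norm_eq_abs]
    gcongr
    · exact abs_inner_div_norm_le b c
    · exact hB b (Metric.ball_subset_closedBall hb)
  calc ∫ b, lineDeriv ℝ (fun b : E => max 0 (r - ‖b‖)) b (-c) * φ b ∂μ = ∫ b, F b ∂μ := by
        refine integral_congr_ae ?_
        filter_upwards [ae_lineDeriv_cone μ (r := r) c] with b hb
        rw [hb, hF, indicator_mul_left]
    _ = ∫ s in Ioi (0 : ℝ), s ^ (Module.finrank ℝ E - 1) *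
          ∫ v : Metric.sphere (0 : E) 1, F (s • (v : E)) ∂μ.toSphere :=
        integral_eq_integral_radial μ hFint
    _ = ∫ s in Ioi (0 : ℝ), (Ioo 0 r).indicator (radialFlux μ φ c) s := by
        refine setIntegral_congr_fun measurableSet_Ioi fun s (hs : 0 < s) => ?_
        have hn : ∀ v : Metric.sphere (0 : E) 1, ‖s • (v : E)‖ = s := fun v => by
          rw [norm_smul, Real.norm_eq_abs, abs_of_pos hs, norm_eq_of_mem_sphere, mul_one]
        by_cases hsr : s < r
        · simp only [indicator_of_mem (show s ∈ Ioo 0 r from ⟨hs, hsr⟩), radialFlux]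
          congr 1
          refine integral_congr_ae (Eventually.of_forall fun v => ?_)
          have : s • (v : E) ∈ Metric.ball (0 : E) r := by simpa [hn] using hsr
          simp only [hF, indicator_of_mem this, hn, inner_smul_left, conj_trivial]
          field_simp
        · simp only [indicator_of_notMem (show s ∉ Ioo 0 r from fun h => hsr h.2)]
          have : ∀ v : Metric.sphere (0 : E) 1, F (s • (v : E)) = 0 := fun v =>
            indicator_of_notMem (by simpa [hn] using hsr) _
          simp [this]
    _ = ∫ s in Ioo 0 r, radialFlux μ φ c s := by
        rw [setIntegral_indicator measurableSet_Ioo, inter_eq_right.2 Ioo_subset_Ioi_self]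
    _ = _ := by rw [intervalIntegral.integral_of_le hr.le, integral_Ioc_eq_integral_Ioo]

/-- The divergence theorem for the vector field `φ c` on the unit ball. Both sides are the
derivatives at `r = 1` of the two sides of `integral_lineDeriv_mul_cone`. -/
lemma integral_sphere_mul_inner {φ : E → ℝ} {C : NNReal} (hφ : LipschitzWith C φ) (c : E) :
    ∫ v : Metric.sphere (0 : E) 1, φ v * inner ℝ (v : E) c ∂μ.toSphere =
      ∫ b in Metric.ball (0 : E) 1, lineDeriv ℝ φ b c ∂μ := by
  have hcont := continuous_radialFlux μ hφ.continuous c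
  have hR : HasDerivAt (fun r => ∫ s in (0)..r, radialFlux μ φ c s) (radialFlux μ φ c 1) 1 :=
    intervalIntegral.integral_hasDerivAt_right (hcont.intervalIntegrable _ _)
      hcont.stronglyMeasurable.stronglyMeasurableAtFilter hcont.continuousAt
  have hgm : Measurable fun b => lineDeriv ℝ φ b c := measurable_lineDeriv hφ.continuous
  have hgb : ∀ b, |lineDeriv ℝ φ b c| ≤ C * ‖c‖ := fun b => norm_lineDeriv_le_of_lipschitz ℝ hφ
  have hcone : ∀ r : ℝ, Continuous fun b : E => max 0 (r - ‖b‖) := fun r => by fun_prop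
  have hL := hasDerivAt_integral_of_dominated_loc_of_lip (μ := μ) (x₀ := (1 : ℝ))
    (F := fun r b => lineDeriv ℝ φ b c * max 0 (r - ‖b‖))
    (F' := (Metric.ball (0 : E) 1).indicator fun b => lineDeriv ℝ φ b c)
    (bound := (Metric.ball (0 : E) 2).indicator fun _ => C * ‖c‖)
    (Metric.ball_mem_nhds (1 : ℝ) one_pos)
    (Eventually.of_forall fun r => (hgm.mul (hcone r).measurable).aestronglyMeasurable) ?_
    (hgm.indicator measurableSet_ball).aestronglyMeasurable ?_ ?_ ?_
  · have heq : (fun r => ∫ b, lineDeriv ℝ φ b c * max 0 (r - ‖b‖) ∂μ) =ᶠ[𝓝 1]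
        fun r => ∫ s in (0)..r, radialFlux μ φ c s := by
      filter_upwards [lt_mem_nhds (zero_lt_one (α := ℝ))] with r hr
      exact integral_lineDeriv_mul_cone μ hφ c hr
    have := (heq.hasDerivAt_iff.1 hL.2).unique hR
    rw [integral_indicator measurableSet_ball] at this
    rw [this]
    simp [radialFlux]
  · refine Integrable.bdd_mul (c := C * ‖c‖) ?_ hgm.aestronglyMeasurable
      (Eventually.of_forall hgb)
    refine (hcone 1).integrable_of_hasCompactSupport
      (HasCompactSupport.intro (isCompact_closedBall (0 : E) 1) fun x hx => ?_)
    have : 1 < ‖x‖ := by simpa using hx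
    exact max_eq_left (by linarith)
  · refine Eventually.of_forall fun b => LipschitzOnWith.of_dist_le_mul fun x hx y hy => ?_
    have hx2 : x < 2 := by
      have := abs_lt.1 (show |x - 1| < 1 from hx)
      linarith [this.2]
    have hy2 : y < 2 := by
      have := abs_lt.1 (show |y - 1| < 1 from hy)
      linarith [this.2]
    rw [Real.dist_eq, Real.dist_eq, Real.coe_nnabs, ← mul_sub, abs_mul]
    by_cases hb : b ∈ Metric.ball (0 : E) 2
    · rw [indicator_of_mem hb, abs_of_nonneg (by positivity : (0 : ℝ) ≤ C * ‖c‖)]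
      refine mul_le_mul (hgb b) ?_ (abs_nonneg _) (by positivity)
      simpa using abs_max_sub_max_le_max 0 (x - ‖b‖) 0 (y - ‖b‖)
    · have hb2 : 2 ≤ ‖b‖ := by simpa using hb
      rw [max_eq_left (by linarith), max_eq_left (by linarith)]
      simp only [sub_zero, abs_zero, mul_zero]
      positivity
  · rw [integrable_indicator_iff measurableSet_ball]
    exact integrableOn_const measure_ball_lt_top.ne
  · have h1 : ∀ᵐ b ∂μ, b ∉ Metric.sphere (0 : E) 1 :=
      measure_eq_zero_iff_ae_notMem.1 (Measure.addHaar_sphere μ 0 1)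
    filter_upwards [h1] with b hb
    have hb1' : ‖b‖ ≠ 1 := by simpa using hb
    rcases lt_or_gt_of_ne hb1' with hlt | hgt
    · rw [indicator_of_mem (by simpa using hlt)]
      have h2 : HasDerivAt (fun r : ℝ => max 0 (r - ‖b‖)) 1 1 := by
        refine ((hasDerivAt_id (1 : ℝ)).sub_const ‖b‖).congr_of_eventuallyEq ?_
        filter_upwards [lt_mem_nhds hlt] with r hr
        exact max_eq_right (by simp; linarith)
      simpa using h2.const_mul (lineDeriv ℝ φ b c)
    · rw [indicator_of_notMem (by simpa using hgt.le)]
      have h2 : HasDerivAt (fun r : ℝ => max 0 (r - ‖b‖)) 0 1 := by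
        refine (hasDerivAt_const (1 : ℝ) (0 : ℝ)).congr_of_eventuallyEq ?_
        filter_upwards [gt_mem_nhds hgt] with r hr
        exact max_eq_left (by linarith)
      simpa using h2.const_mul (lineDeriv ℝ φ b c)

end Sphere

/-! ### Monotone DR-submodular rewards -/

section Reward

variable {d : ℕ} {a : Fin d → ℝ} {L₁ L₂ : ℝ} {f : Vec d → ℝ}

lemma convex_box (a : Fin d → ℝ) : Convex ℝ (box a) := by
  intro x hx y hy s t hs ht hst i
  obtain rfl : t = 1 - s := by linarith
  obtain ⟨h1, h2⟩ := hx i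
  obtain ⟨h3, h4⟩ := hy i
  simp only [PiLp.add_apply, PiLp.smul_apply, smul_eq_mul]
  constructor
  · positivity
  · nlinarith

/-- The coordinatewise projection onto the box. -/
def clampBox (a : Fin d → ℝ) (x : Vec d) : Vec d := WithLp.toLp 2 fun i => max 0 (min (x i) (a i))

lemma clampBox_mem (ha : ∀ i, 0 ≤ a i) (x : Vec d) : clampBox a x ∈ box a := fun i =>
  ⟨le_max_left _ _, max_le (ha i) (min_le_right _ _)⟩

lemma clampBox_of_mem {x : Vec d} (hx : x ∈ box a) : clampBox a x = x := by
  ext i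
  simp [clampBox, min_eq_left (hx i).2, max_eq_right (hx i).1]

lemma norm_clampBox_sub_le (x y : Vec d) : ‖clampBox a x - clampBox a y‖ ≤ ‖x - y‖ := by
  rw [EuclideanSpace.norm_eq, EuclideanSpace.norm_eq]
  refine Real.sqrt_le_sqrt (Finset.sum_le_sum fun i _ => ?_)
  simp only [PiLp.sub_apply, Real.norm_eq_abs, clampBox]
  gcongr 1
  calc |max 0 (min (x i) (a i)) - max 0 (min (y i) (a i))|
      ≤ |min (x i) (a i) - min (y i) (a i)| := by
        simpa using abs_max_sub_max_le_max 0 (min (x i) (a i)) 0 (min (y i) (a i))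
    _ ≤ |x i - y i| := by
        simpa using abs_min_sub_min_le_max (x i) (a i) (y i) (a i)

/-- The DR property for an increment in several coordinates. -/
lemma IsReward.dr_vec (hf : IsReward a L₁ L₂ f) {x y u : Vec d} (hx : x ∈ box a) (hy : y ∈ box a)
    (hyx : ∀ i, y i ≤ x i) (hu : ∀ i, 0 ≤ u i) (hxu : x + u ∈ box a) :
    f (x + u) - f x ≤ f (y + u) - f y := by
  set p : Finset (Fin d) → Vec d := fun S => WithLp.toLp 2 fun i => if i ∈ S then u i else 0
  have key : ∀ S : Finset (Fin d), f (x + p S) - f x ≤ f (y + p S) - f y := by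
    intro S
    induction S using Finset.induction_on with
    | empty =>
      have : p ∅ = 0 := by ext i; simp [p]
      simp [this]
    | insert j S hj ih =>
      have hins : p (insert j S) = p S + u j • EuclideanSpace.single j (1 : ℝ) := by
        ext i
        by_cases hij : i = j
        · subst hij; simp [p, hj]
        · simp [p, hij]
      have hbox : ∀ z : Vec d, z ∈ box a → (∀ i, z i ≤ x i) → ∀ S, z + p S ∈ box a := by
        intro z hz hzx S i
        have h1 := hxu i
        have h2 := hz i
        have h3 := hx i
        have h4 := hzx i
        have h5 := hu i
        simp only [PiLp.add_apply] at h1 ⊢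
        by_cases hi : i ∈ S
        · simp only [p, hi, if_true]; constructor <;> linarith
        · simp only [p, hi, if_false]; constructor <;> linarith
      have h1 := hf.dr (x + p S) (hbox x hx (fun _ => le_rfl) S) (y + p S) (hbox y hy hyx S)
        (fun i => by simpa using hyx i) j (u j) (hu j)
        (by rw [add_assoc, ← hins]; exact hbox x hx (fun _ => le_rfl) _)
      rw [hins, ← add_assoc, ← add_assoc]
      linarith
  have huniv : p Finset.univ = u := by ext i; simp [p]
  simpa [huniv] using key Finset.univ

/-- Concavity along nonnegative directions, in discrete form. -/
lemma IsReward.sub_le_nsmul (hf : IsReward a L₁ L₂ f) {x u : Vec d} (hx : x ∈ box a)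
    (hu : ∀ i, 0 ≤ u i) (hxu : x + u ∈ box a) {n : ℕ} (hn : 0 < n) :
    f (x + u) - f x ≤ n * (f (x + (n : ℝ)⁻¹ • u) - f x) := by
  have hn' : (0 : ℝ) < n := by exact_mod_cast hn
  have hmem : ∀ t ∈ Icc (0 : ℝ) 1, x + t • u ∈ box a := fun t ht => by
    simpa using (convex_box a).add_smul_sub_mem hx hxu ht
  have htel := Finset.sum_range_sub (fun k : ℕ => f (x + (k / n : ℝ) • u)) n
  simp only [div_self hn'.ne', one_smul, Nat.cast_zero, zero_div, zero_smul, add_zero] at htel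
  rw [← htel]
  calc _ ≤ ∑ _k ∈ Finset.range n, (f (x + (n : ℝ)⁻¹ • u) - f x) := by
        refine Finset.sum_le_sum fun k hk => ?_
        have hk1 : (k : ℝ) + 1 ≤ n := by exact_mod_cast Finset.mem_range.1 hk
        have hk0 : (0 : ℝ) ≤ (k / n : ℝ) := by positivity
        have heq : x + ((k + 1 : ℕ) / n : ℝ) • u = (x + (k / n : ℝ) • u) + (n : ℝ)⁻¹ • u := by
          push_cast
          rw [add_div, add_smul, one_div, add_assoc]
        rw [heq]
        refine hf.dr_vec (hmem _ ⟨hk0, (div_le_one hn').2 (by linarith)⟩) hx (fun i => ?_)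
          (fun i => ?_) ?_
        · simpa using mul_nonneg hk0 (hu i)
        · simpa using mul_nonneg (inv_nonneg.2 hn'.le) (hu i)
        · rw [← heq]
          exact hmem _ ⟨by positivity, (div_le_one hn').2 (by exact_mod_cast Finset.mem_range.1 hk)⟩
    _ = _ := by simp [mul_sub]

/-- A reward extended to the whole space: Lipschitz everywhere, smooth on the open set `U`, and
with gradients that overestimate increments. The last property is what monotonicity and
DR-submodularity provide. -/
structure IsExtendedReward (U B : Set (Vec d)) (L₁ L₂ : ℝ) (f : Vec d → ℝ) : Prop where
  zero : f 0 = 0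
  nonneg : ∀ x, 0 ≤ f x
  lipschitz : LipschitzWith L₁.toNNReal f
  differentiableAt : ∀ x ∈ U, DifferentiableAt ℝ f x
  smooth : ∀ x ∈ U, ∀ y ∈ U, ‖fderiv ℝ f x - fderiv ℝ f y‖ ≤ L₂ * ‖x - y‖
  sub_le_fderiv : ∀ x ∈ U, ∀ y ∈ B, f y - f x ≤ fderiv ℝ f x y

lemma tendsto_slope_line {g : Vec d → ℝ} {x : Vec d} (hg : DifferentiableAt ℝ g x) (u : Vec d) :
    Tendsto (fun t : ℝ => t⁻¹ * (g (x + t • u) - g x)) (𝓝[>] 0) (𝓝 (fderiv ℝ g x u)) := by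
  have h1 : HasDerivAt (fun t : ℝ => g (x + t • u)) (fderiv ℝ g x u) 0 := by
    have h0 : HasFDerivAt g (fderiv ℝ g x) (x + (0 : ℝ) • u) := by simpa using hg.hasFDerivAt
    exact h0.comp_hasDerivAt 0 (hasDerivAt_add_smul x u 0)
  have h2 := (hasDerivAt_iff_tendsto_slope.1 h1).mono_left
    (nhdsWithin_mono 0 (fun t (ht : 0 < t) => ht.ne'))
  refine h2.congr fun t => ?_
  simp [slope_def_field, div_eq_inv_mul]

/-- Monotonicity and concavity along nonnegative directions bound increments by the gradient: with
`s = max x y` one has `y = (s - x) + min x y`, so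
`f y - f x ≤ f s - f x ≤ ∇ f x (s - x) ≤ ∇ f x y`. -/
lemma IsReward.sub_le_fderiv (hf : IsReward a L₁ L₂ f) {x y : Vec d} (hx : x ∈ interior (box a))
    (hy : y ∈ box a) : f y - f x ≤ fderiv ℝ f x y := by
  have hxb := interior_subset hx
  have hdiff : DifferentiableAt ℝ f x :=
    hf.differentiable.differentiableAt (mem_interior_iff_mem_nhds.1 hx)
  set s : Vec d := WithLp.toLp 2 fun i => max (y i) (x i)
  have hs : s ∈ box a := fun i => ⟨(hy i).1.trans (le_max_left _ _), max_le (hy i).2 (hxb i).2⟩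
  have h1 : f y ≤ f s := hf.mono s hs y hy fun i => le_max_left _ _
  -- Concavity in the direction `s - x ≥ 0`.
  have h2 : f s - f x ≤ fderiv ℝ f x (s - x) := by
    have hlim : Tendsto (fun n : ℕ => ((n : ℝ)⁻¹)⁻¹ * (f (x + (n : ℝ)⁻¹ • (s - x)) - f x)) atTop
        (𝓝 (fderiv ℝ f x (s - x))) := by
      refine (tendsto_slope_line hdiff (s - x)).comp (tendsto_nhdsWithin_iff.2
        ⟨tendsto_inv_atTop_nhds_zero_nat, ?_⟩)
      filter_upwards [eventually_gt_atTop 0] with n hn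
      exact mem_Ioi.2 (inv_pos.2 (Nat.cast_pos.2 hn))
    refine ge_of_tendsto hlim ?_
    filter_upwards [eventually_gt_atTop 0] with n hn
    have := hf.sub_le_nsmul (u := s - x) hxb (fun i => by simp [s]) (by simpa using hs) hn
    simpa using this
  -- Monotonicity in the direction `y - (s - x) = min x y ≥ 0`.
  have h3 : 0 ≤ fderiv ℝ f x (y - (s - x)) := by
    set w := y - (s - x)
    have hw : ∀ i, 0 ≤ w i := fun i => by
      have h4 := (hy i).1
      have h5 := (hxb i).1
      simp only [w, s, PiLp.sub_apply]
      rcases max_cases (y i) (x i) with ⟨h, _⟩ | ⟨h, _⟩ <;> rw [h] <;> linarith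
    refine ge_of_tendsto (tendsto_slope_line hdiff w) ?_
    have hc : ContinuousAt (fun t : ℝ => x + t • w) 0 := by fun_prop
    have hn : ∀ᶠ t in 𝓝 (0 : ℝ), x + t • w ∈ box a :=
      hc.eventually_mem (by simpa using mem_interior_iff_mem_nhds.1 hx)
    filter_upwards [nhdsWithin_le_nhds hn, self_mem_nhdsWithin] with t ht ht0
    refine mul_nonneg (inv_nonneg.2 (le_of_lt ht0)) (sub_nonneg.2 (hf.mono _ ht _ hxb fun i => ?_))
    simpa using mul_nonneg (le_of_lt ht0) (hw i)
  rw [map_sub] at h3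
  linarith

lemma IsReward.nonneg (hf : IsReward a L₁ L₂ f) {x : Vec d} (hx : x ∈ box a) : 0 ≤ f x := by
  have h0 : (0 : Vec d) ∈ box a := fun i => ⟨le_rfl, (hx i).1.trans (hx i).2⟩
  rw [← hf.zero]
  exact hf.mono x hx 0 h0 fun i => (hx i).1

lemma IsReward.isExtendedReward (hf : IsReward a L₁ L₂ f) (hL₁ : 0 ≤ L₁) (ha : ∀ i, 0 ≤ a i) :
    IsExtendedReward (interior (box a)) (box a) L₁ L₂ (f ∘ clampBox a) := by
  have heq : ∀ x ∈ interior (box a), f ∘ clampBox a =ᶠ[𝓝 x] f := fun x hx => by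
    filter_upwards [mem_interior_iff_mem_nhds.1 hx] with y hy
    rw [Function.comp_apply, clampBox_of_mem hy]
  have hdiff : ∀ x ∈ interior (box a), DifferentiableAt ℝ f x := fun x hx =>
    hf.differentiable.differentiableAt (mem_interior_iff_mem_nhds.1 hx)
  have hfd : ∀ x ∈ interior (box a), fderiv ℝ (f ∘ clampBox a) x = fderiv ℝ f x := fun x hx =>
    (heq x hx).fderiv_eq
  have hval : ∀ x ∈ box a, (f ∘ clampBox a) x = f x := fun x hx => by
    rw [Function.comp_apply, clampBox_of_mem hx]
  refine ⟨?_, fun x => hf.nonneg (clampBox_mem ha x), ?_, ?_, ?_, ?_⟩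
  · rw [hval 0 fun i => ⟨le_rfl, ha i⟩, hf.zero]
  · refine LipschitzWith.of_dist_le_mul fun x y => ?_
    rw [Real.coe_toNNReal _ hL₁, Real.dist_eq, dist_eq_norm]
    refine (hf.lipschitz _ (clampBox_mem ha x) _ (clampBox_mem ha y)).trans ?_
    gcongr
    exact norm_clampBox_sub_le x y
  · exact fun x hx => (heq x hx).differentiableAt_iff.2 (hdiff x hx)
  · intro x hx y hy
    have h := hf.smooth x (interior_subset hx) y (interior_subset hy)
    rwa [fderivWithin_of_mem_nhds (mem_interior_iff_mem_nhds.1 hx),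
      fderivWithin_of_mem_nhds (mem_interior_iff_mem_nhds.1 hy), ← hfd x hx, ← hfd y hy] at h
  · intro x hx y hy
    rw [hfd x hx, hval y hy, hval x (interior_subset hx)]
    exact hf.sub_le_fderiv hx hy

end Reward

section Extended

variable {d : ℕ} {U B : Set (Vec d)} {L₁ L₂ : ℝ} {f : Vec d → ℝ}

lemma IsExtendedReward.abs_sub_le (hf : IsExtendedReward U B L₁ L₂ f) (hL₁ : 0 ≤ L₁) (x y : Vec d) :
    |f x - f y| ≤ L₁ * ‖x - y‖ := by
  have := hf.lipschitz.dist_le_mul x y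
  rwa [Real.coe_toNNReal _ hL₁, Real.dist_eq, dist_eq_norm] at this

lemma IsExtendedReward.le_mul_norm (hf : IsExtendedReward U B L₁ L₂ f) (hL₁ : 0 ≤ L₁) (x : Vec d) :
    f x ≤ L₁ * ‖x‖ := by
  have := (le_abs_self _).trans (hf.abs_sub_le hL₁ x 0)
  simpa [hf.zero] using this

lemma IsExtendedReward.abs_fderiv_le (hf : IsExtendedReward U B L₁ L₂ f) (hL₁ : 0 ≤ L₁)
    (x h : Vec d) : |fderiv ℝ f x h| ≤ L₁ * ‖h‖ := by
  have h1 : ‖fderiv ℝ f x‖ ≤ L₁ := by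
    have := norm_fderiv_le_of_lipschitz ℝ (x₀ := x) hf.lipschitz
    rwa [Real.coe_toNNReal _ hL₁] at this
  exact ((fderiv ℝ f x).le_opNorm h).trans (by gcongr)

lemma one_sub_inv_exp : 1 - 1 / Real.exp 1 = 1 - Real.exp (-1) := by
  rw [Real.exp_neg, one_div]

lemma one_sub_inv_exp_nonneg : 0 ≤ 1 - 1 / Real.exp 1 := by
  rw [one_sub_inv_exp, sub_nonneg, Real.exp_le_one_iff]; norm_num

lemma one_sub_inv_exp_le_one : 1 - 1 / Real.exp 1 ≤ 1 := by
  have := Real.exp_pos 1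
  have : 0 ≤ 1 / Real.exp 1 := by positivity
  linarith

lemma integral_zLaw (h : ℝ → ℝ) :
    (1 - 1 / Real.exp 1) * ∫ z, h z ∂zLaw = ∫ z in (0)..1, Real.exp (z - 1) * h z := by
  have hpos : (0 : ℝ) < 1 - Real.exp (-1) := by
    rw [sub_pos, Real.exp_lt_one_iff]; norm_num
  have hm : Measurable fun u : ℝ => (Real.exp (u - 1) / (1 - Real.exp (-1))).toNNReal := by fun_prop
  simp only [zLaw, ENNReal.ofReal]
  rw [integral_withDensity_eq_integral_smul hm, intervalIntegral.integral_of_le zero_le_one,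
    ← integral_Icc_eq_integral_Ioc, one_sub_inv_exp, ← integral_const_mul]
  refine integral_congr_ae (Eventually.of_forall fun z => ?_)
  simp only [NNReal.smul_def, smul_eq_mul]
  rw [Real.coe_toNNReal _ (by positivity)]
  field_simp

lemma IsExtendedReward.intervalIntegrable (hf : IsExtendedReward U B L₁ L₂ f) (hL₁ : 0 ≤ L₁)
    (w h : Vec d) :
    IntervalIntegrable (fun z : ℝ => Real.exp (z - 1) * fderiv ℝ f (z • w) h) volume 0 1 := by
  have hm : Measurable fun z : ℝ => fderiv ℝ f (z • w) h :=
    (measurable_fderiv_apply_const ℝ f h).comp (by fun_prop)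
  have hc : IntervalIntegrable (fun z : ℝ => Real.exp (z - 1)) volume 0 1 :=
    (by fun_prop : Continuous fun z : ℝ => Real.exp (z - 1)).intervalIntegrable _ _
  rw [intervalIntegrable_iff] at hc ⊢
  exact hc.mul_bdd (c := L₁ * ‖h‖) hm.aestronglyMeasurable
    (Eventually.of_forall fun z => hf.abs_fderiv_le hL₁ _ _)

/-- The ascent inequality of the auxiliary function `∫ e ^ (z - 1) / z * f (z w) dz`: the value at
`y` enters with the factor `1 - 1 / e`. -/
lemma IsExtendedReward.le_integral_fderiv (hf : IsExtendedReward U B L₁ L₂ f) (hL₁ : 0 ≤ L₁)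
    {w y : Vec d} (hw : ∀ z ∈ Ioc (0 : ℝ) 1, z • w ∈ U) (hy : y ∈ B) :
    (1 - 1 / Real.exp 1) * f y - f w ≤
      ∫ z in (0)..1, Real.exp (z - 1) * fderiv ℝ f (z • w) (y - w) := by
  have hfc : Continuous fun z : ℝ => f (z • w) := hf.lipschitz.continuous.comp (by fun_prop)
  have hec : Continuous fun z : ℝ => Real.exp (z - 1) := by fun_prop
  -- The bound `f y - f (z w) ≤ ∇ f (z w) y` turns the integrand into the derivative of
  -- `e ^ (z - 1) (f y - f (z w))`.
  have hderiv : ∀ z ∈ Ioo (0 : ℝ) 1, HasDerivAt (fun z => Real.exp (z - 1) * (f y - f (z • w)))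
      (Real.exp (z - 1) * (f y - f (z • w)) - Real.exp (z - 1) * fderiv ℝ f (z • w) w) z := by
    intro z hz
    have h1 : HasDerivAt (fun z : ℝ => z • w) w z := by
      simpa using (hasDerivAt_id z).smul_const w
    have h2 := (hf.differentiableAt _ (hw z ⟨hz.1, hz.2.le⟩)).hasFDerivAt.comp_hasDerivAt z h1
    have h3 : HasDerivAt (fun z : ℝ => Real.exp (z - 1)) (Real.exp (z - 1)) z := by
      simpa using ((hasDerivAt_id z).sub_const 1).exp
    exact (h3.mul (h2.const_sub (f y))).congr_deriv (by simp; ring)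
  have hI1 : IntervalIntegrable (fun z => Real.exp (z - 1) * (f y - f (z • w))) volume 0 1 :=
    (hec.mul (continuous_const.sub hfc)).intervalIntegrable _ _
  have hI2 := hf.intervalIntegrable hL₁ w w
  have hftc := intervalIntegral.integral_eq_sub_of_hasDerivAt_of_le zero_le_one
    (hec.mul (continuous_const.sub hfc)).continuousOn hderiv (hI1.sub hI2)
  have hlow : ∫ z in (0)..1, (Real.exp (z - 1) * (f y - f (z • w)) -
      Real.exp (z - 1) * fderiv ℝ f (z • w) w) ≤
      ∫ z in (0)..1, Real.exp (z - 1) * fderiv ℝ f (z • w) (y - w) := by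
    rw [intervalIntegral.integral_of_le zero_le_one, intervalIntegral.integral_of_le zero_le_one]
    refine setIntegral_mono_on (hI1.sub hI2).1 (hf.intervalIntegrable hL₁ w (y - w)).1
      measurableSet_Ioc fun z hz => ?_
    rw [map_sub, ← mul_sub]
    exact mul_le_mul_of_nonneg_left (sub_le_sub_right (hf.sub_le_fderiv _ (hw z hz) y hy) _)
      (Real.exp_pos _).le
  rw [hftc] at hlow
  simp only [Pi.mul_apply, Pi.sub_apply, one_smul, zero_smul, hf.zero, sub_self,
    Real.exp_zero, zero_sub] at hlow
  rw [one_sub_inv_exp]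
  linarith

end Extended

section SecondOrder

variable {d : ℕ} {U B : Set (Vec d)} {L₁ L₂ : ℝ} {f : Vec d → ℝ}

lemma IsExtendedReward.add_add_sub_le (hf : IsExtendedReward U B L₁ L₂ f) (hL₂ : 0 ≤ L₂)
    {x h : Vec d} (hseg : ∀ t ∈ Icc (-1 : ℝ) 1, x + t • h ∈ U) :
    f (x + h) + f (x - h) ≤ 2 * f x + 2 * L₂ * ‖h‖ ^ 2 := by
  have hneg : ∀ t ∈ Icc (0 : ℝ) 1, x + t • (-h) ∈ U := fun t ht => by
    have := hseg (-t) ⟨by linarith [ht.2], by linarith [ht.1]⟩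
    simpa using this
  have hpos : ∀ t ∈ Icc (0 : ℝ) 1, x + t • h ∈ U := fun t ht =>
    hseg t ⟨by linarith [ht.1], ht.2⟩
  have hd : ∀ t ∈ Icc (0 : ℝ) 1, HasDerivWithinAt (fun t : ℝ => f (x + t • h) + f (x + t • (-h)))
      (fderiv ℝ f (x + t • h) h + fderiv ℝ f (x + t • (-h)) (-h)) (Icc 0 1) t := fun t ht =>
    (((hf.differentiableAt _ (hpos t ht)).hasFDerivAt.comp_hasDerivAt t
      (hasDerivAt_add_smul x h t)).add
      ((hf.differentiableAt _ (hneg t ht)).hasFDerivAt.comp_hasDerivAt t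
        (hasDerivAt_add_smul x (-h) t))).hasDerivWithinAt
  have hbound : ∀ t ∈ Icc (0 : ℝ) 1,
      ‖fderiv ℝ f (x + t • h) h + fderiv ℝ f (x + t • (-h)) (-h)‖ ≤ 2 * L₂ * ‖h‖ ^ 2 := by
    intro t ht
    have h1 : fderiv ℝ f (x + t • h) h + fderiv ℝ f (x + t • (-h)) (-h) =
        (fderiv ℝ f (x + t • h) - fderiv ℝ f (x + t • (-h))) h := by
      simp [sub_eq_add_neg]
    have h2 : x + t • h - (x + t • (-h)) = (2 * t) • h := by module
    rw [h1]
    refine ((fderiv ℝ f (x + t • h) - fderiv ℝ f (x + t • (-h))).le_opNorm h).trans ?_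
    have h3 := hf.smooth _ (hpos t ht) _ (hneg t ht)
    rw [h2, norm_smul, Real.norm_eq_abs, abs_of_nonneg (by linarith [ht.1])] at h3
    calc _ ≤ L₂ * (2 * t * ‖h‖) * ‖h‖ := by gcongr
      _ ≤ L₂ * (2 * 1 * ‖h‖) * ‖h‖ := by gcongr; exact ht.2
      _ = _ := by ring
  have := (convex_Icc (0 : ℝ) 1).norm_image_sub_le_of_norm_hasDerivWithin_le hd hbound
    ⟨le_rfl, zero_le_one⟩ ⟨zero_le_one, le_rfl⟩
  simp only [one_smul, zero_smul, add_zero, sub_zero, norm_one, mul_one, Real.norm_eq_abs] at this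
  have h2 := (le_abs_self _).trans this
  rw [← sub_eq_add_neg] at h2
  linarith

/-- Averaging over the two perturbations `± h` makes the effect of the perturbation on the ascent
inequality quadratic. -/
lemma IsExtendedReward.le_integral_add_integral (hf : IsExtendedReward U B L₁ L₂ f)
    (hL₁ : 0 ≤ L₁) (hL₂ : 0 ≤ L₂) {x h y : Vec d}
    (hseg : ∀ t ∈ Icc (-1 : ℝ) 1, ∀ z ∈ Ioc (0 : ℝ) 1, z • (x + t • h) ∈ U) (hy : y ∈ B) :
    2 * ((1 - 1 / Real.exp 1) * f y - f x) - 4 * L₂ * ‖h‖ ^ 2 ≤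
      (∫ z in (0)..1, Real.exp (z - 1) * fderiv ℝ f (z • (x + h)) (y - x)) +
        ∫ z in (0)..1, Real.exp (z - 1) * fderiv ℝ f (z • (x - h)) (y - x) := by
  have hp : ∀ z ∈ Ioc (0 : ℝ) 1, z • (x + h) ∈ U := by simpa using hseg 1 (by norm_num)
  have hm : ∀ z ∈ Ioc (0 : ℝ) 1, z • (x - h) ∈ U := by
    simpa [sub_eq_add_neg] using hseg (-1) (by norm_num)
  have hsplit : ∀ k : Vec d,
      ∫ z in (0)..1, Real.exp (z - 1) * fderiv ℝ f (z • (x + k)) (y - x) =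
      (∫ z in (0)..1, Real.exp (z - 1) * fderiv ℝ f (z • (x + k)) (y - (x + k))) +
        ∫ z in (0)..1, Real.exp (z - 1) * fderiv ℝ f (z • (x + k)) k := by
    intro k
    rw [← intervalIntegral.integral_add (hf.intervalIntegrable hL₁ _ _)
      (hf.intervalIntegrable hL₁ _ _)]
    congr 1
    ext z
    rw [← mul_add, ← map_add]
    congr 2
    abel
  have h1 := hf.le_integral_fderiv hL₁ hp hy
  have h2 := hf.le_integral_fderiv hL₁ hm hy
  have h3 := hf.add_add_sub_le hL₂ (x := x) (h := h)
    (fun t ht => by simpa using hseg t ht 1 ⟨one_pos, le_rfl⟩)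
  have h4 : -(2 * L₂ * ‖h‖ ^ 2) ≤
      (∫ z in (0)..1, Real.exp (z - 1) * fderiv ℝ f (z • (x + h)) h) +
        ∫ z in (0)..1, Real.exp (z - 1) * fderiv ℝ f (z • (x + -h)) (-h) := by
    rw [← intervalIntegral.integral_add (hf.intervalIntegrable hL₁ _ _)
      (hf.intervalIntegrable hL₁ _ _)]
    have hb := intervalIntegral.norm_integral_le_of_norm_le_const (a := (0 : ℝ)) (b := 1)
      (C := 2 * L₂ * ‖h‖ ^ 2)
      (f := fun z => Real.exp (z - 1) * fderiv ℝ f (z • (x + h)) h +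
        Real.exp (z - 1) * fderiv ℝ f (z • (x + -h)) (-h)) ?_
    · rw [sub_zero, abs_one, mul_one, Real.norm_eq_abs] at hb
      exact (abs_le.1 hb).1
    · intro z hz
      rw [uIoc_of_le zero_le_one] at hz
      have e1 : Real.exp (z - 1) * fderiv ℝ f (z • (x + h)) h +
          Real.exp (z - 1) * fderiv ℝ f (z • (x + -h)) (-h) =
          Real.exp (z - 1) * ((fderiv ℝ f (z • (x + h)) - fderiv ℝ f (z • (x - h))) h) := by
        simp [sub_eq_add_neg]
        ring
      rw [e1, norm_mul, Real.norm_eq_abs, abs_of_pos (Real.exp_pos _)]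
      have e2 : Real.exp (z - 1) ≤ 1 := Real.exp_le_one_iff.2 (by linarith [hz.2])
      have e3 := hf.smooth _ (hp z hz) _ (hm z hz)
      have e4 : z • (x + h) - z • (x - h) = (2 * z) • h := by module
      rw [e4, norm_smul, Real.norm_eq_abs, abs_of_nonneg (by linarith [hz.1])] at e3
      calc _ ≤ 1 * (‖fderiv ℝ f (z • (x + h)) - fderiv ℝ f (z • (x - h))‖ * ‖h‖) := by
            gcongr
            exact ContinuousLinearMap.le_opNorm _ _
        _ ≤ 1 * (L₂ * (2 * z * ‖h‖) * ‖h‖) := by gcongr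
        _ ≤ 1 * (L₂ * (2 * 1 * ‖h‖) * ‖h‖) := by gcongr; exact hz.2
        _ = _ := by ring
  have e1 := hsplit h
  have e2 := hsplit (-h)
  rw [← sub_eq_add_neg] at e2 h4
  linarith

end SecondOrder

/-! ### The one-point gradient estimator -/

/-- The uniform distribution on the unit ball of `ℝ^d`. -/
def ballLaw (d : ℕ) : Measure (Vec d) := ProbabilityTheory.cond volume (Metric.ball 0 1)

instance instProbBallLaw (d : ℕ) : IsProbabilityMeasure (ballLaw d) := by
  unfold ballLaw
  exact cond_isProbabilityMeasure_of_finite (Metric.measure_ball_pos _ _ one_pos).ne'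
    measure_ball_lt_top.ne

lemma ae_ballLaw (d : ℕ) : ∀ᵐ b ∂ballLaw d, b ∈ Metric.ball (0 : Vec d) 1 := by
  rw [ballLaw, ProbabilityTheory.cond]
  exact Measure.ae_smul_measure (ae_restrict_mem measurableSet_ball) _

lemma integral_ballLaw_neg {d : ℕ} (g : Vec d → ℝ) :
    ∫ b, g (-b) ∂ballLaw d = ∫ b, g b ∂ballLaw d := by
  simp only [ballLaw, ProbabilityTheory.cond, integral_smul_measure]
  congr 1
  rw [← integral_indicator measurableSet_ball, ← integral_indicator measurableSet_ball,
    ← integral_neg_eq_self ((Metric.ball (0 : Vec d) 1).indicator g)]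
  congr 1
  ext b
  by_cases hb : b ∈ Metric.ball (0 : Vec d) 1
  · have hb' : -b ∈ Metric.ball (0 : Vec d) 1 := by simpa using hb
    rw [indicator_of_mem hb, indicator_of_mem hb']
  · have hb' : -b ∉ Metric.ball (0 : Vec d) 1 := by simpa using hb
    rw [indicator_of_notMem hb, indicator_of_notMem hb']

lemma integral_sphereLaw_mul_inner {d : ℕ} [NeZero d] {φ : Vec d → ℝ} {C : NNReal}
    (hφ : LipschitzWith C φ) (c : Vec d) :
    d * ∫ v, φ (v : Vec d) * inner ℝ (v : Vec d) c ∂sphereLaw d =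
      ∫ b, lineDeriv ℝ φ b c ∂ballLaw d := by
  have : Nontrivial (Vec d) := by
    have : Nonempty (Fin d) := ⟨0⟩
    infer_instance
  have hvol : volume.real (Metric.ball (0 : Vec d) 1) ≠ 0 :=
    (ENNReal.toReal_pos (Metric.measure_ball_pos _ _ one_pos).ne' measure_ball_lt_top.ne).ne'
  have hd : (d : ℝ) ≠ 0 := Nat.cast_ne_zero.2 (NeZero.ne d)
  simp only [sphereLaw, ballLaw, ProbabilityTheory.cond, integral_smul_measure,
    Measure.restrict_univ]
  rw [integral_sphere_mul_inner volume hφ c, ENNReal.toReal_inv, ENNReal.toReal_inv,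
    ← measureReal_def, ← measureReal_def, Measure.toSphere_real_apply_univ,
    finrank_euclideanSpace, Fintype.card_fin]
  simp only [smul_eq_mul]
  field_simp

section Estimator

variable {d : ℕ} {K U B : Set (Vec d)} {ν L₁ L₂ D δ : ℝ} {Φ : Vec d → ℝ} {f : Vec d → ℝ}

lemma IsSelfConcordantBarrier.explore_mem_interior (hΦ : IsSelfConcordantBarrier K ν Φ)
    (hKD : K ⊆ Metric.closedBall 0 D) {x : Vec d} (hx : x ∈ interior K) (hδ : |δ| < 1)
    {v : Vec d} (hv : ‖v‖ ≤ 1) :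
    x + δ • Matrix.toEuclideanLin (ellipsoid Φ x) v ∈ interior K := by
  refine hΦ.add_mem_interior hx ?_
  rw [hessForm_smul, hΦ.hessForm_ellipsoid hKD hx]
  have h1 : δ ^ 2 < 1 := (sq_lt_one_iff_abs_lt_one δ).2 hδ
  have h2 : ‖v‖ ^ 2 ≤ 1 := pow_le_one₀ (norm_nonneg _) hv
  nlinarith [sq_nonneg δ, sq_nonneg ‖v‖]

/-- The one-point estimator is unbiased for the gradient averaged over the ellipsoid of
radius `δ` around `x`, scaled by `z`. -/
lemma IsExtendedReward.integral_estimator [NeZero d] (hf : IsExtendedReward U B L₁ L₂ f)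
    (hΦ : IsSelfConcordantBarrier K ν Φ) (hKD : K ⊆ Metric.closedBall 0 D)
    (hKU : ∀ w ∈ interior K, ∀ z ∈ Ioc (0 : ℝ) 1, z • w ∈ U)
    {x : Vec d} (hx : x ∈ interior K) (hδ : 0 < δ) (hδ1 : δ < 1) {z : ℝ} (hz : z ∈ Ioc (0 : ℝ) 1)
    (h : Vec d) :
    d / (δ * z) * ∫ v, f (z • x + (δ * z) • Matrix.toEuclideanLin (ellipsoid Φ x) (v : Vec d)) *
        inner ℝ (Matrix.toEuclideanLin (ellipsoid Φ x)⁻¹ (v : Vec d)) h ∂sphereLaw d =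
      ∫ b, fderiv ℝ f (z • (x + δ • Matrix.toEuclideanLin (ellipsoid Φ x) b)) h ∂ballLaw d := by
  set A : Vec d →L[ℝ] Vec d := (Matrix.toEuclideanLin (ellipsoid Φ x)).toContinuousLinearMap
  have hA : ∀ v, Matrix.toEuclideanLin (ellipsoid Φ x) v = A v := fun v => rfl
  simp only [inner_inv_ellipsoid_left, hA]
  set c := Matrix.toEuclideanLin (ellipsoid Φ x)⁻¹ h with hc
  have hAc : A c = h := hΦ.ellipsoid_inv_ellipsoid hKD hx h
  have hδz : δ * z ≠ 0 := (mul_pos hδ hz.1).ne'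
  have hlip : LipschitzWith (L₁.toNNReal * (0 + ‖δ * z‖₊ * ‖A‖₊))
      fun b => f (z • x + (δ * z) • A b) :=
    hf.lipschitz.comp ((LipschitzWith.const (z • x)).add
      ((lipschitzWith_smul (δ * z)).comp A.lipschitz))
  rw [div_mul_eq_mul_div, integral_sphereLaw_mul_inner hlip c, div_eq_iff hδz,
    ← integral_mul_const]
  refine integral_congr_ae ?_
  filter_upwards [ae_ballLaw d] with b hb
  have hw : x + δ • A b ∈ interior K :=
    hΦ.explore_mem_interior hKD hx (by rwa [abs_of_pos hδ]) (mem_ball_zero_iff.1 hb).le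
  have heq : z • (x + δ • A b) = z • x + (δ * z) • A b := by module
  have h1 : HasFDerivAt f (fderiv ℝ f (z • (x + δ • A b))) (z • x + (δ * z) • A b) := by
    rw [← heq]
    exact (hf.differentiableAt _ (hKU _ hw z hz)).hasFDerivAt
  have h2 : HasFDerivAt (fun b => z • x + (δ * z) • A b) ((δ * z) • A) b :=
    (A.hasFDerivAt.const_smul (δ * z)).const_add (z • x)
  have h3 := (h1.comp b h2).hasLineDerivAt c
  have h4 := h3.lineDeriv
  simp only [ContinuousLinearMap.comp_apply, FunLike.coe_smul, Pi.smul_apply, hAc, map_smul,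
    smul_eq_mul] at h4
  exact h4.trans (mul_comm _ _)

/-- In expectation over the scaling and the direction, the estimator satisfies the ascent
inequality of the unperturbed reward up to a quadratic error in the exploration radius. -/
lemma IsExtendedReward.le_integral_estimator [NeZero d] (hf : IsExtendedReward U B L₁ L₂ f)
    (hL₁ : 0 ≤ L₁) (hL₂ : 0 ≤ L₂)
    (hΦ : IsSelfConcordantBarrier K ν Φ) (hD : 0 ≤ D) (hKD : K ⊆ Metric.closedBall 0 D)
    (hKU : ∀ w ∈ interior K, ∀ z ∈ Ioc (0 : ℝ) 1, z • w ∈ U)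
    {x : Vec d} (hx : x ∈ interior K) (hδ : 0 < δ) (hδ1 : δ < 1) {y : Vec d} (hy : y ∈ B) :
    (1 - 1 / Real.exp 1) * f y - f x - 2 * L₂ * (δ * D) ^ 2 ≤
      (1 - 1 / Real.exp 1) * ∫ z, d / (δ * z) *
        ∫ v, f (z • x + (δ * z) • Matrix.toEuclideanLin (ellipsoid Φ x) (v : Vec d)) *
          inner ℝ (Matrix.toEuclideanLin (ellipsoid Φ x)⁻¹ (v : Vec d)) (y - x) ∂sphereLaw d
        ∂zLaw := by
  set A : Vec d →L[ℝ] Vec d := (Matrix.toEuclideanLin (ellipsoid Φ x)).toContinuousLinearMap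
  set G : Vec d → ℝ → ℝ := fun b z =>
    Real.exp (z - 1) * fderiv ℝ f (z • (x + δ • A b)) (y - x) with hG
  have hGm : Measurable (Function.uncurry G) :=
    (by fun_prop : Measurable fun p : Vec d × ℝ => Real.exp (p.2 - 1)).mul
      ((measurable_fderiv_apply_const ℝ f (y - x)).comp (by fun_prop))
  have hGint : Integrable (Function.uncurry G)
      ((ballLaw d).prod (volume.restrict (Ioc (0 : ℝ) 1))) := by
    refine Integrable.of_bound hGm.aestronglyMeasurable (1 * (L₁ * ‖y - x‖)) ?_
    have hz : ∀ᵐ p ∂(ballLaw d).prod (volume.restrict (Ioc (0 : ℝ) 1)), p.2 ∈ Ioc (0 : ℝ) 1 :=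
      Measure.quasiMeasurePreserving_snd.ae (ae_restrict_mem measurableSet_Ioc)
    filter_upwards [hz] with p hp
    simp only [Function.uncurry, hG, norm_mul, Real.norm_eq_abs, abs_of_pos (Real.exp_pos _)]
    gcongr
    · exact Real.exp_le_one_iff.2 (by linarith [hp.2])
    · exact hf.abs_fderiv_le hL₁ _ _
  have hswap : (1 - 1 / Real.exp 1) * ∫ z, d / (δ * z) *
        ∫ v, f (z • x + (δ * z) • Matrix.toEuclideanLin (ellipsoid Φ x) (v : Vec d)) *
          inner ℝ (Matrix.toEuclideanLin (ellipsoid Φ x)⁻¹ (v : Vec d)) (y - x) ∂sphereLaw d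
        ∂zLaw = ∫ b, (∫ z in (0)..1, G b z) ∂ballLaw d := by
    rw [integral_zLaw, intervalIntegral.integral_of_le zero_le_one]
    simp only [intervalIntegral.integral_of_le zero_le_one]
    rw [integral_integral_swap hGint]
    refine setIntegral_congr_fun measurableSet_Ioc fun z hz => ?_
    simp only [hG]
    rw [hf.integral_estimator hΦ hKD hKU hx hδ hδ1 hz (y - x), integral_const_mul]
    rfl
  rw [hswap]
  set I : Vec d → ℝ := fun b => ∫ z in (0)..1, G b z with hI
  have hIint : Integrable I (ballLaw d) := by
    simp only [hI, intervalIntegral.integral_of_le zero_le_one]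
    exact hGint.integral_prod_left
  have hIneg : Integrable (fun b => I (-b)) (ballLaw d) := by
    have hIm : Measurable I := by
      simp only [hI, intervalIntegral.integral_of_le zero_le_one]
      exact (hGm.stronglyMeasurable.integral_prod_right).measurable
    refine Integrable.of_bound (C := 1 * (L₁ * ‖y - x‖))
      (hIm.comp measurable_neg).aestronglyMeasurable ?_
    · refine Eventually.of_forall fun b => ?_
      have := intervalIntegral.norm_integral_le_of_norm_le_const (a := (0 : ℝ)) (b := 1)
        (C := 1 * (L₁ * ‖y - x‖)) (f := G (-b)) fun z hz => by
          rw [uIoc_of_le zero_le_one] at hz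
          simp only [hG, norm_mul, Real.norm_eq_abs, abs_of_pos (Real.exp_pos _)]
          gcongr
          · exact Real.exp_le_one_iff.2 (by linarith [hz.2])
          · exact hf.abs_fderiv_le hL₁ _ _
      simpa using this
  have hsym : 2 * ∫ b, I b ∂ballLaw d = ∫ b, (I b + I (-b)) ∂ballLaw d := by
    rw [integral_add hIint hIneg, integral_ballLaw_neg, two_mul]
  have hlow : 2 * ((1 - 1 / Real.exp 1) * f y - f x) - 4 * L₂ * (δ * D) ^ 2 ≤
      ∫ b, (I b + I (-b)) ∂ballLaw d := by
    have hconst : ∫ _b, (2 * ((1 - 1 / Real.exp 1) * f y - f x) - 4 * L₂ * (δ * D) ^ 2) ∂ballLaw d =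
        2 * ((1 - 1 / Real.exp 1) * f y - f x) - 4 * L₂ * (δ * D) ^ 2 := by simp
    rw [← hconst]
    refine integral_mono_ae (integrable_const _) (hIint.add hIneg) ?_
    filter_upwards [ae_ballLaw d] with b hb
    have hb1 : ‖b‖ ≤ 1 := by simpa using (mem_ball_zero_iff.1 hb).le
    have hseg : ∀ t ∈ Icc (-1 : ℝ) 1, ∀ z ∈ Ioc (0 : ℝ) 1, z • (x + t • (δ • A b)) ∈ U := by
      intro t ht z hz
      refine hKU _ ?_ z hz
      rw [smul_smul]
      refine hΦ.explore_mem_interior hKD hx ?_ hb1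
      rw [abs_mul, abs_of_pos hδ]
      have := abs_le.2 ht
      nlinarith [abs_nonneg t]
    have h1 := hf.le_integral_add_integral hL₁ hL₂ hseg hy
    have h2 : ‖δ • A b‖ ≤ δ * D := by
      rw [norm_smul, Real.norm_eq_abs, abs_of_pos hδ]
      have := hΦ.norm_ellipsoid_le hD hKD hx b
      gcongr
      exact this.trans (mul_le_of_le_one_right hD hb1)
    have h3 : 4 * L₂ * ‖δ • A b‖ ^ 2 ≤ 4 * L₂ * (δ * D) ^ 2 := by gcongr
    have h4 : I (-b) =
        ∫ z in (0)..1, Real.exp (z - 1) * fderiv ℝ f (z • (x - δ • A b)) (y - x) := by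
      simp only [hI, hG, map_neg, smul_neg, ← sub_eq_add_neg]
    rw [h4]
    simp only [hI, hG]
    linarith
  linarith

end Estimator

/-! ### The random tape -/

section Seed

variable {d L : ℕ}

/-- Seeds with a scaling in `(0, 1]` and an exploration round inside the block. -/
def goodSeeds (d L : ℕ) : Set (Seed d) := {s | s.1 < L ∧ s.2.1 ∈ Ioc (0 : ℝ) 1}

lemma ae_zLaw : ∀ᵐ z ∂zLaw, z ∈ Ioc (0 : ℝ) 1 := by
  refine (withDensity_absolutelyContinuous _ _).ae_le ?_
  rw [Measure.restrict_congr_set Ioc_ae_eq_Icc.symm]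
  exact ae_restrict_mem measurableSet_Ioc

lemma integral_uniformOn_range (g : ℕ → ℝ) :
    ∫ n, g n ∂uniformOn (Finset.range L : Set ℕ) = (L : ℝ)⁻¹ * ∑ n ∈ Finset.range L, g n := by
  rw [uniformOn, ProbabilityTheory.cond, integral_smul_measure,
    Measure.count_apply_finset, setIntegral_finset]
  · simp
  · refine ⟨Measurable.of_discrete.aestronglyMeasurable, ?_⟩
    rw [hasFiniteIntegral_iff_enorm, lintegral_finset]
    simp [ENNReal.sum_lt_top]

lemma ae_uniformOn_range : ∀ᵐ n ∂uniformOn (Finset.range L : Set ℕ), n < L := by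
  rw [uniformOn, ProbabilityTheory.cond]
  refine Measure.ae_smul_measure ?_ _
  filter_upwards [ae_restrict_mem (Finset.range L).measurableSet] with n hn
  simpa using hn

lemma ae_seedLaw : ∀ᵐ s ∂seedLaw d L, s ∈ goodSeeds d L := by
  have h1 : ∀ᵐ s ∂seedLaw d L, s.1 < L :=
    Measure.quasiMeasurePreserving_fst.ae ae_uniformOn_range
  have h2 : ∀ᵐ s ∂seedLaw d L, s.2.1 ∈ Ioc (0 : ℝ) 1 :=
    Measure.quasiMeasurePreserving_snd.ae (Measure.quasiMeasurePreserving_fst.ae ae_zLaw)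
  filter_upwards [h1, h2] with s hs1 hs2 using ⟨hs1, hs2⟩

variable [NeZero d] [NeZero L]

lemma ae_tapeLaw : ∀ᵐ ω ∂tapeLaw d L, ∀ q, ω q ∈ goodSeeds d L := by
  rw [ae_all_iff]
  intro q
  exact (measurePreserving_eval_infinitePi (fun _ : ℕ => seedLaw d L) q).quasiMeasurePreserving.ae
    ae_seedLaw

instance instProbTapeLaw : IsProbabilityMeasure (tapeLaw d L) := by
  unfold tapeLaw
  infer_instance

/-- A bounded measurable function of the seed is integrated coordinate by coordinate. -/
lemma integral_seedLaw {g : Seed d → ℝ} (hg : Measurable g) {C : ℝ}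
    (hC : ∀ s ∈ goodSeeds d L, |g s| ≤ C) :
    ∫ s, g s ∂seedLaw d L =
      (L : ℝ)⁻¹ * ∑ n ∈ Finset.range L, ∫ z, ∫ v, g (n, z, v) ∂sphereLaw d ∂zLaw := by
  have hint : Integrable g (seedLaw d L) :=
    Integrable.of_bound hg.aestronglyMeasurable C (ae_seedLaw.mono hC)
  unfold seedLaw at hint ⊢
  rw [integral_prod _ hint, integral_uniformOn_range]
  congr 1
  refine Finset.sum_congr rfl fun n hn => integral_prod _ ?_
  refine Integrable.of_bound (hg.comp (by fun_prop)).aestronglyMeasurable C ?_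
  have h2 : ∀ᵐ p ∂zLaw.prod (sphereLaw d), p.1 ∈ Ioc (0 : ℝ) 1 :=
    Measure.quasiMeasurePreserving_fst.ae ae_zLaw
  filter_upwards [h2] with p hp using hC (n, p) ⟨Finset.mem_range.1 hn, hp⟩

end Seed

/-! ### The state of the algorithm -/

/-- The data of a run against rewards that have been extended to the whole space. -/
structure IsInstance {d : ℕ} (K U : Set (Vec d)) (ν : ℝ) (Φ : Vec d → ℝ) (L₁ L₂ D δ : ℝ)
    (F : ℕ → Vec d → ℝ) : Prop where
  isCompact : IsCompact K
  zero_mem : 0 ∈ K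
  nonneg_D : 0 ≤ D
  nonneg_L₁ : 0 ≤ L₁
  nonneg_L₂ : 0 ≤ L₂
  subset_ball : K ⊆ Metric.closedBall 0 D
  barrier : IsSelfConcordantBarrier K ν Φ
  smul_mem : ∀ w ∈ interior K, ∀ z ∈ Ioc (0 : ℝ) 1, z • w ∈ U
  reward : ∀ t, IsExtendedReward U K L₁ L₂ (F t)
  pos_δ : 0 < δ
  δ_le_one : δ ≤ 1

section State

variable {d : ℕ} {K U : Set (Vec d)} {ν L₁ L₂ D δ η : ℝ} {Φ : Vec d → ℝ} {F : ℕ → Vec d → ℝ}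

lemma IsInstance.rftl_mem (H : IsInstance K U ν Φ L₁ L₂ D δ F) (η : ℝ) (G : Vec d) :
    rftl K Φ η G ∈ interior K :=
  (H.barrier.rftl_spec H.isCompact η G).1

lemma IsInstance.norm_le (H : IsInstance K U ν Φ L₁ L₂ D δ F) {x : Vec d} (hx : x ∈ K) :
    ‖x‖ ≤ D :=
  mem_closedBall_zero_iff.1 (H.subset_ball hx)

lemma exploreAction_eq (Φ : Vec d → ℝ) (δ : ℝ) (x : Vec d) (s : Seed d) :
    exploreAction Φ δ x s =
      s.2.1 • (x + δ • Matrix.toEuclideanLin (ellipsoid Φ x) (s.2.2 : Vec d)) := by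
  rw [exploreAction]
  module

lemma IsInstance.explore_mem (H : IsInstance K U ν Φ L₁ L₂ D δ F) {x : Vec d}
    (hx : x ∈ interior K) (v : Metric.sphere (0 : Vec d) 1) :
    x + δ • Matrix.toEuclideanLin (ellipsoid Φ x) (v : Vec d) ∈ K := by
  refine H.barrier.add_mem H.isCompact.isClosed hx ?_
  rw [hessForm_smul, H.barrier.hessForm_ellipsoid H.subset_ball hx, norm_eq_of_mem_sphere]
  rw [one_pow, mul_one]
  exact pow_le_one₀ H.pos_δ.le H.δ_le_one

lemma IsInstance.exploreAction_mem (H : IsInstance K U ν Φ L₁ L₂ D δ F) {x : Vec d}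
    (hx : x ∈ interior K) {s : Seed d} (hs : s.2.1 ∈ Ioc (0 : ℝ) 1) :
    exploreAction Φ δ x s ∈ K := by
  rw [exploreAction_eq]
  exact H.barrier.convex_set.smul_mem_of_zero_mem H.zero_mem (H.explore_mem hx s.2.2)
    ⟨hs.1.le, hs.2⟩

/-- The scalar factor of the gradient estimate is bounded: the reward observed at a point scaled
by `z` is at most proportional to `z`, which compensates the factor `1 / z`. -/
lemma IsInstance.abs_scalar_le (H : IsInstance K U ν Φ L₁ L₂ D δ F) {x : Vec d}
    (hx : x ∈ interior K) {s : Seed d} (hs : s.2.1 ∈ Ioc (0 : ℝ) 1) (t : ℕ) :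
    |(1 - 1 / Real.exp 1) * (d / (δ * s.2.1)) * F t (exploreAction Φ δ x s)| ≤
      d * L₁ * D / δ := by
  have hδ := H.pos_δ
  have hz := hs.1
  have h1 : F t (exploreAction Φ δ x s) ≤ L₁ * (s.2.1 * D) := by
    refine ((H.reward t).le_mul_norm H.nonneg_L₁ _).trans ?_
    rw [exploreAction_eq, norm_smul, Real.norm_eq_abs, abs_of_pos hz]
    have := H.nonneg_L₁
    gcongr
    exact H.norm_le (H.explore_mem hx s.2.2)
  have h0 := (H.reward t).nonneg (exploreAction Φ δ x s)
  have hα := one_sub_inv_exp_nonneg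
  rw [abs_of_nonneg (by positivity)]
  calc (1 - 1 / Real.exp 1) * (d / (δ * s.2.1)) * F t (exploreAction Φ δ x s)
      ≤ 1 * (d / (δ * s.2.1)) * (L₁ * (s.2.1 * D)) := by
        gcongr
        exact one_sub_inv_exp_le_one
    _ = d * L₁ * D / δ := by field_simp

lemma inner_gradEstimate (Φ : Vec d → ℝ) (δ : ℝ) (x : Vec d) (s : Seed d) (r : ℝ) (h : Vec d) :
    inner ℝ (gradEstimate Φ δ x s r) h = ((1 - 1 / Real.exp 1) * (d / (δ * s.2.1)) * r) *
      inner ℝ (Matrix.toEuclideanLin (ellipsoid Φ x)⁻¹ (s.2.2 : Vec d)) h := by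
  rw [gradEstimate, inner_smul_left, conj_trivial]

/-- The dual local norm of the gradient estimate is at most `d L₁ D / δ`. -/
lemma IsInstance.abs_inner_gradEstimate_le (H : IsInstance K U ν Φ L₁ L₂ D δ F) {x : Vec d}
    (hx : x ∈ interior K) {s : Seed d} (hs : s.2.1 ∈ Ioc (0 : ℝ) 1) (t : ℕ) (h : Vec d) :
    |inner ℝ (gradEstimate Φ δ x s (F t (exploreAction Φ δ x s))) h| ≤
      d * L₁ * D / δ * √(hessForm Φ x h) := by
  rw [inner_gradEstimate, abs_mul]
  have h1 : |inner ℝ (Matrix.toEuclideanLin (ellipsoid Φ x)⁻¹ (s.2.2 : Vec d)) h| ≤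
      √(hessForm Φ x h) := by
    rw [inner_inv_ellipsoid_left, H.barrier.hessForm_eq_norm_sq H.subset_ball hx,
      Real.sqrt_sq (norm_nonneg _)]
    refine (abs_real_inner_le_norm _ _).trans_eq ?_
    rw [norm_eq_of_mem_sphere, one_mul]
  exact mul_le_mul (H.abs_scalar_le hx hs t) h1 (abs_nonneg _)
    ((abs_nonneg _).trans (H.abs_scalar_le hx hs t))

lemma IsInstance.continuous_rftl (H : IsInstance K U ν Φ L₁ L₂ D δ F) (η : ℝ) :
    Continuous (rftl K Φ η) :=
  H.barrier.continuous_rftl H.isCompact H.subset_ball η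

lemma IsInstance.continuous_ellipsoid_rftl (H : IsInstance K U ν Φ L₁ L₂ D δ F) (η : ℝ) :
    Continuous fun p : Vec d × Vec d =>
      Matrix.toEuclideanLin (ellipsoid Φ (rftl K Φ η p.1)) p.2 := by
  have h : Continuous fun G => (ellipsoid Φ (rftl K Φ η G)) :=
    (H.barrier.continuousOn_ellipsoid H.subset_ball).comp_continuous (H.continuous_rftl η)
      (H.rftl_mem η)
  exact continuous_toEuclideanLin (h.comp continuous_fst) continuous_snd

lemma IsInstance.continuous_inv_ellipsoid_rftl (H : IsInstance K U ν Φ L₁ L₂ D δ F) (η : ℝ) :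
    Continuous fun p : Vec d × Vec d =>
      Matrix.toEuclideanLin (ellipsoid Φ (rftl K Φ η p.1))⁻¹ p.2 := by
  have h : Continuous fun G => (ellipsoid Φ (rftl K Φ η G))⁻¹ :=
    (H.barrier.continuousOn_inv_ellipsoid H.subset_ball).comp_continuous (H.continuous_rftl η)
      (H.rftl_mem η)
  exact continuous_toEuclideanLin (h.comp continuous_fst) continuous_snd

lemma measurable_comp_direction {g : Vec d → Vec d → Vec d}
    (hg : Measurable fun p : Vec d × Vec d => g p.1 p.2) :
    Measurable fun p : Vec d × Seed d => g p.1 (p.2.2.2 : Vec d) :=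
  hg.comp (measurable_fst.prodMk (measurable_subtype_coe.comp
    (measurable_snd.comp (measurable_snd.comp measurable_snd))))

lemma IsInstance.measurable_exploreAction (H : IsInstance K U ν Φ L₁ L₂ D δ F) (η : ℝ) :
    Measurable fun p : Vec d × Seed d => exploreAction Φ δ (rftl K Φ η p.1) p.2 := by
  have h1 : Measurable fun p : Vec d × Seed d => rftl K Φ η p.1 :=
    (H.continuous_rftl η).measurable.comp measurable_fst
  have h2 : Measurable fun p : Vec d × Seed d =>
      Matrix.toEuclideanLin (ellipsoid Φ (rftl K Φ η p.1)) (p.2.2.2 : Vec d) := by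
    exact measurable_comp_direction (g := fun G v =>
      Matrix.toEuclideanLin (ellipsoid Φ (rftl K Φ η G)) v)
      (H.continuous_ellipsoid_rftl η).measurable
  have h3 : Measurable fun p : Vec d × Seed d => p.2.2.1 :=
    measurable_fst.comp (measurable_snd.comp measurable_snd)
  exact (h3.smul h1).add ((h3.const_mul δ).smul h2)

/-- The gradient estimate in block `q` as a function of the gradient sum and the seed. -/
def gradStep (K : Set (Vec d)) (Φ : Vec d → ℝ) (η δ : ℝ) (L : ℕ) (F : ℕ → Vec d → ℝ) (q : ℕ)
    (p : Vec d × Seed d) : Vec d :=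
  gradEstimate Φ δ (rftl K Φ η p.1) p.2
    (F (q * L + p.2.1) (exploreAction Φ δ (rftl K Φ η p.1) p.2))

lemma gradSum_succ (K : Set (Vec d)) (Φ : Vec d → ℝ) (η δ : ℝ) (L : ℕ) (F : ℕ → Vec d → ℝ)
    (ω : ℕ → Seed d) (q : ℕ) :
    gradSum K Φ η δ L F ω (q + 1) = gradSum K Φ η δ L F ω q +
      gradStep K Φ η δ L F q (gradSum K Φ η δ L F ω q, ω q) := rfl

lemma IsInstance.measurable_gradStep (H : IsInstance K U ν Φ L₁ L₂ D δ F) (η : ℝ) (L q : ℕ) :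
    Measurable (gradStep K Φ η δ L F q) := by
  have hF : Measurable fun p : ℕ × Vec d => F (q * L + p.1) p.2 :=
    measurable_from_prod_countable_right fun n =>
      (H.reward (q * L + n)).lipschitz.continuous.measurable
  have hr : Measurable fun p : Vec d × Seed d =>
      F (q * L + p.2.1) (exploreAction Φ δ (rftl K Φ η p.1) p.2) :=
    hF.comp ((measurable_fst.comp measurable_snd).prodMk
      (H.measurable_exploreAction η))
  have h2 : Measurable fun p : Vec d × Seed d =>
      Matrix.toEuclideanLin (ellipsoid Φ (rftl K Φ η p.1))⁻¹ (p.2.2.2 : Vec d) := by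
    exact measurable_comp_direction (g := fun G v =>
      Matrix.toEuclideanLin (ellipsoid Φ (rftl K Φ η G))⁻¹ v)
      (H.continuous_inv_ellipsoid_rftl η).measurable
  unfold gradStep gradEstimate
  have h3 : Measurable fun p : Vec d × Seed d =>
      (1 - 1 / Real.exp 1) * ((d : ℝ) / (δ * p.2.2.1)) := by
    fun_prop
  exact (h3.mul hr).smul h2

lemma IsInstance.measurable_gradSum (H : IsInstance K U ν Φ L₁ L₂ D δ F) (η : ℝ) (L q : ℕ) :
    Measurable fun ω => gradSum K Φ η δ L F ω q := by
  induction q with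
  | zero => exact measurable_const
  | succ q ih =>
    simp only [gradSum_succ]
    exact ih.add ((H.measurable_gradStep η L q).comp (ih.prodMk (measurable_pi_apply q)))

/-- The gradient sum after `q` blocks depends only on the first `q` seeds. -/
lemma gradSum_congr {L : ℕ} {ω ω' : ℕ → Seed d} {q : ℕ} (hω : ∀ i < q, ω i = ω' i) :
    gradSum K Φ η δ L F ω q = gradSum K Φ η δ L F ω' q := by
  induction q with
  | zero => rfl
  | succ q ih =>
    rw [gradSum_succ, gradSum_succ, ← ih fun i hi => hω i (by omega), ← hω q (by omega)]

/-- On good tapes the rewards enter only through their values on `K` in the rounds of the past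
blocks. -/
lemma IsInstance.gradSum_eq (H : IsInstance K U ν Φ L₁ L₂ D δ F) {L T : ℕ}
    {f : ℕ → Vec d → ℝ} (hf : ∀ t < T, EqOn (f t) (F t) K) {ω : ℕ → Seed d}
    (hω : ∀ q, ω q ∈ goodSeeds d L) {q : ℕ} (hq : q * L ≤ T) :
    gradSum K Φ η δ L f ω q = gradSum K Φ η δ L F ω q := by
  induction q with
  | zero => rfl
  | succ q ih =>
    rw [Nat.succ_mul] at hq
    have h1 := (hω q).1
    rw [gradSum_succ, gradSum_succ, ih (by omega), gradStep, gradStep,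
      hf (q * L + (ω q).1) (by omega) (H.exploreAction_mem (H.rftl_mem η _) (hω q).2)]

lemma IsInstance.indepFun_gradSum [NeZero d] (H : IsInstance K U ν Φ L₁ L₂ D δ F) (η : ℝ) (L q : ℕ)
    [NeZero L] :
    IndepFun (fun ω => gradSum K Φ η δ L F ω q) (fun ω => ω q) (tapeLaw d L) := by
  have hind : iIndepFun (fun (i : ℕ) (ω : ℕ → Seed d) => ω i) (tapeLaw d L) :=
    iIndepFun_infinitePi (P := fun _ : ℕ => seedLaw d L) (X := fun _ s => s) fun _ => measurable_id
  have h1 := hind.indepFun_finset (Finset.range q) {q} (by simp) fun i => measurable_pi_apply i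
  set s₀ : Seed d := (0, 0, ⟨EuclideanSpace.single 0 1, by simp⟩)
  set ext : (Finset.range q → Seed d) → ℕ → Seed d := fun r i =>
    if h : i ∈ Finset.range q then r ⟨i, h⟩ else s₀ with hext
  have hextm : Measurable ext := by
    refine measurable_pi_lambda _ fun i => ?_
    by_cases hi : i ∈ Finset.range q
    · simp only [hext, hi, dif_pos]
      exact measurable_pi_apply _
    · simp only [hext, hi, dif_neg, not_false_eq_true]
      exact measurable_const
  have h2 := h1.comp ((H.measurable_gradSum η L q).comp hextm)
    (measurable_pi_apply (⟨q, Finset.mem_singleton_self q⟩ : ({q} : Finset ℕ)))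
  have h3 : (fun ω => gradSum K Φ η δ L F ω q) = ((fun ω => gradSum K Φ η δ L F ω q) ∘ ext) ∘
      fun (ω : ℕ → Seed d) (i : Finset.range q) => ω i := by
    ext1 ω
    refine gradSum_congr fun i hi => ?_
    simp [hext, hi]
  rw [h3]
  exact h2

/-- Conditioning on the past: the seed of block `q` is independent of the state. -/
lemma IsInstance.integral_state_seed [NeZero d] (H : IsInstance K U ν Φ L₁ L₂ D δ F) (η : ℝ)
    (L q : ℕ) [NeZero L] {Ψ : Vec d × Seed d → ℝ} (hΨ : Measurable Ψ)
    (hint : Integrable (fun ω => Ψ (gradSum K Φ η δ L F ω q, ω q)) (tapeLaw d L)) :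
    Integrable (fun ω => ∫ s, Ψ (gradSum K Φ η δ L F ω q, s) ∂seedLaw d L) (tapeLaw d L) ∧
    ∫ ω, Ψ (gradSum K Φ η δ L F ω q, ω q) ∂tapeLaw d L =
      ∫ ω, ∫ s, Ψ (gradSum K Φ η δ L F ω q, s) ∂seedLaw d L ∂tapeLaw d L := by
  have hG := H.measurable_gradSum η L q
  have hq : Measurable fun ω : ℕ → Seed d => ω q := measurable_pi_apply q
  have hmapq : (tapeLaw d L).map (fun ω => ω q) = seedLaw d L :=
    (measurePreserving_eval_infinitePi (fun _ : ℕ => seedLaw d L) q).map_eq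
  have hprod := (indepFun_iff_map_prod_eq_prod_map_map hG.aemeasurable hq.aemeasurable).1
    (H.indepFun_gradSum η L q)
  rw [hmapq] at hprod
  have hmeas := (hG.prodMk hq)
  have hint2 : Integrable Ψ (((tapeLaw d L).map fun ω => gradSum K Φ η δ L F ω q).prod
      (seedLaw d L)) := by
    rw [← hprod, integrable_map_measure hΨ.aestronglyMeasurable hmeas.aemeasurable]
    exact hint
  have hprob : IsProbabilityMeasure ((tapeLaw d L).map fun ω => gradSum K Φ η δ L F ω q) :=
    Measure.isProbabilityMeasure_map hG.aemeasurable
  have hsm : StronglyMeasurable fun g => ∫ s, Ψ (g, s) ∂seedLaw d L :=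
    hΨ.stronglyMeasurable.integral_prod_right'
  constructor
  · have := hint2.integral_prod_left
    rwa [integrable_map_measure hsm.aestronglyMeasurable hG.aemeasurable] at this
  · calc ∫ ω, Ψ (gradSum K Φ η δ L F ω q, ω q) ∂tapeLaw d L
        = ∫ p, Ψ p ∂(tapeLaw d L).map fun ω => (gradSum K Φ η δ L F ω q, ω q) :=
          (integral_map hmeas.aemeasurable hΨ.aestronglyMeasurable).symm
      _ = ∫ g, ∫ s, Ψ (g, s) ∂seedLaw d L ∂(tapeLaw d L).map fun ω => gradSum K Φ η δ L F ω q := by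
          rw [hprod, integral_prod _ hint2]
      _ = _ := integral_map hG.aemeasurable hsm.aestronglyMeasurable

lemma IsInstance.exists_gradStep_bound (H : IsInstance K U ν Φ L₁ L₂ D δ F) (η : ℝ) (L q : ℕ)
    (R : ℝ) :
    ∃ R', ∀ g : Vec d, ‖g‖ ≤ R → ∀ s ∈ goodSeeds d L, ‖gradStep K Φ η δ L F q (g, s)‖ ≤ R' := by
  obtain ⟨M, hM⟩ := ((isCompact_closedBall (0 : Vec d) R).prod
    (isCompact_sphere (0 : Vec d) 1)).exists_bound_of_continuousOn
    (H.continuous_inv_ellipsoid_rftl η).continuousOn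
  refine ⟨d * L₁ * D / δ * M, fun g hg s hs => ?_⟩
  rw [gradStep, gradEstimate, norm_smul, Real.norm_eq_abs]
  have h1 := H.abs_scalar_le (H.rftl_mem η g) hs.2 (q * L + s.1)
  exact mul_le_mul h1 (hM (g, s.2.2) ⟨mem_closedBall_zero_iff.2 hg, s.2.2.2⟩) (norm_nonneg _)
    ((abs_nonneg _).trans h1)

/-- Along good tapes the gradient sums stay in a bounded set: the states then range over a compact
subset of the interior, on which the Hessian is bounded. -/
lemma IsInstance.exists_gradSum_bound (H : IsInstance K U ν Φ L₁ L₂ D δ F) (η : ℝ) (L q : ℕ) :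
    ∃ R, ∀ ω : ℕ → Seed d, (∀ i, ω i ∈ goodSeeds d L) → ‖gradSum K Φ η δ L F ω q‖ ≤ R := by
  induction q with
  | zero => exact ⟨0, fun ω _ => by simp [gradSum]⟩
  | succ q ih =>
    obtain ⟨R, hR⟩ := ih
    obtain ⟨R', hR'⟩ := H.exists_gradStep_bound η L q R
    refine ⟨R + R', fun ω hω => ?_⟩
    rw [gradSum_succ]
    exact (norm_add_le _ _).trans (add_le_add (hR ω hω) (hR' _ (hR ω hω) _ (hω q)))

end State

/-! ### Expected regret of the algorithm -/

section Regret

variable {d L T : ℕ} {K U : Set (Vec d)} {ν L₁ L₂ D δ η : ℝ} {Φ : Vec d → ℝ} {F : ℕ → Vec d → ℝ}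

lemma banditDRSM_mul_add (K : Set (Vec d)) (Φ : Vec d → ℝ) (η δ : ℝ) (F : ℕ → Vec d → ℝ)
    (ω : ℕ → Seed d) (q : ℕ) {n : ℕ} (hn : n < L) :
    banditDRSM K Φ η δ L F (q * L + n) ω =
      if n = (ω q).1 then exploreAction Φ δ (rftl K Φ η (gradSum K Φ η δ L F ω q)) (ω q)
      else rftl K Φ η (gradSum K Φ η δ L F ω q) := by
  have hdiv : (q * L + n) / L = q := by
    rw [Nat.mul_comm, Nat.mul_add_div (by omega), Nat.div_eq_of_lt hn, add_zero]
  have hmod : (q * L + n) % L = n := by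
    rw [Nat.mul_comm, Nat.mul_add_mod, Nat.mod_eq_of_lt hn]
  simp only [banditDRSM, hdiv, hmod]

lemma IsInstance.banditDRSM_mem (H : IsInstance K U ν Φ L₁ L₂ D δ F) (η : ℝ) (t : ℕ)
    {ω : ℕ → Seed d} (hω : ∀ q, ω q ∈ goodSeeds d L) : banditDRSM K Φ η δ L F t ω ∈ K := by
  simp only [banditDRSM]
  split_ifs
  · exact H.exploreAction_mem (H.rftl_mem η _) (hω _).2
  · exact interior_subset (H.rftl_mem η _)

lemma IsInstance.measurable_banditDRSM (H : IsInstance K U ν Φ L₁ L₂ D δ F) (η : ℝ) (L t : ℕ) :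
    Measurable (banditDRSM K Φ η δ L F t) := by
  have hG := H.measurable_gradSum η L (t / L)
  have hq : Measurable fun ω : ℕ → Seed d => ω (t / L) := measurable_pi_apply _
  refine Measurable.ite ?_ ((H.measurable_exploreAction η).comp (hG.prodMk hq))
    ((H.continuous_rftl η).measurable.comp hG)
  exact (measurable_fst.comp hq) (measurableSet_eq_fun measurable_const measurable_id)

lemma IsInstance.abs_reward_le (H : IsInstance K U ν Φ L₁ L₂ D δ F) (t : ℕ) {x : Vec d}
    (hx : x ∈ K) : |F t x| ≤ L₁ * D := by
  rw [abs_of_nonneg ((H.reward t).nonneg x)]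
  exact ((H.reward t).le_mul_norm H.nonneg_L₁ x).trans
    (mul_le_mul_of_nonneg_left (H.norm_le hx) H.nonneg_L₁)

/-- Regret against the states: the cost of exploration is at most one round per block, and the
comparator is moved from `y` to the point `u` at relative distance `1 / T`. -/
lemma IsInstance.sum_regret_le [NeZero L] (H : IsInstance K U ν Φ L₁ L₂ D δ F) (η : ℝ)
    {ω : ℕ → Seed d}
    (hω : ∀ q, ω q ∈ goodSeeds d L) {y u : Vec d} (hy : y ∈ K) {ε : ℝ} (hyu : ‖y - u‖ ≤ ε) :
    ∑ t ∈ Finset.range T, ((1 - 1 / Real.exp 1) * F t y - F t (banditDRSM K Φ η δ L F t ω)) ≤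
      (∑ q ∈ Finset.range (T / L), ∑ n ∈ Finset.range L, ((1 - 1 / Real.exp 1) * F (q * L + n) u -
        F (q * L + n) (rftl K Φ η (gradSum K Φ η δ L F ω q)))) +
      ((T / L : ℕ) * (L * (L₁ * ε) + L₁ * D) + L * (L₁ * D)) := by
  have hα0 := one_sub_inv_exp_nonneg
  have hα1 := one_sub_inv_exp_le_one
  have hLD : 0 ≤ L₁ * D := mul_nonneg H.nonneg_L₁ H.nonneg_D
  have hsplit : ∀ (g : ℕ → ℝ) (Q : ℕ), ∑ t ∈ Finset.range (Q * L), g t =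
      ∑ q ∈ Finset.range Q, ∑ n ∈ Finset.range L, g (q * L + n) := by
    intro g Q
    induction Q with
    | zero => simp
    | succ Q ih => rw [Nat.succ_mul, Finset.sum_range_add, ih, Finset.sum_range_succ]
  have hT : T = T / L * L + T % L := by rw [Nat.mul_comm]; exact (Nat.div_add_mod T L).symm
  conv_lhs => rw [hT]
  rw [Finset.sum_range_add, hsplit, add_comm (_ * _ : ℝ), ← add_assoc, add_right_comm]
  refine add_le_add ?_ ?_
  · have hblock : ∀ q, ∑ n ∈ Finset.range L, ((1 - 1 / Real.exp 1) * F (q * L + n) y -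
        F (q * L + n) (banditDRSM K Φ η δ L F (q * L + n) ω)) ≤
        (∑ n ∈ Finset.range L, ((1 - 1 / Real.exp 1) * F (q * L + n) u -
        F (q * L + n) (rftl K Φ η (gradSum K Φ η δ L F ω q)))) + (L * (L₁ * ε) + L₁ * D) := by
      intro q
      have h1 : ∀ n ∈ Finset.range L, (1 - 1 / Real.exp 1) * F (q * L + n) y -
          F (q * L + n) (banditDRSM K Φ η δ L F (q * L + n) ω) ≤
          ((1 - 1 / Real.exp 1) * F (q * L + n) u -
          F (q * L + n) (rftl K Φ η (gradSum K Φ η δ L F ω q))) +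
          (L₁ * ε + if n = (ω q).1 then L₁ * D else 0) := by
        intro n hn
        have h2 : F (q * L + n) y - F (q * L + n) u ≤ L₁ * ε :=
          ((le_abs_self _).trans ((H.reward _).abs_sub_le H.nonneg_L₁ y u)).trans
            (mul_le_mul_of_nonneg_left hyu H.nonneg_L₁)
        have hε : 0 ≤ L₁ * ε := mul_nonneg H.nonneg_L₁ ((norm_nonneg _).trans hyu)
        have h3 : (1 - 1 / Real.exp 1) * (F (q * L + n) y - F (q * L + n) u) ≤ L₁ * ε :=
          (mul_le_mul_of_nonneg_left h2 hα0).trans (mul_le_of_le_one_left hε hα1)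
        rw [banditDRSM_mul_add K Φ η δ F ω q (Finset.mem_range.1 hn)]
        split_ifs
        · have h4 := (le_abs_self _).trans (H.abs_reward_le (q * L + n)
            (interior_subset (H.rftl_mem η (gradSum K Φ η δ L F ω q))))
          have h5 := (H.reward (q * L + n)).nonneg
            (exploreAction Φ δ (rftl K Φ η (gradSum K Φ η δ L F ω q)) (ω q))
          linarith
        · linarith
      refine (Finset.sum_le_sum h1).trans_eq ?_
      rw [Finset.sum_add_distrib, Finset.sum_add_distrib, Finset.sum_ite_eq',
        if_pos (Finset.mem_range.2 (hω q).1)]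
      simp
    refine (Finset.sum_le_sum fun q _ => hblock q).trans_eq ?_
    rw [Finset.sum_add_distrib]
    simp [mul_add]
  · calc _ ≤ ∑ _n ∈ Finset.range (T % L), L₁ * D := by
          refine Finset.sum_le_sum fun n _ => ?_
          have h4 := (le_abs_self _).trans (H.abs_reward_le (T / L * L + n) hy)
          have h5 := (H.reward (T / L * L + n)).nonneg
            (banditDRSM K Φ η δ L F (T / L * L + n) ω)
          have h6 := (H.reward (T / L * L + n)).nonneg y
          nlinarith
      _ = (T % L : ℕ) * (L₁ * D) := by simp
      _ ≤ L * (L₁ * D) := by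
          gcongr
          exact (Nat.mod_lt T (Nat.pos_of_ne_zero (NeZero.ne L))).le

variable [NeZero d] [NeZero L]

lemma IsInstance.integrable_reward (H : IsInstance K U ν Φ L₁ L₂ D δ F) (η : ℝ) (t t' : ℕ) :
    Integrable (fun ω => F t (banditDRSM K Φ η δ L F t' ω)) (tapeLaw d L) := by
  refine Integrable.of_bound ((H.reward t).lipschitz.continuous.measurable.comp
    (H.measurable_banditDRSM η L t')).aestronglyMeasurable (L₁ * D) ?_
  filter_upwards [ae_tapeLaw] with ω hω
  exact H.abs_reward_le t (H.banditDRSM_mem η t' hω)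

lemma IsInstance.integrable_reward_state (H : IsInstance K U ν Φ L₁ L₂ D δ F) (η : ℝ) (t q : ℕ) :
    Integrable (fun ω => F t (rftl K Φ η (gradSum K Φ η δ L F ω q))) (tapeLaw d L) :=
  Integrable.of_bound ((H.reward t).lipschitz.continuous.measurable.comp
    ((H.continuous_rftl η).measurable.comp (H.measurable_gradSum η L q))).aestronglyMeasurable
    (L₁ * D) (Eventually.of_forall fun _ => H.abs_reward_le t (interior_subset (H.rftl_mem η _)))

/-- The expected linearized gain of a block, given the state, dominates the average gain of the
block. -/
lemma IsInstance.le_integral_gradStep (H : IsInstance K U ν Φ L₁ L₂ D δ F) (hδ : δ < 1) (η : ℝ)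
    (q : ℕ) (g : Vec d) {u : Vec d} (hu : u ∈ K) :
    (L : ℝ)⁻¹ * ∑ n ∈ Finset.range L, ((1 - 1 / Real.exp 1) * F (q * L + n) u -
        F (q * L + n) (rftl K Φ η g) - 2 * L₂ * (δ * D) ^ 2) ≤
      ∫ s, inner ℝ (gradStep K Φ η δ L F q (g, s)) (u - rftl K Φ η g) ∂seedLaw d L := by
  obtain ⟨R, hR⟩ := H.exists_gradStep_bound η L q ‖g‖
  have hm : Measurable fun s : Seed d =>
      inner ℝ (gradStep K Φ η δ L F q (g, s)) (u - rftl K Φ η g) :=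
    ((H.measurable_gradStep η L q).comp (measurable_const.prodMk measurable_id)).inner
      measurable_const
  rw [integral_seedLaw hm (C := R * ‖u - rftl K Φ η g‖) fun s hs =>
    (abs_real_inner_le_norm _ _).trans
      (mul_le_mul_of_nonneg_right (hR g le_rfl s hs) (norm_nonneg _))]
  refine mul_le_mul_of_nonneg_left (Finset.sum_le_sum fun n _ => ?_) (by positivity)
  refine ((H.reward (q * L + n)).le_integral_estimator H.nonneg_L₁ H.nonneg_L₂ H.barrier H.nonneg_D
    H.subset_ball H.smul_mem (H.rftl_mem η g) H.pos_δ hδ hu).trans_eq ?_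
  rw [← integral_const_mul]
  refine integral_congr_ae (Eventually.of_forall fun z => ?_)
  simp only
  rw [← integral_const_mul, ← integral_const_mul]
  refine integral_congr_ae (Eventually.of_forall fun v => ?_)
  simp only [gradStep, inner_gradEstimate, exploreAction]
  ring

/-- The expectation of the linearized gain of block `q`. -/
lemma IsInstance.le_expected_gain (H : IsInstance K U ν Φ L₁ L₂ D δ F) (hδ : δ < 1) (η : ℝ) (q : ℕ)
    {u : Vec d} (hu : u ∈ K) :
    Integrable (fun ω => inner ℝ (gradStep K Φ η δ L F q (gradSum K Φ η δ L F ω q, ω q))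
      (u - rftl K Φ η (gradSum K Φ η δ L F ω q))) (tapeLaw d L) ∧
    (L : ℝ)⁻¹ * ∫ ω, ∑ n ∈ Finset.range L, ((1 - 1 / Real.exp 1) * F (q * L + n) u -
        F (q * L + n) (rftl K Φ η (gradSum K Φ η δ L F ω q)) - 2 * L₂ * (δ * D) ^ 2)
        ∂tapeLaw d L ≤
      ∫ ω, inner ℝ (gradStep K Φ η δ L F q (gradSum K Φ η δ L F ω q, ω q))
        (u - rftl K Φ η (gradSum K Φ η δ L F ω q)) ∂tapeLaw d L := by
  obtain ⟨R, hR⟩ := H.exists_gradSum_bound η L q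
  obtain ⟨R', hR'⟩ := H.exists_gradStep_bound η L q R
  have hΨ : Measurable fun p : Vec d × Seed d =>
      inner ℝ (gradStep K Φ η δ L F q p) (u - rftl K Φ η p.1) :=
    (H.measurable_gradStep η L q).inner
      (measurable_const.sub ((H.continuous_rftl η).measurable.comp measurable_fst))
  have hint : Integrable (fun ω => inner ℝ (gradStep K Φ η δ L F q (gradSum K Φ η δ L F ω q, ω q))
      (u - rftl K Φ η (gradSum K Φ η δ L F ω q))) (tapeLaw d L) := by
    refine Integrable.of_bound (hΨ.comp ((H.measurable_gradSum η L q).prodMk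
      (measurable_pi_apply q))).aestronglyMeasurable (R' * (D + D)) ?_
    filter_upwards [ae_tapeLaw] with ω hω
    have h1 := hR' _ (hR ω hω) _ (hω q)
    refine (norm_inner_le_norm _ _).trans (mul_le_mul h1 ?_ (norm_nonneg _)
      ((norm_nonneg _).trans h1))
    exact (norm_sub_le _ _).trans (add_le_add (H.norm_le hu)
      (H.norm_le (interior_subset (H.rftl_mem η _))))
  refine ⟨hint, ?_⟩
  obtain ⟨hint2, heq⟩ := H.integral_state_seed η L q hΨ hint
  rw [heq, ← integral_const_mul]
  refine integral_mono (Integrable.const_mul (integrable_finsetSum _ fun n _ => ?_) _) hint2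
    fun ω => H.le_integral_gradStep hδ η q _ hu
  exact ((integrable_const _).sub (H.integrable_reward_state η _ q)).sub (integrable_const _)

/-- The expected regret for general parameters. -/
lemma IsInstance.expected_regret_le (H : IsInstance K U ν Φ L₁ L₂ D δ F) (hδ : δ < 1)
    (hη : 0 < η) (hT : 1 ≤ T)
    (hη2 : η * (d * L₁ * D / δ) ≤ 1 / 2) {y : Vec d} (hy : y ∈ K) :
    ∫ ω, ∑ t ∈ Finset.range T, ((1 - 1 / Real.exp 1) * F t y -
        F t (banditDRSM K Φ η δ L F t ω)) ∂tapeLaw d L ≤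
      L * ((ν * Real.log T + (T / L : ℕ) * (η * (d * L₁ * D / δ)) ^ 2) / η) +
        (T / L : ℕ) * (L * (2 * L₂ * (δ * D) ^ 2)) +
        ((T / L : ℕ) * (L * (L₁ * (2 * D / T)) + L₁ * D) + L * (L₁ * D)) := by
  set Q := T / L
  have hTpos : (0 : ℝ) < T := by exact_mod_cast hT
  have hLpos : (0 : ℝ) < L := Nat.cast_pos.2 (Nat.pos_of_ne_zero (NeZero.ne L))
  have hLDδ : 0 ≤ d * L₁ * D / δ := by
    have h1 := H.nonneg_L₁
    have h2 := H.nonneg_D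
    have h3 := H.pos_δ
    positivity
  set τ : ℝ := 1 - (T : ℝ)⁻¹ with hτdef
  have hτ : τ ∈ Ico (0 : ℝ) 1 :=
    ⟨sub_nonneg.2 (inv_le_one_of_one_le₀ (by exact_mod_cast hT)), by
      have := inv_pos.2 hTpos
      linarith⟩
  set x₁ := rftl K Φ η 0
  have hx₁ := H.rftl_mem η 0
  set u := x₁ + τ • (y - x₁) with hu_def
  have hu : u ∈ K := interior_subset (H.barrier.add_smul_sub_mem hx₁ (subset_closure hy) hτ)
  have hyu : ‖y - u‖ ≤ 2 * D / T := by
    have h1 : y - u = (T : ℝ)⁻¹ • (y - x₁) := by rw [hu_def, hτdef]; module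
    rw [h1, norm_smul, Real.norm_eq_abs, abs_of_pos (inv_pos.2 hTpos), div_eq_inv_mul]
    gcongr
    linarith [norm_sub_le y x₁, H.norm_le hy, H.norm_le (interior_subset hx₁)]
  -- The regret of the linearized problem, tape by tape.
  have hlin : ∑ q ∈ Finset.range Q, ∫ ω, inner ℝ
      (gradStep K Φ η δ L F q (gradSum K Φ η δ L F ω q, ω q))
      (u - rftl K Φ η (gradSum K Φ η δ L F ω q)) ∂tapeLaw d L ≤
      (ν * Real.log T + Q * (η * (d * L₁ * D / δ)) ^ 2) / η := by
    rw [← integral_finsetSum _ fun q _ => (H.le_expected_gain hδ η q hu).1]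
    have hc : ∫ _ω, (ν * Real.log T + Q * (η * (d * L₁ * D / δ)) ^ 2) / η ∂tapeLaw d L =
        (ν * Real.log T + Q * (η * (d * L₁ * D / δ)) ^ 2) / η := by simp
    rw [← hc]
    refine integral_mono_ae (integrable_finsetSum _ fun q _ => (H.le_expected_gain hδ η q hu).1)
      (integrable_const _) ?_
    filter_upwards [ae_tapeLaw] with ω hω
    rw [le_div_iff₀' hη]
    have := H.barrier.rftl_regret H.isCompact η (fun q => gradSum K Φ η δ L F ω q)
      (fun q => gradStep K Φ η δ L F q (gradSum K Φ η δ L F ω q, ω q)) rfl Q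
      (fun q _ => gradSum_succ K Φ η δ L F ω q) (mul_nonneg hη.le hLDδ) hη2
      (fun q _ h => by
        rw [mul_assoc]
        exact mul_le_mul_of_nonneg_left ((le_abs_self _).trans
          (H.abs_inner_gradEstimate_le (H.rftl_mem η _) (hω q).2 _ h)) hη.le) hy hτ
    refine this.trans_eq ?_
    rw [hτdef, sub_sub_cancel, Real.log_inv]
    ring
  set c := 2 * L₂ * (δ * D) ^ 2
  set S : ℕ → (ℕ → Seed d) → ℝ := fun q ω => ∑ n ∈ Finset.range L,
    ((1 - 1 / Real.exp 1) * F (q * L + n) u -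
      F (q * L + n) (rftl K Φ η (gradSum K Φ η δ L F ω q))) with hS
  have hSint : ∀ q, Integrable (S q) (tapeLaw d L) := fun q =>
    integrable_finsetSum _ fun n _ =>
      (integrable_const _).sub (H.integrable_reward_state η _ q)
  have hgain : ∀ q, ∫ ω, S q ω ∂tapeLaw d L ≤ L * (∫ ω, inner ℝ
      (gradStep K Φ η δ L F q (gradSum K Φ η δ L F ω q, ω q))
      (u - rftl K Φ η (gradSum K Φ η δ L F ω q)) ∂tapeLaw d L) + L * c := by
    intro q
    have h2 : ∀ ω, ∑ n ∈ Finset.range L, ((1 - 1 / Real.exp 1) * F (q * L + n) u -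
        F (q * L + n) (rftl K Φ η (gradSum K Φ η δ L F ω q)) - c) = S q ω - L * c := by
      intro ω
      rw [Finset.sum_sub_distrib]
      simp [hS]
    have h1 := (congrArg (fun I => (L : ℝ)⁻¹ * I)
      (integral_congr_ae (Eventually.of_forall h2))).symm.trans_le (H.le_expected_gain hδ η q hu).2
    rw [integral_sub (hSint q) (integrable_const _), inv_mul_le_iff₀ hLpos] at h1
    simp only [integral_const, probReal_univ, one_smul] at h1
    linarith
  calc _ ≤ ∫ ω, (∑ q ∈ Finset.range Q, S q ω) +
        (Q * (L * (L₁ * (2 * D / T)) + L₁ * D) + L * (L₁ * D)) ∂tapeLaw d L := by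
        refine integral_mono_ae (integrable_finsetSum _ fun t _ =>
          (integrable_const _).sub (H.integrable_reward η t t))
          ((integrable_finsetSum _ fun q _ => hSint q).add (integrable_const _)) ?_
        filter_upwards [ae_tapeLaw] with ω hω
        exact H.sum_regret_le η hω hy hyu
    _ = (∑ q ∈ Finset.range Q, ∫ ω, S q ω ∂tapeLaw d L) +
        (Q * (L * (L₁ * (2 * D / T)) + L₁ * D) + L * (L₁ * D)) := by
        rw [integral_add (integrable_finsetSum _ fun q _ => hSint q) (integrable_const _),
          integral_finsetSum _ fun q _ => hSint q]
        simp
    _ ≤ _ := by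
        refine add_le_add_left ?_ _
        refine (Finset.sum_le_sum fun q _ => hgain q).trans ?_
        rw [Finset.sum_add_distrib, ← Finset.mul_sum]
        simp only [Finset.sum_const, Finset.card_range, nsmul_eq_mul]
        gcongr

/-- The trivial bound: every round costs at most `L₁ D`. -/
lemma IsInstance.expected_regret_le_trivial (H : IsInstance K U ν Φ L₁ L₂ D δ F) (η : ℝ) (T : ℕ)
    {y : Vec d} (hy : y ∈ K) :
    ∫ ω, ∑ t ∈ Finset.range T, ((1 - 1 / Real.exp 1) * F t y -
        F t (banditDRSM K Φ η δ L F t ω)) ∂tapeLaw d L ≤ T * (L₁ * D) := by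
  have hc : ∫ _ω, (T : ℝ) * (L₁ * D) ∂tapeLaw d L = T * (L₁ * D) := by simp
  rw [← hc]
  refine integral_mono (integrable_finsetSum _ fun t _ =>
    (integrable_const _).sub (H.integrable_reward η t t)) (integrable_const _) fun ω => ?_
  calc _ ≤ ∑ _t ∈ Finset.range T, L₁ * D := by
        refine Finset.sum_le_sum fun t _ => ?_
        have h4 := (le_abs_self _).trans (H.abs_reward_le t hy)
        have h5 := (H.reward t).nonneg (banditDRSM K Φ η δ L F t ω)
        have h6 := (H.reward t).nonneg y
        have hα0 := one_sub_inv_exp_nonneg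
        have hα1 := one_sub_inv_exp_le_one
        nlinarith
    _ = _ := by simp

end Regret

/-! ### The choice of parameters -/

/-- The bound of `IsInstance.expected_regret_le` for `d = s ^ 4`, `T = t ^ 8`, `δ = s / t`,
`η = D⁻² s⁻⁴ t⁻⁴` and a block length `ℓ` of order `t ^ 2 / s ^ 2`. -/
lemma regret_bound_le {s t D L₁ L₂ N ℓ Q : ℝ} (hs : 1 ≤ s) (ht : 1 ≤ t) (hD : 0 < D)
    (hL₁ : 0 ≤ L₁) (hL₂ : 0 ≤ L₂) (hN : 0 ≤ N) (hQ : 0 ≤ Q)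
    (hlow : t ^ 2 / s ^ 2 ≤ 2 * ℓ) (hupp : ℓ ≤ t ^ 2 / s ^ 2) (hQℓ : Q * ℓ ≤ t ^ 8) :
    ℓ * ((N + Q * ((D ^ 2 * s ^ 4 * t ^ 4)⁻¹ * (s ^ 4 * L₁ * D / (s / t))) ^ 2) /
        (D ^ 2 * s ^ 4 * t ^ 4)⁻¹) + Q * (ℓ * (2 * L₂ * (s / t * D) ^ 2)) +
      (Q * (ℓ * (L₁ * (2 * D / t ^ 8)) + L₁ * D) + ℓ * (L₁ * D)) ≤
    s ^ 2 * t ^ 6 * (D ^ 2 * N + (L₁ ^ 2 + 2 * L₂ * D ^ 2 + 5 * (L₁ * D))) := by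
  have hs0 : 0 < s := by linarith
  have ht0 : 0 < t := by linarith
  have hLD : 0 ≤ L₁ * D := by positivity
  have hℓ : 0 ≤ ℓ := by have : 0 ≤ t ^ 2 / s ^ 2 := by positivity
                        linarith
  have hR : 1 ≤ s ^ 2 * t ^ 6 := one_le_mul_of_one_le_of_one_le (one_le_pow₀ hs) (one_le_pow₀ ht)
  have e1 : ℓ * ((N + Q * ((D ^ 2 * s ^ 4 * t ^ 4)⁻¹ * (s ^ 4 * L₁ * D / (s / t))) ^ 2) /
      (D ^ 2 * s ^ 4 * t ^ 4)⁻¹) =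
      ℓ * (D ^ 2 * s ^ 4 * t ^ 4 * N) + (Q * ℓ) * (L₁ ^ 2 * s ^ 2 / t ^ 2) := by
    field_simp
  have e2 : Q * (ℓ * (2 * L₂ * (s / t * D) ^ 2)) =
      (Q * ℓ) * (2 * L₂ * D ^ 2 * s ^ 2 / t ^ 2) := by field_simp
  have e3 : Q * (ℓ * (L₁ * (2 * D / t ^ 8)) + L₁ * D) =
      (Q * ℓ) * (2 * (L₁ * D) / t ^ 8) + Q * (L₁ * D) := by field_simp
  have b1 : ℓ * (D ^ 2 * s ^ 4 * t ^ 4 * N) ≤ s ^ 2 * t ^ 6 * (D ^ 2 * N) := by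
    calc _ ≤ t ^ 2 / s ^ 2 * (D ^ 2 * s ^ 4 * t ^ 4 * N) := by gcongr
      _ = _ := by field_simp
  have b2 : (Q * ℓ) * (L₁ ^ 2 * s ^ 2 / t ^ 2) ≤ s ^ 2 * t ^ 6 * L₁ ^ 2 := by
    calc _ ≤ t ^ 8 * (L₁ ^ 2 * s ^ 2 / t ^ 2) := by gcongr
      _ = _ := by field_simp
  have b3 : (Q * ℓ) * (2 * L₂ * D ^ 2 * s ^ 2 / t ^ 2) ≤ s ^ 2 * t ^ 6 * (2 * L₂ * D ^ 2) := by
    calc _ ≤ t ^ 8 * (2 * L₂ * D ^ 2 * s ^ 2 / t ^ 2) := by gcongr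
      _ = _ := by field_simp
  have b4 : (Q * ℓ) * (2 * (L₁ * D) / t ^ 8) ≤ s ^ 2 * t ^ 6 * (2 * (L₁ * D)) := by
    calc _ ≤ t ^ 8 * (2 * (L₁ * D) / t ^ 8) := by gcongr
      _ = 1 * (2 * (L₁ * D)) := by field_simp
      _ ≤ _ := by gcongr
  have b5 : Q * (L₁ * D) ≤ s ^ 2 * t ^ 6 * (2 * (L₁ * D)) := by
    have h1 : Q ≤ 2 * (s ^ 2 * t ^ 6) := by
      have h2 : Q * (t ^ 2 / s ^ 2) ≤ 2 * t ^ 8 := by nlinarith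
      rw [mul_div_assoc', div_le_iff₀ (by positivity)] at h2
      have h3 : Q * t ^ 2 ≤ 2 * (s ^ 2 * t ^ 6) * t ^ 2 := by linarith
      exact le_of_mul_le_mul_right h3 (by positivity)
    calc _ ≤ 2 * (s ^ 2 * t ^ 6) * (L₁ * D) := by gcongr
      _ = _ := by ring
  have b6 : ℓ * (L₁ * D) ≤ s ^ 2 * t ^ 6 * (L₁ * D) := by
    have h1 : t ^ 2 / s ^ 2 ≤ s ^ 2 * t ^ 6 := by
      calc t ^ 2 / s ^ 2 ≤ t ^ 2 := div_le_self (by positivity) (one_le_pow₀ hs)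
        _ ≤ t ^ 6 := pow_le_pow_right₀ ht (by norm_num)
        _ ≤ _ := le_mul_of_one_le_left (by positivity) (one_le_pow₀ hs)
    gcongr
    linarith
  rw [e1, e2, e3]
  linarith

section Instance

variable {d T : ℕ} {a : Fin d → ℝ} {K : Set (Vec d)} {ν L₁ L₂ D δ η : ℝ} {Φ : Vec d → ℝ}
  {f : ℕ → Vec d → ℝ}

/-- The rewards of the first `T` rounds, extended to the whole space; later rounds, in which the
last, incomplete block may still explore, get the zero reward. -/
def extendRewards (a : Fin d → ℝ) (T : ℕ) (f : ℕ → Vec d → ℝ) (t : ℕ) : Vec d → ℝ :=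
  if t < T then f t ∘ clampBox a else fun _ => 0

lemma eqOn_extendRewards (hKa : K ⊆ box a) {t : ℕ} (ht : t < T) :
    EqOn (f t) (extendRewards a T f t) K := fun x hx => by
  rw [extendRewards, if_pos ht, Function.comp_apply, clampBox_of_mem (hKa hx)]

lemma isInstance_extendRewards (hL₁ : 0 ≤ L₁) (hL₂ : 0 ≤ L₂) (hD : 0 ≤ D) (hK : IsCompact K)
    (h0 : (0 : Vec d) ∈ K) (hKD : K ⊆ Metric.closedBall 0 D) (hKa : K ⊆ box a)
    (hΦ : IsSelfConcordantBarrier K ν Φ) (hf : ∀ t < T, IsReward a L₁ L₂ (f t)) (hδ : 0 < δ)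
    (hδ1 : δ ≤ 1) :
    IsInstance K (interior (box a)) ν Φ L₁ L₂ D δ (extendRewards a T f) where
  isCompact := hK
  zero_mem := h0
  nonneg_D := hD
  nonneg_L₁ := hL₁
  nonneg_L₂ := hL₂
  subset_ball := hKD
  barrier := hΦ
  smul_mem w hw z hz := by
    have := (convex_box a).combo_interior_closure_mem_interior (interior_mono hKa hw)
      (subset_closure (hKa h0)) (a := z) (b := 1 - z) hz.1 (by linarith [hz.2]) (by ring)
    simpa using this
  reward t := by
    by_cases ht : t < T
    · have h := (hf t ht).isExtendedReward hL₁ fun i => (hKa h0 i).1.trans (hKa h0 i).2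
      rw [extendRewards, if_pos ht]
      exact { h with sub_le_fderiv := fun x hx y hy => h.sub_le_fderiv x hx y (hKa hy) }
    · rw [extendRewards, if_neg ht]
      refine ⟨rfl, fun _ => le_rfl, LipschitzWith.const' 0, fun _ _ => by fun_prop,
        fun x _ y _ => ?_, fun x _ y _ => ?_⟩
      · simpa using mul_nonneg hL₂ (norm_nonneg (x - y))
      · simp
  pos_δ := hδ
  δ_le_one := hδ1

lemma IsInstance.banditDRSM_eq {U : Set (Vec d)} {F : ℕ → Vec d → ℝ}
    (H : IsInstance K U ν Φ L₁ L₂ D δ F) {L : ℕ}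
    (hf : ∀ t < T, EqOn (f t) (F t) K) {ω : ℕ → Seed d} (hω : ∀ q, ω q ∈ goodSeeds d L)
    {t : ℕ} (ht : t < T) :
    banditDRSM K Φ η δ L f t ω = banditDRSM K Φ η δ L F t ω := by
  simp only [banditDRSM]
  rw [H.gradSum_eq hf hω ((Nat.div_mul_le_self t L).trans ht.le)]

end Instance

/-- The expected regret in terms of `t = T ^ (1 / 8)` and `s = d ^ (1 / 4)`. The trivial bound
suffices if `t ≤ s` or if `t ^ 3 s` is bounded, when the step size is too large for the stability of
the iterates. -/
lemma IsInstance.expected_regret_le_rpow {d T L : ℕ} [NeZero d] [NeZero L] {K U : Set (Vec d)}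
    {ν L₁ L₂ D δ η s t : ℝ} {Φ : Vec d → ℝ} {F : ℕ → Vec d → ℝ}
    (H : IsInstance K U ν Φ L₁ L₂ D δ F) (hD : 0 < D) (hT : 2 ≤ T) (hs : 1 ≤ s) (ht : 1 ≤ t)
    (hds : (d : ℝ) = s ^ 4) (hTt : (T : ℝ) = t ^ 8) (hδ : δ = min 1 (s / t))
    (hη : η = (D ^ 2 * s ^ 4 * t ^ 4)⁻¹) (hL : L = max 1 ⌊t ^ 2 / s ^ 2⌋₊)
    (hN : 0 ≤ ν * Real.log T) {y : Vec d} (hy : y ∈ K) :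
    ∫ ω, ∑ r ∈ Finset.range T, ((1 - 1 / Real.exp 1) * F r y -
        F r (banditDRSM K Φ η δ L F r ω)) ∂tapeLaw d L ≤
      s ^ 2 * t ^ 6 * (D ^ 2 * (ν * Real.log T) +
        (3 * L₁ ^ 2 + 2 * L₂ * D ^ 2 + 5 * (L₁ * D))) := by
  have hL₁ := H.nonneg_L₁
  have hL₂ := H.nonneg_L₂
  have hLD : 0 ≤ L₁ * D := by positivity
  have hLD2 : 0 ≤ L₂ * D ^ 2 := by positivity
  have hs0 : 0 < s := by linarith
  have ht0 : 0 < t := by linarith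
  have hDN : 0 ≤ D ^ 2 * (ν * Real.log T) := by positivity
  have hR0 : 0 ≤ s ^ 2 * t ^ 6 := by positivity
  have htriv := H.expected_regret_le_trivial (L := L) η T hy
  rcases le_or_gt t s with hts | hts
  · refine htriv.trans ?_
    have h1 : (T : ℝ) ≤ s ^ 2 * t ^ 6 := by
      calc (T : ℝ) = t ^ 2 * t ^ 6 := by rw [hTt]; ring
        _ ≤ s ^ 2 * t ^ 6 := by gcongr
    calc (T : ℝ) * (L₁ * D) ≤ s ^ 2 * t ^ 6 * (L₁ * D) := by gcongr
      _ ≤ _ := mul_le_mul_of_nonneg_left (by linarith [sq_nonneg L₁]) hR0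
  have hδ' : δ = s / t := by rw [hδ, min_eq_right ((div_le_one ht0).2 hts.le)]
  rcases lt_or_ge (t ^ 3 * s * D) (2 * L₁) with hbig | hsmall
  · refine htriv.trans ?_
    have h1 : t ^ 2 * D ≤ 2 * L₁ := by
      refine le_trans ?_ hbig.le
      have : t ^ 2 ≤ t ^ 3 * s := by
        calc t ^ 2 ≤ t ^ 3 := pow_le_pow_right₀ ht (by norm_num)
          _ ≤ _ := le_mul_of_one_le_right (by positivity) hs
      gcongr
    have h2 : t ^ 2 * (L₁ * D) ≤ s ^ 2 * (2 * L₁ ^ 2) := by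
      calc t ^ 2 * (L₁ * D) = L₁ * (t ^ 2 * D) := by ring
        _ ≤ L₁ * (2 * L₁) := by gcongr
        _ = 1 * (2 * L₁ ^ 2) := by ring
        _ ≤ _ := by gcongr; exact one_le_pow₀ hs
    calc (T : ℝ) * (L₁ * D) = t ^ 6 * (t ^ 2 * (L₁ * D)) := by rw [hTt]; ring
      _ ≤ t ^ 6 * (s ^ 2 * (2 * L₁ ^ 2)) := by gcongr
      _ = s ^ 2 * t ^ 6 * (2 * L₁ ^ 2) := by ring
      _ ≤ _ := mul_le_mul_of_nonneg_left (by linarith [sq_nonneg L₁]) hR0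
  have hp : 1 ≤ t ^ 2 / s ^ 2 := by
    rw [one_le_div (by positivity)]
    gcongr
  have hfloor : 1 ≤ ⌊t ^ 2 / s ^ 2⌋₊ := Nat.one_le_floor_iff _ |>.2 hp
  rw [max_eq_right hfloor] at hL
  have hupp : (L : ℝ) ≤ t ^ 2 / s ^ 2 := by
    rw [hL]
    exact Nat.floor_le (by positivity)
  have hlow : t ^ 2 / s ^ 2 ≤ 2 * (L : ℝ) := by
    have h1 := Nat.lt_floor_add_one (t ^ 2 / s ^ 2)
    have h2 : (1 : ℝ) ≤ ⌊t ^ 2 / s ^ 2⌋₊ := by exact_mod_cast hfloor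
    rw [hL]
    linarith
  have hQ : ((T / L : ℕ) : ℝ) * L ≤ t ^ 8 := by
    rw [← hTt]
    exact_mod_cast Nat.div_mul_le_self T L
  have hη2 : η * (d * L₁ * D / δ) ≤ 1 / 2 := by
    have : η * (d * L₁ * D / δ) = L₁ / (t ^ 3 * s * D) := by
      rw [hη, hδ', hds]
      field_simp
    rw [this, div_le_iff₀ (by positivity)]
    linarith
  refine (H.expected_regret_le (L := L) (T := T) (by rw [hδ']; exact (div_lt_one ht0).2 hts)
    (by rw [hη]; positivity) (by omega) hη2 hy).trans ?_
  have hbound := regret_bound_le hs ht hD hL₁ hL₂ hN (Nat.cast_nonneg (T / L)) hlow hupp hQ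
  rw [← hδ', ← hη, ← hds, ← hTt] at hbound
  exact hbound.trans (mul_le_mul_of_nonneg_left (by linarith [sq_nonneg L₁]) hR0)

/-- The expected regret for the prescribed parameters. -/
lemma IsInstance.expected_regret_le_parameters {d T : ℕ} [NeZero d] {K U : Set (Vec d)}
    {ν L₁ L₂ D : ℝ} {Φ : Vec d → ℝ} {F : ℕ → Vec d → ℝ}
    (H : IsInstance K U ν Φ L₁ L₂ D (smoothingRadius d T) F) (hD : 0 < D) (hT : 2 ≤ T)
    {y : Vec d} (hy : y ∈ K) :
    ∫ ω, ∑ t ∈ Finset.range T, ((1 - 1 / Real.exp 1) * F t y -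
        F t (banditDRSM K Φ (learningRate D d T) (smoothingRadius d T) (blockLength d T) F t ω))
        ∂tapeLaw d (blockLength d T) ≤
      (D ^ 2 + 4 * (3 * L₁ ^ 2 + 2 * L₂ * D ^ 2 + 5 * (L₁ * D))) *
        (ν * (d : ℝ) ^ (1 / 2 : ℝ) * (T : ℝ) ^ (3 / 4 : ℝ) * Real.log T) := by
  have hL₁ := H.nonneg_L₁
  have hL₂ := H.nonneg_L₂
  have hd1 : (1 : ℝ) ≤ d := by exact_mod_cast Nat.one_le_iff_ne_zero.2 (NeZero.ne d)
  have hT1 : (1 : ℝ) ≤ T := by exact_mod_cast (show 1 ≤ T by omega)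
  have hd0 : (0 : ℝ) ≤ d := by linarith
  have hT0 : (0 : ℝ) ≤ T := by linarith
  obtain ⟨s, hs⟩ : ∃ s : ℝ, s = (d : ℝ) ^ (1 / 4 : ℝ) := ⟨_, rfl⟩
  obtain ⟨t, ht⟩ : ∃ t : ℝ, t = (T : ℝ) ^ (1 / 8 : ℝ) := ⟨_, rfl⟩
  have hspow (k : ℕ) : s ^ k = (d : ℝ) ^ ((1 / 4 : ℝ) * k) := by
    rw [hs, ← Real.rpow_natCast, ← Real.rpow_mul hd0]
  have htpow (k : ℕ) : t ^ k = (T : ℝ) ^ ((1 / 8 : ℝ) * k) := by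
    rw [ht, ← Real.rpow_natCast, ← Real.rpow_mul hT0]
  have hd4 : (d : ℝ) = s ^ 4 := by rw [hspow]; norm_num
  have hT8 : (T : ℝ) = t ^ 8 := by rw [htpow]; norm_num
  have hd2 : (d : ℝ) ^ (1 / 2 : ℝ) = s ^ 2 := by rw [hspow]; norm_num
  have hT2 : (T : ℝ) ^ (1 / 4 : ℝ) = t ^ 2 := by rw [htpow]; norm_num
  have hT4 : (T : ℝ) ^ (1 / 2 : ℝ) = t ^ 4 := by rw [htpow]; norm_num
  have hT6 : (T : ℝ) ^ (3 / 4 : ℝ) = t ^ 6 := by rw [htpow]; norm_num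
  have hL : blockLength d T = max 1 ⌊t ^ 2 / s ^ 2⌋₊ := by
    rw [blockLength, Real.rpow_neg hd0, hd2, hT2, div_eq_inv_mul]
  have hδ : smoothingRadius d T = min 1 (s / t) := by
    rw [smoothingRadius, Real.rpow_neg hT0, ← div_eq_mul_inv, hs, ht]
  have hη : learningRate D d T = (D ^ 2 * s ^ 4 * t ^ 4)⁻¹ := by
    have h2 : D ^ (-2 : ℝ) = (D ^ 2)⁻¹ := by rw [Real.rpow_neg hD.le]; norm_num
    rw [learningRate, h2, Real.rpow_neg_one, Real.rpow_neg hT0, hT4, ← hd4, mul_inv, mul_inv]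
  have hlog : 1 / 2 ≤ Real.log T := by
    have h1 : Real.log 2 ≤ Real.log T := Real.log_le_log two_pos (by exact_mod_cast hT)
    linarith [Real.log_two_gt_d9]
  have hν : 1 / 2 ≤ ν := H.barrier.half_le_nu H.isCompact
  have hN : 1 ≤ 4 * (ν * Real.log T) := by nlinarith
  refine (H.expected_regret_le_rpow hD hT (hs ▸ Real.one_le_rpow hd1 (by norm_num))
    (ht ▸ Real.one_le_rpow hT1 (by norm_num)) hd4 hT8 hδ hη hL (by linarith) hy).trans ?_
  have h1 : s ^ 2 * t ^ 6 * (3 * L₁ ^ 2 + 2 * L₂ * D ^ 2 + 5 * (L₁ * D)) ≤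
      s ^ 2 * t ^ 6 * (3 * L₁ ^ 2 + 2 * L₂ * D ^ 2 + 5 * (L₁ * D)) * (4 * (ν * Real.log T)) :=
    le_mul_of_one_le_right (by positivity) hN
  rw [hd2, hT6]
  linarith

end

end DRSM

theorem theorem4p1 (L₁ L₂ D : ℝ) (hL₁ : 0 ≤ L₁) (hL₂ : 0 ≤ L₂) (hD : 0 < D) :
    ∃ C : ℝ, ∀ (d : ℕ) [NeZero d] (a : Fin d → ℝ) (K : Set (DRSM.Vec d)) (ν : ℝ)
      (Φ : DRSM.Vec d → ℝ) (T : ℕ) (f : ℕ → DRSM.Vec d → ℝ),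
      IsCompact K → Convex ℝ K → (0 : DRSM.Vec d) ∈ K →
      K ⊆ Metric.closedBall (0 : DRSM.Vec d) D → K ⊆ DRSM.box a →
      DRSM.IsSelfConcordantBarrier K ν Φ →
      2 ≤ T →
      (∀ t < T, DRSM.IsReward a L₁ L₂ (f t)) →
      let L : ℕ := DRSM.blockLength d T
      let P : Measure (ℕ → DRSM.Seed d) := DRSM.tapeLaw d L
      let y : ℕ → (ℕ → DRSM.Seed d) → DRSM.Vec d :=
        DRSM.banditDRSM K Φ (DRSM.learningRate D d T) (DRSM.smoothingRadius d T) L f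
      (∀ᵐ ω ∂P, ∀ t < T, y t ω ∈ K) ∧
      (∀ t < T, Integrable (fun ω => f t (y t ω)) P) ∧
      DRSM.expectedRegret P (1 - 1 / Real.exp 1) K f y T ≤
        ((C * (ν * (d : ℝ) ^ (1 / 2 : ℝ) * (T : ℝ) ^ (3 / 4 : ℝ) * Real.log T) : ℝ) : EReal) := by
  refine ⟨D ^ 2 + 4 * (3 * L₁ ^ 2 + 2 * L₂ * D ^ 2 + 5 * (L₁ * D)), ?_⟩
  intro d _ a K ν Φ T f hK _ h0 hKD hKa hΦ hT hf L P y
  have hδ0 : 0 < DRSM.smoothingRadius d T := by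
    have hd : (0 : ℝ) < d := Nat.cast_pos.2 (Nat.pos_of_ne_zero (NeZero.ne d))
    have hT0 : (0 : ℝ) < T := Nat.cast_pos.2 (by omega)
    exact lt_min one_pos (by positivity)
  have H := DRSM.isInstance_extendRewards hL₁ hL₂ hD.le hK h0 hKD hKa hΦ hf hδ0 (min_le_left _ _)
  set F := DRSM.extendRewards a T f
  have hfF : ∀ t < T, EqOn (f t) (F t) K := fun t ht => DRSM.eqOn_extendRewards hKa ht
  set y' := DRSM.banditDRSM K Φ (DRSM.learningRate D d T) (DRSM.smoothingRadius d T) L F with hy'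
  have hgood : ∀ᵐ ω ∂P, ∀ q, ω q ∈ DRSM.goodSeeds d L := DRSM.ae_tapeLaw
  have hval : ∀ᵐ ω ∂P, ∀ t < T, y t ω ∈ K ∧ f t (y t ω) = F t (y' t ω) := by
    filter_upwards [hgood] with ω hω t ht
    have h1 : y t ω = y' t ω := H.banditDRSM_eq hfF hω ht
    have h2 : y' t ω ∈ K := H.banditDRSM_mem _ t hω
    rw [h1]
    exact ⟨h2, hfF t ht h2⟩
  refine ⟨hval.mono fun ω h t ht => (h t ht).1, fun t ht => ?_, ?_⟩
  · refine (H.integrable_reward (DRSM.learningRate D d T) t t).congr ?_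
    filter_upwards [hval] with ω h using (h t ht).2.symm
  · refine iSup₂_le fun x hx => EReal.coe_le_coe_iff.2 ?_
    refine le_trans (le_of_eq (integral_congr_ae ?_)) (H.expected_regret_le_parameters hD hT hx)
    filter_upwards [hval] with ω h
    refine Finset.sum_congr rfl fun t ht => ?_
    have ht' := Finset.mem_range.1 ht
    rw [(h t ht').2, hfF t ht' hx]
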